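/- Let $\mathbb K$ be an algebraically closed field. Let $A=(a_{ij})_{i,j\in I}$ be a symmetrizable Borcherds–Cartan matrix: an integer matrix with $a_{ii}\in\{2,0,-2,-4,\dots\}$ and $a_{ij}\le 0$ for $i\ne j$, together with integers $r_i>0$ such that $r_ia_{ij}=r_ja_{ji}$ for all $i,j$; put $(\alpha_i,\alpha_j)=r_ia_{ij}$. For $\nu=\sum_i\nu_i i\in\mathbb N[I]$ of height $m=\sum_i\nu_i$, let $\mathrm{Seq}(\nu)$ be the set of sequences $\mathbf i=i_1\cdots i_m$ in $I$ with $i_1+\dots+i_m=\nu$. Let $R(\nu)$ be the graded unital $\mathbb K$-algebra with the following generators and relations. (For a product, the right factor acts first; $s_k$ exchanges the $k$-th and $(k+1)$-st entries of a sequence.) The generators are $1_{\mathbf i}$, $x_{k,\mathbf i}$ $(1\le k\le m)$, $\tau_{k,\mathbf i}$ $(1\le k<m)$ for $\mathbf i\in\mathrm{Seq}(\nu)$, of degrees $0$, $2r_{i_k}$, $-(\alpha_{i_k},\alpha_{i_{k+1}})$. The $1_{\mathbf i}$ are orthogonal idempotents with sum $1$, and $x_{k,\mathbf i}=1_{\mathbf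 i}x_{k,\mathbf i}1_{\mathbf i}$, $\tau_{k,\mathbf i}=1_{s_k\mathbf i}\tau_{k,\mathbf i}1_{\mathbf i}$. With $x_k=\sum_{\mathbf i}x_{k,\mathbf i}$ and $\tau_k=\sum_{\mathbf i}\tau_{k,\mathbf i}$, the $x_k$ commute with each other, $\tau_kx_l=x_l\tau_k$ for $l\ne k,k+1$, $\tau_k\tau_l=\tau_l\tau_k$ for $|k-l|>1$, and the following local relations hold: * $\tau_k^2 1_{\mathbf i}=0$ if $i_k=i_{k+1}$; $\tau_k^21_{\mathbf i}=1_{\mathbf i}$ if $i_k\neq i_{k+1}$ and $(\alpha_{i_k},\alpha_{i_{k+1}})=0$; and $\tau_k^21_{\mathbf i}=(x_k^{-a_{i_ki_{k+1}}}+x_{k+1}^{-a_{i_{k+1}i_k}})1_{\mathbf i}$ otherwise. * $(x_k\tau_k-\tau_kx_{k+1})1_{\mathbf i}=(\tau_kx_k-x_{k+1}\tau_k)1_{\mathbf i}$, and this element is $1_{\mathbf i}$ if $i_k=i_{k+1}$ and $a_{i_ki_k}=2$, and $0$ otherwise. * $(\tau_k\tau_{k+1}\tau_k-\tau_{k+1}\tau_k\tau_{k+1})1_{\mathbf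 i}=\sum_{c=0}^{-a_{ij}-1}x_k^{c}x_{k+2}^{-a_{ij}-1-c}1_{\mathbf i}$ if $(i_k,i_{k+1},i_{k+2})=(i,j,i)$ with $a_{ii}=2$, $i\ne j$ and $(\alpha_i,\alpha_j)\neq0$, and $=0$ otherwise. All modules are $\mathbb Z$-graded left modules. A nonzero graded module is *gr-irreducible* if it has no graded submodules other than $0$ and itself, and $\operatorname{soc}M$ is the sum of the gr-irreducible graded submodules of $M$. Juxtaposition of diagrams gives a homomorphism, unital onto a corner, $R(\nu)\otimes R(\nu')\to 1_{\nu,\nu'}R(\nu+\nu')1_{\nu,\nu'}$, where $1_{\nu,\nu'}$ is the sum of the $1_{\mathbf i\mathbf j}$ with $\mathbf i\in \mathrm{Seq}(\nu)$, $\mathbf j\in\mathrm{Seq}(\nu')$; similarly for more than two factors. For $i\in I$ and a nonzero finite-dimensional $R(\nu)$-module $M$, let $\varepsilon_i(M)$ be the largest $n\ge0$ such that $1_{\nu-ni,\,ni}M\ne0$, that is, such that $1_{\mathbf k}M\neq 0$ for some $\mathbf k\in\mathrm{Seq}(\nu)$ ending in $n$ copies of $i$. Let $i\in I$ be imaginary,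 i.e. $a_{ii}\le 0$. Let $V(i^n)$ be the one-dimensional $R(ni)$-module, in degree $0$, on which all $x_k,\tau_k$ act by zero. For a composition $\mu=(\mu_1,\dots,\mu_r)$ of $n$ put $R(\mu i)=R(\mu_1i)\otimes\dots\otimes R(\mu_ri)$ and $V(i^\mu)=V(i^{\mu_1})\otimes\dots\otimes V(i^{\mu_r})$. For an $R(\nu)$-module $K$ define the co-induced $R(\nu+ni)$-module $$\widehat{\mathrm{Ind}}{}^{\nu+ni}_{\nu,\mu i}\,K\otimes V(i^\mu)=\mathrm{HOM}_{R(\nu)\otimes R(\mu i)}\big(1_{\nu,\mu i}R(\nu+ni),\,K\otimes V(i^\mu)\big),\qquad (z\cdot f)(y)=f(yz),$$ where $\mathrm{HOM}=\bigoplus_{d\in\mathbb Z}\{\text{homomorphisms homogeneous of degree } d\}$ and $1_{\nu,\mu i}$ is the image of $1$ under juxtaposition $R(\nu)\otimes R(\mu i)\to R(\nu+ni)$. **Lemma.** Let $i\in I$ be imaginary, let $\nu\in\mathbb N[I]$, and let $K$ be a finite-dimensional gr-irreducible $R(\nu)$-module with $\varepsilon_i(K)=0$. Let $n\ge0$, let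 $\mu$ be a composition of $n$, and set $M=\widehat{\mathrm{Ind}}{}^{\nu+ni}_{\nu,\mu i}K\otimes V(i^\mu)$. Then $\operatorname{soc}M$ is gr-irreducible and $\varepsilon_i(\operatorname{soc}M)=n$. Moreover, $$\operatorname{soc}M\;\cong\;\operatorname{soc}\,\widehat{\mathrm{Ind}}{}^{\nu+ni}_{\nu,ni}K\otimes V(i^n)$$ as graded $R(\nu+ni)$-modules. -/

import Mathlib

open scoped TensorProduct

universe u v w w'

set_option linter.unusedSectionVars false

noncomputable section

namespace QHA

/-- A symmetrizable Borcherds-Cartan matrix `A = (a i j)` indexed by `I`, together with positive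
integers `r i` such that `diag (r i) * A` is symmetric. -/
structure BorcherdsCartan (I : Type v) where
  a : I → I → ℤ
  r : I → ℕ
  diag_le : ∀ i, a i i ≤ 2
  diag_even : ∀ i, Even (a i i)
  off_diag : ∀ i j, i ≠ j → a i j ≤ 0
  r_pos : ∀ i, 0 < r i
  symm : ∀ i j, (r i : ℤ) * a i j = (r j : ℤ) * a j i

/-- The symmetric form `(α_i, α_j) = r_i a_{ij}`. -/
def BorcherdsCartan.form {I : Type v} (C : BorcherdsCartan I) (i j : I) : ℤ :=
  (C.r i : ℤ) * C.a i j

/-- The elementary pieces of a diagram: a dot on a strand coloured `i`, and a crossing whose two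
strands are coloured `i, j` (from left to right) at the bottom. -/
inductive Piece (I : Type v) : Type v
  | dot (i : I) : Piece I
  | cross (i j : I) : Piece I

/-- Colours at the bottom of a piece. -/
def Piece.src {I : Type v} : Piece I → List I
  | .dot i => [i]
  | .cross i j => [i, j]

/-- Colours at the top of a piece. -/
def Piece.tgt {I : Type v} : Piece I → List I
  | .dot i => [i]
  | .cross i j => [j, i]

/-- `deg x = 2 r_i` and `deg τ = - (α_i, α_j)`. -/
def Piece.deg {I : Type v} (C : BorcherdsCartan I) : Piece I → ℤ
  | .dot i => 2 * (C.r i : ℤ)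
  | .cross i j => - C.form i j

/-- The generating diagrams: `idem s` consists of vertical strands coloured by the sequence `s`;
`place p z q` is the piece `p` with vertical strands coloured by `z` on its left and by `q` on its
right.  Thus `x_{k, s}` is `place z (dot i) q` where `s = z ++ [i] ++ q` and `z` has length `k - 1`,
and `τ_{k, s}` is `place z (cross i j) q` where `s = z ++ [i, j] ++ q`, with `z` of
length `k - 1`. -/
inductive Gen (I : Type v) : Type v
  | idem (s : List I) : Gen I
  | place (z : List I) (p : Piece I) (q : List I) : Gen I

/-- Degree of a generator. -/
def Gen.deg {I : Type v} (C : BorcherdsCartan I) : Gen I → ℤ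
  | .idem _ => 0
  | .place _ p _ => p.deg C

/-- The finite set `Seq(ν)` of sequences of weight `ν`, where `ν ∈ ℕ[I]` is
regarded as a multiset. -/
def seqs {I : Type v} [DecidableEq I] (ν : Multiset I) : Finset (List I) :=
  ν.lists.toFinset

theorem mem_seqs {I : Type v} [DecidableEq I] {ν : Multiset I} {s : List I} :
    s ∈ seqs ν ↔ (s : Multiset I) = ν := by
  simp [seqs, eq_comm]

section Algebra

variable (𝕜 : Type u) [Field 𝕜] {I : Type v} [DecidableEq I]

/-- The generator `1_s` in the free algebra. -/
abbrev fE (s : List I) : FreeAlgebra 𝕜 (Gen I) := FreeAlgebra.ι 𝕜 (Gen.idem s)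

/-- A piece `p` with `z` on its left and `q` on its right, in the free algebra. -/
abbrev fP (z : List I) (p : Piece I) (q : List I) : FreeAlgebra 𝕜 (Gen I) :=
  FreeAlgebra.ι 𝕜 (Gen.place z p q)

/-- A dot on a strand coloured `i`, in the free algebra. -/
abbrev fX (z : List I) (i : I) (q : List I) : FreeAlgebra 𝕜 (Gen I) := fP 𝕜 z (.dot i) q

/-- A crossing with bottom colours `i, j`, in the free algebra. -/
abbrev fT (z : List I) (i j : I) (q : List I) : FreeAlgebra 𝕜 (Gen I) := fP 𝕜 z (.cross i j) q

/-- Defining relations of `R(ν)`.  In a product the left factor is the upper diagram.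
Generators are indexed by all sequences; those whose sequence is not in
`Seq(ν)` are killed by `idem_zero` (with `top` and `bot`). -/
inductive Rel (C : BorcherdsCartan I) (ν : Multiset I) :
    FreeAlgebra 𝕜 (Gen I) → FreeAlgebra 𝕜 (Gen I) → Prop
  | idem_self (s : List I) : Rel C ν (fE 𝕜 s * fE 𝕜 s) (fE 𝕜 s)
  | idem_ne (s t : List I) : s ≠ t → Rel C ν (fE 𝕜 s * fE 𝕜 t) 0
  | idem_zero (s : List I) : (s : Multiset I) ≠ ν → Rel C ν (fE 𝕜 s) 0
  | idem_sum : Rel C ν (∑ s ∈ seqs ν, fE 𝕜 s) 1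
  | top (z : List I) (p : Piece I) (q : List I) :
      Rel C ν (fE 𝕜 (z ++ p.tgt ++ q) * fP 𝕜 z p q) (fP 𝕜 z p q)
  | bot (z : List I) (p : Piece I) (q : List I) :
      Rel C ν (fP 𝕜 z p q * fE 𝕜 (z ++ p.src ++ q)) (fP 𝕜 z p q)
  /- isotopy: pieces on disjoint sets of strands slide past each other -/
  | far (z : List I) (p : Piece I) (m : List I) (p' : Piece I) (q : List I) :
      Rel C ν (fP 𝕜 z p (m ++ p'.tgt ++ q) * fP 𝕜 (z ++ p.src ++ m) p' q)
        (fP 𝕜 (z ++ p.tgt ++ m) p' q * fP 𝕜 z p (m ++ p'.src ++ q))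
  /- double crossings -/
  | double_same (z : List I) (i : I) (q : List I) :
      Rel C ν (fT 𝕜 z i i q * fT 𝕜 z i i q) 0
  | double_orth (z : List I) (i j : I) (q : List I) : i ≠ j → C.form i j = 0 →
      Rel C ν (fT 𝕜 z j i q * fT 𝕜 z i j q) (fE 𝕜 (z ++ [i, j] ++ q))
  | double_ne (z : List I) (i j : I) (q : List I) : i ≠ j → C.form i j ≠ 0 →
      Rel C ν (fT 𝕜 z j i q * fT 𝕜 z i j q)
        (fX 𝕜 z i ([j] ++ q) ^ (-C.a i j).toNat + fX 𝕜 (z ++ [i]) j q ^ (-C.a j i).toNat)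
  /- dots and crossings of two strands of the same real colour -/
  | slide_real_left (z : List I) (i : I) (q : List I) : C.a i i = 2 →
      Rel C ν (fX 𝕜 z i ([i] ++ q) * fT 𝕜 z i i q - fT 𝕜 z i i q * fX 𝕜 (z ++ [i]) i q)
        (fE 𝕜 (z ++ [i, i] ++ q))
  | slide_real_right (z : List I) (i : I) (q : List I) : C.a i i = 2 →
      Rel C ν (fT 𝕜 z i i q * fX 𝕜 z i ([i] ++ q) - fX 𝕜 (z ++ [i]) i q * fT 𝕜 z i i q)
        (fE 𝕜 (z ++ [i, i] ++ q))
  /- otherwise dots slide freely through crossings -/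
  | slide_left (z : List I) (i j : I) (q : List I) : ¬ (i = j ∧ C.a i i = 2) →
      Rel C ν (fX 𝕜 z j ([i] ++ q) * fT 𝕜 z i j q) (fT 𝕜 z i j q * fX 𝕜 (z ++ [i]) j q)
  | slide_right (z : List I) (i j : I) (q : List I) : ¬ (i = j ∧ C.a i i = 2) →
      Rel C ν (fT 𝕜 z i j q * fX 𝕜 z i ([j] ++ q)) (fX 𝕜 (z ++ [j]) i q * fT 𝕜 z i j q)
  /- braid relations for three neighbouring strands coloured `i, j, k` at the bottom -/
  | braid_real (z : List I) (i j : I) (q : List I) :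
      C.a i i = 2 → i ≠ j → C.form i j ≠ 0 →
      Rel C ν
        (fT 𝕜 z j i ([i] ++ q) * fT 𝕜 (z ++ [j]) i i q * fT 𝕜 z i j ([i] ++ q)
          - fT 𝕜 (z ++ [i]) i j q * fT 𝕜 z i i ([j] ++ q) * fT 𝕜 (z ++ [i]) j i q)
        (∑ c ∈ Finset.range (-C.a i j).toNat,
          fX 𝕜 z i ([j, i] ++ q) ^ c * fX 𝕜 (z ++ [i, j]) i q ^ ((-C.a i j).toNat - 1 - c)
            * fE 𝕜 (z ++ [i, j, i] ++ q))
  | braid (z : List I) (i j k : I) (q : List I) :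
      ¬ (i = k ∧ C.a i i = 2 ∧ i ≠ j ∧ C.form i j ≠ 0) →
      Rel C ν
        (fT 𝕜 z j k ([i] ++ q) * fT 𝕜 (z ++ [j]) i k q * fT 𝕜 z i j ([k] ++ q))
        (fT 𝕜 (z ++ [k]) i j q * fT 𝕜 z i k ([j] ++ q) * fT 𝕜 (z ++ [i]) j k q)

/-- The quiver Hecke (KLR) algebra `R(ν)`. -/
def Alg (C : BorcherdsCartan I) (ν : Multiset I) : Type (max u v) := RingQuot (Rel 𝕜 C ν)

instance Alg.instRing (C : BorcherdsCartan I) (ν : Multiset I) : Ring (Alg 𝕜 C ν) :=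
  inferInstanceAs (Ring (RingQuot (Rel 𝕜 C ν)))

instance Alg.instAlgebra (C : BorcherdsCartan I) (ν : Multiset I) : Algebra 𝕜 (Alg 𝕜 C ν) :=
  inferInstanceAs (Algebra 𝕜 (RingQuot (Rel 𝕜 C ν)))

/-- The quotient map from the free algebra. -/
def Alg.mk (C : BorcherdsCartan I) (ν : Multiset I) : FreeAlgebra 𝕜 (Gen I) →ₐ[𝕜] Alg 𝕜 C ν :=
  RingQuot.mkAlgHom 𝕜 (Rel 𝕜 C ν)

/-- The universal property of `R(ν)`. -/
def Alg.lift {C : BorcherdsCartan I} {ν : Multiset I} {A : Type w} [Ring A] [Algebra 𝕜 A]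
    (f : FreeAlgebra 𝕜 (Gen I) →ₐ[𝕜] A) (hf : ∀ {x y}, Rel 𝕜 C ν x y → f x = f y) :
    Alg 𝕜 C ν →ₐ[𝕜] A :=
  RingQuot.liftAlgHom 𝕜 ⟨f, fun _ _ h => hf h⟩

theorem Alg.lift_mk {C : BorcherdsCartan I} {ν : Multiset I} {A : Type w} [Ring A] [Algebra 𝕜 A]
    (f : FreeAlgebra 𝕜 (Gen I) →ₐ[𝕜] A) (hf : ∀ {x y}, Rel 𝕜 C ν x y → f x = f y)
    (x : FreeAlgebra 𝕜 (Gen I)) : Alg.lift 𝕜 f hf (Alg.mk 𝕜 C ν x) = f x :=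
  RingQuot.liftAlgHom_mkAlgHom_apply 𝕜 f (fun _ _ h => hf h) x

theorem Alg.mk_surjective (C : BorcherdsCartan I) (ν : Multiset I) :
    Function.Surjective (Alg.mk 𝕜 C ν) :=
  RingQuot.mkAlgHom_surjective 𝕜 (Rel 𝕜 C ν)

/-- The image of a generator in `R(ν)`. -/
def gen (C : BorcherdsCartan I) (ν : Multiset I) (g : Gen I) : Alg 𝕜 C ν :=
  Alg.mk 𝕜 C ν (FreeAlgebra.ι 𝕜 g)

/-- The homogeneous component of degree `d` of `R(ν)`: the span of the products of generators of
total degree `d`. -/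
def Alg.gr (C : BorcherdsCartan I) (ν : Multiset I) (d : ℤ) : Submodule 𝕜 (Alg 𝕜 C ν) :=
  Submodule.span 𝕜 {y | ∃ l : List (Gen I),
    (l.map (Gen.deg C)).sum = d ∧ y = (l.map (gen 𝕜 C ν)).prod}

variable {𝕜}

theorem rel_eq {C : BorcherdsCartan I} {ν : Multiset I} {x y : FreeAlgebra 𝕜 (Gen I)}
    (h : Rel 𝕜 C ν x y) :
    Alg.mk 𝕜 C ν x = Alg.mk 𝕜 C ν y :=
  RingQuot.mkAlgHom_rel 𝕜 h

/-! ### Juxtaposition of diagrams -/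

/-- A generator with extra vertical strands on both sides. -/
def Gen.shift (z : List I) (q : List I) : Gen I → Gen I
  | .idem s => .idem (z ++ s ++ q)
  | .place z' p q' => .place (z ++ z') p (q' ++ q)

/-- Bottom sequence of a generator. -/
def Gen.src : Gen I → List I
  | .idem s => s
  | .place z p q => z ++ p.src ++ q

/-- Top sequence of a generator. -/
def Gen.tgt : Gen I → List I
  | .idem s => s
  | .place z p q => z ++ p.tgt ++ q

section

variable (C : BorcherdsCartan I)

theorem idem_mul_idem (γ : Multiset I) (s t : List I) :
    gen 𝕜 C γ (.idem s) * gen 𝕜 C γ (.idem t) = if s = t then gen 𝕜 C γ (.idem s) else 0 := by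
  split_ifs with h
  · subst h
    simpa [gen] using rel_eq (Rel.idem_self (𝕜 := 𝕜) (C := C) (ν := γ) s)
  · simpa [gen] using rel_eq (Rel.idem_ne (𝕜 := 𝕜) (C := C) (ν := γ) s t h)

theorem idem_eq_zero {γ : Multiset I} {s : List I} (h : (s : Multiset I) ≠ γ) :
    gen 𝕜 C γ (.idem s) = 0 := by
  simpa [gen] using rel_eq (Rel.idem_zero (𝕜 := 𝕜) (C := C) (ν := γ) s h)

theorem sum_idem (γ : Multiset I) : ∑ s ∈ seqs γ, gen 𝕜 C γ (.idem s) = 1 := by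
  simpa [gen] using rel_eq (Rel.idem_sum (𝕜 := 𝕜) (C := C) (ν := γ))

theorem tgt_mul (γ : Multiset I) (g : Gen I) :
    gen 𝕜 C γ (.idem g.tgt) * gen 𝕜 C γ g = gen 𝕜 C γ g := by
  cases g with
  | idem s => simp [Gen.tgt, idem_mul_idem]
  | place z p q => simpa [gen, Gen.tgt] using rel_eq (Rel.top (𝕜 := 𝕜) (C := C) (ν := γ) z p q)

theorem mul_src (γ : Multiset I) (g : Gen I) :
    gen 𝕜 C γ g * gen 𝕜 C γ (.idem g.src) = gen 𝕜 C γ g := by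
  cases g with
  | idem s => simp [Gen.src, idem_mul_idem]
  | place z p q => simpa [gen, Gen.src] using rel_eq (Rel.bot (𝕜 := 𝕜) (C := C) (ν := γ) z p q)

theorem far_comm (γ : Multiset I) (g h : Gen I) :
    gen 𝕜 C γ (g.shift [] h.tgt) * gen 𝕜 C γ (h.shift g.src []) =
      gen 𝕜 C γ (h.shift g.tgt []) * gen 𝕜 C γ (g.shift [] h.src) := by
  cases g with
  | idem s =>
    have h1 := tgt_mul (𝕜 := 𝕜) C γ (h.shift s [])
    have h2 := mul_src (𝕜 := 𝕜) C γ (h.shift s [])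
    cases h with
    | idem t => simp [Gen.shift, Gen.src, Gen.tgt]
    | place z p q =>
      simp only [Gen.shift, Gen.src, Gen.tgt, List.nil_append, List.append_nil,
        List.append_assoc] at h1 h2 ⊢
      rw [h1, h2]
  | place z p q =>
    cases h with
    | idem t =>
      have h1 := tgt_mul (𝕜 := 𝕜) C γ ((Gen.place z p q).shift [] t)
      have h2 := mul_src (𝕜 := 𝕜) C γ ((Gen.place z p q).shift [] t)
      simp only [Gen.shift, Gen.src, Gen.tgt, List.nil_append, List.append_nil,
        List.append_assoc] at h1 h2 ⊢
      rw [h1, h2]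
    | place z' p' q' =>
      have := rel_eq (Rel.far (𝕜 := 𝕜) (C := C) (ν := γ) z p (q ++ z') p' q')
      simpa [gen, Gen.shift, Gen.src, Gen.tgt] using this

/-- The idempotent `1_z ⊗ 1_β ⊗ 1_q` of `R(γ)`. -/
def cut (γ : Multiset I) (z : List I) (β : Multiset I) (q : List I) : Alg 𝕜 C γ :=
  ∑ s ∈ seqs β, gen 𝕜 C γ (.idem (z ++ s ++ q))

theorem cut_mul_idem {γ : Multiset I} {z q s : List I} {β : Multiset I}
    (hs : (s : Multiset I) = β) :
    cut (𝕜 := 𝕜) C γ z β q * gen 𝕜 C γ (.idem (z ++ s ++ q)) =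
      gen 𝕜 C γ (.idem (z ++ s ++ q)) := by
  rw [cut, Finset.sum_mul, Finset.sum_eq_single_of_mem s (mem_seqs.2 hs)]
  · simp [idem_mul_idem]
  · intro t _ ht
    simp [idem_mul_idem, ht]

theorem idem_mul_cut {γ : Multiset I} {z q s : List I} {β : Multiset I}
    (hs : (s : Multiset I) = β) :
    gen 𝕜 C γ (.idem (z ++ s ++ q)) * cut (𝕜 := 𝕜) C γ z β q =
      gen 𝕜 C γ (.idem (z ++ s ++ q)) := by
  rw [cut, Finset.mul_sum, Finset.sum_eq_single_of_mem s (mem_seqs.2 hs)]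
  · simp [idem_mul_idem]
  · intro t _ ht
    simp [idem_mul_idem, Ne.symm ht]

theorem cut_idem (γ : Multiset I) (z : List I) (β : Multiset I) (q : List I) :
    IsIdempotentElem (cut (𝕜 := 𝕜) C γ z β q) := by
  have : ∀ s ∈ seqs β, gen 𝕜 C γ (.idem (z ++ s ++ q)) * cut (𝕜 := 𝕜) C γ z β q =
      gen 𝕜 C γ (.idem (z ++ s ++ q)) := fun s hs => idem_mul_cut C (mem_seqs.1 hs)
  rw [IsIdempotentElem]
  nth_rewrite 1 [cut]
  rw [Finset.sum_mul, Finset.sum_congr rfl this, cut]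

theorem Gen.coe_src (g : Gen I) : (g.src : Multiset I) = g.tgt := by
  cases g with
  | idem s => rfl
  | place z p q =>
    cases p with
    | dot i => rfl
    | cross i j =>
      simp only [Gen.src, Gen.tgt, Piece.src, Piece.tgt]
      rw [Multiset.coe_eq_coe]
      exact ((List.Perm.swap j i []).append_left z).append_right q

theorem Gen.shift_src (z q : List I) (g : Gen I) : (g.shift z q).src = z ++ g.src ++ q := by
  cases g <;> simp [Gen.shift, Gen.src]

theorem Gen.shift_tgt (z q : List I) (g : Gen I) : (g.shift z q).tgt = z ++ g.tgt ++ q := by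
  cases g <;> simp [Gen.shift, Gen.tgt]

theorem gen_eq_zero {γ : Multiset I} {g : Gen I} (h : (g.src : Multiset I) ≠ γ) :
    gen 𝕜 C γ g = 0 := by
  rw [← mul_src, idem_eq_zero C h, mul_zero]

theorem gen_mem_corner {γ β : Multiset I} {z q : List I}
    (h : (z : Multiset I) + β + (q : Multiset I) = γ) (g : Gen I) :
    gen 𝕜 C γ (g.shift z q) ∈ Subsemigroup.corner (cut (𝕜 := 𝕜) C γ z β q) := by
  rw [Subsemigroup.mem_corner_iff (cut_idem C γ z β q)]
  by_cases hg : (g.src : Multiset I) = β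
  · constructor
    · rw [← tgt_mul, ← mul_assoc, Gen.shift_tgt, cut_mul_idem C (g.coe_src ▸ hg)]
    · rw [← mul_src, mul_assoc, Gen.shift_src, idem_mul_cut C hg]
  · have : gen 𝕜 C γ (g.shift z q) = 0 := by
      apply gen_eq_zero
      rw [Gen.shift_src, ← h, ← Multiset.coe_add, ← Multiset.coe_add]
      exact fun h0 => hg (add_left_cancel (add_right_cancel h0))
    simp [this]

instance cornerModule {A : Type w} [Ring A] [Algebra 𝕜 A] {e : A} (he : IsIdempotentElem e) :
    Module 𝕜 he.Corner where
  smul c x := ⟨c • x.1, by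
    have := (Subsemigroup.mem_corner_iff he).1 x.2
    rw [Subsemigroup.mem_corner_iff he, mul_smul_comm, smul_mul_assoc, this.1, this.2]
    exact ⟨rfl, rfl⟩⟩
  one_smul x := Subtype.ext (one_smul 𝕜 x.1)
  mul_smul c d x := Subtype.ext (mul_smul c d x.1)
  smul_zero c := Subtype.ext (smul_zero c)
  smul_add c x y := Subtype.ext (smul_add c x.1 y.1)
  add_smul c d x := Subtype.ext (add_smul c d x.1)
  zero_smul x := Subtype.ext (zero_smul 𝕜 x.1)

instance cornerAlgebra {A : Type w} [Ring A] [Algebra 𝕜 A] {e : A} (he : IsIdempotentElem e) :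
    Algebra 𝕜 he.Corner :=
  Algebra.ofModule (fun c x y => Subtype.ext (smul_mul_assoc c x.1 y.1))
    (fun c x y => Subtype.ext (mul_smul_comm c x.1 y.1))

/-- The inclusion `e A e ⊆ A` as a linear map. -/
def cornerVal {A : Type w} [Ring A] [Algebra 𝕜 A] {e : A} (he : IsIdempotentElem e) :
    he.Corner →ₗ[𝕜] A where
  toFun x := x.1
  map_add' _ _ := rfl
  map_smul' _ _ := rfl

theorem cornerVal_mul {A : Type w} [Ring A] [Algebra 𝕜 A] {e : A} (he : IsIdempotentElem e)
    (x y : he.Corner) : cornerVal (𝕜 := 𝕜) he (x * y) = cornerVal (𝕜 := 𝕜) he x * cornerVal (𝕜 := 𝕜) he y := rfl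

theorem cornerVal_one {A : Type w} [Ring A] [Algebra 𝕜 A] {e : A} (he : IsIdempotentElem e) :
    cornerVal (𝕜 := 𝕜) he 1 = e := rfl

theorem cornerVal_inj {A : Type w} [Ring A] [Algebra 𝕜 A] {e : A} (he : IsIdempotentElem e)
    {x y : he.Corner} (h : cornerVal (𝕜 := 𝕜) he x = cornerVal (𝕜 := 𝕜) he y) : x = y := Subtype.ext h

theorem cornerVal_pow_mul {A : Type w} [Ring A] [Algebra 𝕜 A] {e : A} (he : IsIdempotentElem e)
    (x y : he.Corner) (n : ℕ) : cornerVal (𝕜 := 𝕜) he (x ^ n * y) = cornerVal (𝕜 := 𝕜) he x ^ n * cornerVal (𝕜 := 𝕜) he y := by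
  induction n generalizing y with
  | zero => simp
  | succ n ih => rw [pow_succ, pow_succ, mul_assoc, ih, cornerVal_mul, mul_assoc]

theorem cornerVal_pow {A : Type w} [Ring A] [Algebra 𝕜 A] {e : A} (he : IsIdempotentElem e)
    (x : he.Corner) {n : ℕ} (hn : n ≠ 0) : cornerVal (𝕜 := 𝕜) he (x ^ n) = cornerVal (𝕜 := 𝕜) he x ^ n := by
  obtain ⟨m, rfl⟩ := Nat.exists_eq_succ_of_ne_zero hn
  rw [Nat.succ_eq_add_one, pow_succ, cornerVal_pow_mul, pow_succ]

/-- On the free algebra: add vertical strands coloured `z` on the left and `q` on the right. -/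
def preplace {γ β : Multiset I} {z q : List I} (h : (z : Multiset I) + β + (q : Multiset I) = γ) :
    FreeAlgebra 𝕜 (Gen I) →ₐ[𝕜] (cut_idem (𝕜 := 𝕜) C γ z β q).Corner :=
  FreeAlgebra.lift 𝕜 fun g => ⟨gen 𝕜 C γ (g.shift z q), gen_mem_corner C h g⟩

theorem preplace_ι {γ β : Multiset I} {z q : List I}
    (h : (z : Multiset I) + β + (q : Multiset I) = γ) (g : Gen I) :
    cornerVal (𝕜 := 𝕜) _ (preplace (𝕜 := 𝕜) C h (FreeAlgebra.ι 𝕜 g)) = gen 𝕜 C γ (g.shift z q) := by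
  have := FreeAlgebra.lift_ι_apply (R := 𝕜) (A := (cut_idem (𝕜 := 𝕜) C γ z β q).Corner)
    (fun g => ⟨gen 𝕜 C γ (g.shift z q), gen_mem_corner C h g⟩) g
  exact congrArg (cornerVal (𝕜 := 𝕜) _) this

theorem form_ne_zero {C : BorcherdsCartan I} {i j : I} (hij : i ≠ j) (h : C.form i j ≠ 0) :
    (-C.a i j).toNat ≠ 0 ∧ (-C.a j i).toNat ≠ 0 := by
  have h1 : C.a i j ≠ 0 := fun h0 => h (by simp [BorcherdsCartan.form, h0])
  have h2 : C.a j i ≠ 0 := fun h0 => h (by simp [BorcherdsCartan.form, C.symm i j, h0])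
  have := C.off_diag i j hij
  have := C.off_diag j i hij.symm
  omega

theorem preplace_rel {γ β : Multiset I} {z q : List I}
    (h : (z : Multiset I) + β + (q : Multiset I) = γ) {x y : FreeAlgebra 𝕜 (Gen I)}
    (hxy : Rel 𝕜 C β x y) : preplace C h x = preplace C h y := by
  apply cornerVal_inj (𝕜 := 𝕜)
  cases hxy with
  | idem_self s =>
    simp only [map_mul, cornerVal_mul, preplace_ι, Gen.shift]
    simp [idem_mul_idem]
  | idem_ne s t hst =>
    simp only [map_mul, cornerVal_mul, preplace_ι, Gen.shift]
    simp [idem_mul_idem, hst]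
  | idem_zero s hs =>
    simp only [preplace_ι, map_zero]
    apply gen_eq_zero
    rw [Gen.shift_src, ← h, ← Multiset.coe_add, ← Multiset.coe_add]
    exact fun h0 => hs (add_left_cancel (add_right_cancel h0))
  | idem_sum =>
    rw [map_one, cornerVal_one, map_sum, map_sum]
    exact Finset.sum_congr rfl fun s _ => preplace_ι C h _
  | top z' p q' =>
    simp only [map_mul, cornerVal_mul, preplace_ι]
    have := tgt_mul (𝕜 := 𝕜) C γ ((Gen.place z' p q').shift z q)
    simpa [Gen.shift, Gen.tgt] using this
  | bot z' p q' =>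
    simp only [map_mul, cornerVal_mul, preplace_ι]
    have := mul_src (𝕜 := 𝕜) C γ ((Gen.place z' p q').shift z q)
    simpa [Gen.shift, Gen.src] using this
  | far z' p m p' q' =>
    simp only [map_mul, cornerVal_mul, preplace_ι]
    have := rel_eq (Rel.far (𝕜 := 𝕜) (C := C) (ν := γ) (z ++ z') p m p' (q' ++ q))
    simpa [gen, Gen.shift] using this
  | double_same z' i q' =>
    simp only [map_mul, cornerVal_mul, preplace_ι, map_zero]
    have := rel_eq (Rel.double_same (𝕜 := 𝕜) (C := C) (ν := γ) (z ++ z') i (q' ++ q))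
    simpa [gen, Gen.shift] using this
  | double_orth z' i j q' hij hf =>
    simp only [map_mul, cornerVal_mul, preplace_ι]
    have := rel_eq (Rel.double_orth (𝕜 := 𝕜) (C := C) (ν := γ) (z ++ z') i j (q' ++ q) hij hf)
    simpa [gen, Gen.shift] using this
  | double_ne z' i j q' hij hf =>
    simp only [map_mul, cornerVal_mul, preplace_ι, map_add, map_pow,
      cornerVal_pow _ _ (form_ne_zero hij hf).1, cornerVal_pow _ _ (form_ne_zero hij hf).2]
    have := rel_eq (Rel.double_ne (𝕜 := 𝕜) (C := C) (ν := γ) (z ++ z') i j (q' ++ q) hij hf)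
    simpa [gen, Gen.shift] using this
  | slide_real_left z' i q' hi =>
    simp only [map_mul, cornerVal_mul, preplace_ι, map_sub]
    have := rel_eq (Rel.slide_real_left (𝕜 := 𝕜) (C := C) (ν := γ) (z ++ z') i (q' ++ q) hi)
    simpa [gen, Gen.shift] using this
  | slide_real_right z' i q' hi =>
    simp only [map_mul, cornerVal_mul, preplace_ι, map_sub]
    have := rel_eq (Rel.slide_real_right (𝕜 := 𝕜) (C := C) (ν := γ) (z ++ z') i (q' ++ q) hi)
    simpa [gen, Gen.shift] using this
  | slide_left z' i j q' hi =>
    simp only [map_mul, cornerVal_mul, preplace_ι]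
    have := rel_eq (Rel.slide_left (𝕜 := 𝕜) (C := C) (ν := γ) (z ++ z') i j (q' ++ q) hi)
    simpa [gen, Gen.shift] using this
  | slide_right z' i j q' hi =>
    simp only [map_mul, cornerVal_mul, preplace_ι]
    have := rel_eq (Rel.slide_right (𝕜 := 𝕜) (C := C) (ν := γ) (z ++ z') i j (q' ++ q) hi)
    simpa [gen, Gen.shift] using this
  | braid_real z' i j q' hi hij hf =>
    have := rel_eq (Rel.braid_real (𝕜 := 𝕜) (C := C) (ν := γ) (z ++ z') i j (q' ++ q) hi hij hf)
    refine Eq.trans ?_ (Eq.trans this ?_)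
    · simp only [map_mul, cornerVal_mul, preplace_ι, map_sub]
      simp [gen, Gen.shift]
    · rw [map_sum, map_sum, map_sum]
      refine Finset.sum_congr rfl fun c _ => ?_
      rw [map_mul (preplace C h), map_mul (preplace C h), map_pow (preplace C h),
        map_pow (preplace C h), mul_assoc (preplace C h _ ^ c), cornerVal_pow_mul,
        cornerVal_pow_mul, preplace_ι, preplace_ι, preplace_ι]
      simp [gen, Gen.shift, mul_assoc]
  | braid z' i j k q' hi =>
    simp only [map_mul, cornerVal_mul, preplace_ι]
    have := rel_eq (Rel.braid (𝕜 := 𝕜) (C := C) (ν := γ) (z ++ z') i j k (q' ++ q) hi)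
    simpa [gen, Gen.shift, mul_assoc] using this

/-- Adding vertical strands coloured `z` on the left and `q` on the right, as an algebra
homomorphism `R(β) → e R(γ) e` with `e = 1_z ⊗ 1_β ⊗ 1_q`. -/
def place {γ β : Multiset I} {z q : List I} (h : (z : Multiset I) + β + (q : Multiset I) = γ) :
    Alg 𝕜 C β →ₐ[𝕜] (cut_idem (𝕜 := 𝕜) C γ z β q).Corner :=
  Alg.lift 𝕜 (preplace C h) (preplace_rel C h)

theorem place_gen {γ β : Multiset I} {z q : List I}
    (h : (z : Multiset I) + β + (q : Multiset I) = γ) (g : Gen I) :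
    cornerVal (𝕜 := 𝕜) _ (place (𝕜 := 𝕜) C h (gen 𝕜 C β g)) = gen 𝕜 C γ (g.shift z q) := by
  rw [place, gen, Alg.lift_mk, preplace_ι]

theorem gen_mul_gen_eq_zero {γ : Multiset I} {g h : Gen I} (hgh : g.src ≠ h.tgt) :
    gen 𝕜 C γ g * gen 𝕜 C γ h = 0 := by
  rw [← mul_src, ← tgt_mul C γ h, mul_assoc, ← mul_assoc (gen 𝕜 C γ (.idem _)), idem_mul_idem,
    if_neg hgh]
  simp

theorem alg_induction {ν : Multiset I} {p : Alg 𝕜 C ν → Prop}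
    (hc : ∀ c, p (algebraMap 𝕜 _ c)) (hg : ∀ g, p (gen 𝕜 C ν g))
    (hm : ∀ a b, p a → p b → p (a * b)) (ha : ∀ a b, p a → p b → p (a + b)) (a : Alg 𝕜 C ν) :
    p a := by
  obtain ⟨x, rfl⟩ := Alg.mk_surjective 𝕜 C ν a
  induction x with
  | grade0 c => rw [AlgHom.commutes]; exact hc c
  | grade1 g => exact hg g
  | mul a b h1 h2 => rw [map_mul]; exact hm _ _ h1 h2
  | add a b h1 h2 => rw [map_add]; exact ha _ _ h1 h2

theorem left_content {ν ν' γ : Multiset I} (h : ν + ν' = γ) (q : {q // q ∈ seqs ν'}) :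
    (([] : List I) : Multiset I) + ν + (q.1 : Multiset I) = γ := by
  rw [mem_seqs.1 q.2, ← h]
  simp

theorem right_content {ν ν' γ : Multiset I} (h : ν + ν' = γ) (z : {z // z ∈ seqs ν}) :
    (z.1 : Multiset I) + ν' + (([] : List I) : Multiset I) = γ := by
  rw [mem_seqs.1 z.2, ← h]
  simp

/-- `a ↦ a ⊗ 1_{ν'}`, from `R(ν)` to `R(ν + ν')`. -/
def leftPl {ν ν' γ : Multiset I} (h : ν + ν' = γ) : Alg 𝕜 C ν →ₗ[𝕜] Alg 𝕜 C γ :=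
  ∑ q ∈ (seqs ν').attach, cornerVal (cut_idem C γ [] ν q.1) ∘ₗ
    (place C (left_content h q)).toLinearMap

/-- `b ↦ 1_ν ⊗ b`, from `R(ν')` to `R(ν + ν')`. -/
def rightPl {ν ν' γ : Multiset I} (h : ν + ν' = γ) : Alg 𝕜 C ν' →ₗ[𝕜] Alg 𝕜 C γ :=
  ∑ z ∈ (seqs ν).attach, cornerVal (cut_idem C γ z.1 ν' []) ∘ₗ
    (place C (right_content h z)).toLinearMap

theorem leftPl_gen {ν ν' γ : Multiset I} (h : ν + ν' = γ) (g : Gen I) :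
    leftPl (𝕜 := 𝕜) C h (gen 𝕜 C ν g) = ∑ q ∈ seqs ν', gen 𝕜 C γ (g.shift [] q) := by
  rw [leftPl, LinearMap.sum_apply, ← Finset.sum_attach (seqs ν')]
  exact Finset.sum_congr rfl fun q _ => place_gen C (left_content h q) g

theorem rightPl_gen {ν ν' γ : Multiset I} (h : ν + ν' = γ) (g : Gen I) :
    rightPl (𝕜 := 𝕜) C h (gen 𝕜 C ν' g) = ∑ z ∈ seqs ν, gen 𝕜 C γ (g.shift z []) := by
  rw [rightPl, LinearMap.sum_apply, ← Finset.sum_attach (seqs ν)]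
  exact Finset.sum_congr rfl fun z _ => place_gen C (right_content h z) g

theorem leftPl_one {ν ν' γ : Multiset I} (h : ν + ν' = γ) :
    leftPl (𝕜 := 𝕜) C h 1 = rightPl (𝕜 := 𝕜) C h 1 := by
  rw [← sum_idem, ← sum_idem, map_sum, map_sum]
  simp only [leftPl_gen, rightPl_gen, Gen.shift, List.nil_append, List.append_nil]
  exact Finset.sum_comm

theorem corner_mul_zero {γ β : Multiset I} {z q z' q' : List I}
    (hl : z.length = z'.length) (hne : z ≠ z' ∨ q ≠ q')
    (x : (cut_idem (𝕜 := 𝕜) C γ z β q).Corner) (y : (cut_idem (𝕜 := 𝕜) C γ z' β q').Corner) :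
    cornerVal (𝕜 := 𝕜) _ x * cornerVal (𝕜 := 𝕜) _ y = 0 := by
  have hx : x.1 * cut C γ z β q = x.1 :=
    ((Subsemigroup.mem_corner_iff (cut_idem (𝕜 := 𝕜) C γ z β q)).1 x.2).2
  have hy : cut C γ z' β q' * y.1 = y.1 :=
    ((Subsemigroup.mem_corner_iff (cut_idem (𝕜 := 𝕜) C γ z' β q')).1 y.2).1
  have h0 : cut (𝕜 := 𝕜) C γ z β q * cut C γ z' β q' = 0 := by
    rw [cut, cut, Finset.sum_mul_sum]
    refine Finset.sum_eq_zero fun s hs => Finset.sum_eq_zero fun t ht => ?_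
    rw [idem_mul_idem, if_neg]
    intro heq
    have hst : s.length = t.length := by
      have := congrArg Multiset.card ((mem_seqs.1 hs).trans (mem_seqs.1 ht).symm)
      simpa using this
    rw [List.append_assoc, List.append_assoc] at heq
    obtain ⟨h1, h2⟩ := List.append_inj heq hl
    obtain ⟨_, h3⟩ := List.append_inj h2 hst
    exact hne.elim (fun h => h h1) (fun h => h h3)
  change x.1 * y.1 = 0
  rw [← hx, ← hy, mul_assoc, ← mul_assoc (cut C γ z β q), h0]
  simp

theorem leftPl_mul {ν ν' γ : Multiset I} (h : ν + ν' = γ) (a b : Alg 𝕜 C ν) :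
    leftPl C h (a * b) = leftPl C h a * leftPl C h b := by
  simp only [leftPl, LinearMap.sum_apply]
  rw [Finset.sum_mul_sum]
  refine Finset.sum_congr rfl fun q hq => ?_
  rw [Finset.sum_eq_single_of_mem q hq]
  · simp only [LinearMap.comp_apply, AlgHom.toLinearMap_apply, map_mul, cornerVal_mul]
  · intro q' _ hne
    exact corner_mul_zero C rfl (Or.inr fun h => hne (Subtype.ext h.symm)) _ _

theorem rightPl_mul {ν ν' γ : Multiset I} (h : ν + ν' = γ) (a b : Alg 𝕜 C ν') :
    rightPl C h (a * b) = rightPl C h a * rightPl C h b := by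
  simp only [rightPl, LinearMap.sum_apply]
  rw [Finset.sum_mul_sum]
  refine Finset.sum_congr rfl fun z hz => ?_
  rw [Finset.sum_eq_single_of_mem z hz]
  · simp only [LinearMap.comp_apply, AlgHom.toLinearMap_apply, map_mul, cornerVal_mul]
  · intro z' _ hne
    refine corner_mul_zero C ?_ (Or.inl fun h => hne (Subtype.ext h.symm)) _ _
    have := congrArg Multiset.card ((mem_seqs.1 z.2).trans (mem_seqs.1 z'.2).symm)
    simpa using this

theorem leftPl_comm_gen {ν ν' γ : Multiset I} (h : ν + ν' = γ) (g g' : Gen I) :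
    leftPl (𝕜 := 𝕜) C h (gen 𝕜 C ν g) * rightPl C h (gen 𝕜 C ν' g') =
      rightPl C h (gen 𝕜 C ν' g') * leftPl C h (gen 𝕜 C ν g) := by
  by_cases hg : (g.src : Multiset I) = ν
  swap
  · rw [gen_eq_zero C hg]; simp
  by_cases hg' : (g'.src : Multiset I) = ν'
  swap
  · rw [gen_eq_zero C hg']; simp
  have hgt := g.coe_src ▸ hg
  have hgt' := g'.coe_src ▸ hg'
  have len : ∀ {β : Multiset I} {s t : List I}, s ∈ seqs β → (t : Multiset I) = β →
      s.length = t.length := by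
    intro β s t hs ht
    have := congrArg Multiset.card ((mem_seqs.1 hs).trans ht.symm)
    simpa using this
  rw [leftPl_gen, rightPl_gen, Finset.sum_mul_sum, Finset.sum_mul_sum,
    Finset.sum_eq_single_of_mem g'.tgt (mem_seqs.2 hgt'),
    Finset.sum_eq_single_of_mem g.src (mem_seqs.2 hg),
    Finset.sum_eq_single_of_mem g.tgt (mem_seqs.2 hgt),
    Finset.sum_eq_single_of_mem g'.src (mem_seqs.2 hg'), far_comm]
  · intro q hq hne
    apply gen_mul_gen_eq_zero
    rw [Gen.shift_src, Gen.shift_tgt]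
    intro heq
    simp only [List.append_nil, List.nil_append] at heq
    exact hne (List.append_inj heq rfl).2.symm
  · intro z hz hne
    refine Finset.sum_eq_zero fun q hq => ?_
    apply gen_mul_gen_eq_zero
    rw [Gen.shift_src, Gen.shift_tgt]
    intro heq
    simp only [List.append_nil, List.nil_append] at heq
    exact hne (List.append_inj heq (len hz hgt)).1
  · intro z hz hne
    apply gen_mul_gen_eq_zero
    rw [Gen.shift_src, Gen.shift_tgt]
    intro heq
    simp only [List.append_nil, List.nil_append] at heq
    exact hne (List.append_inj heq (len hz hg).symm).1.symm
  · intro q hq hne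
    refine Finset.sum_eq_zero fun z hz => ?_
    apply gen_mul_gen_eq_zero
    rw [Gen.shift_src, Gen.shift_tgt]
    intro heq
    simp only [List.append_nil, List.nil_append] at heq
    exact hne (List.append_inj heq (len hz hg).symm).2

theorem leftPl_comm {ν ν' γ : Multiset I} (h : ν + ν' = γ) (a : Alg 𝕜 C ν) (b : Alg 𝕜 C ν') :
    leftPl C h a * rightPl C h b = rightPl C h b * leftPl C h a := by
  induction a using alg_induction with
  | hc c =>
    rw [Algebra.algebraMap_eq_smul_one, map_smul, leftPl_one, smul_mul_assoc, mul_smul_comm,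
      ← rightPl_mul, ← rightPl_mul, one_mul, mul_one]
  | hm x y hx hy => rw [leftPl_mul, mul_assoc, hy, ← mul_assoc, hx, mul_assoc]
  | ha x y hx hy => rw [map_add, add_mul, mul_add, hx, hy]
  | hg g =>
    induction b using alg_induction with
    | hc c =>
      rw [Algebra.algebraMap_eq_smul_one, map_smul, ← leftPl_one, smul_mul_assoc, mul_smul_comm,
        ← leftPl_mul, ← leftPl_mul, one_mul, mul_one]
    | hm x y hx hy => rw [rightPl_mul, ← mul_assoc, hx, mul_assoc, hy, mul_assoc]
    | ha x y hx hy => rw [map_add, add_mul, mul_add, hx, hy]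
    | hg g' => exact leftPl_comm_gen C h g g'

/-- Horizontal juxtaposition: the image of `a ⊗ b` under `R(ν) ⊗ R(ν') → R(ν + ν')`. -/
def hcomp {ν ν' γ : Multiset I} (h : ν + ν' = γ) (a : Alg 𝕜 C ν) (b : Alg 𝕜 C ν') :
    Alg 𝕜 C γ :=
  leftPl C h a * rightPl C h b

theorem hcomp_mul {ν ν' γ : Multiset I} (h : ν + ν' = γ) (a a' : Alg 𝕜 C ν)
    (b b' : Alg 𝕜 C ν') : hcomp C h (a * a') (b * b') = hcomp C h a b * hcomp C h a' b' := by
  simp only [hcomp]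
  rw [leftPl_mul, rightPl_mul, mul_assoc, ← mul_assoc (leftPl C h a'), leftPl_comm, mul_assoc,
    mul_assoc]

/-- Iterated juxtaposition: the image of `b 0 ⊗ b 1 ⊗ ⋯` under
`R(β 0) ⊗ R(β 1) ⊗ ⋯ → R(β 0 + β 1 + ⋯)`. -/
def juxt : ∀ {r : ℕ} (β : Fin r → Multiset I), (∀ j, Alg 𝕜 C (β j)) → Alg 𝕜 C (∑ j, β j)
  | 0, _, _ => 1
  | _ + 1, β, b =>
    hcomp C (Fin.sum_univ_succ β).symm (b 0) (juxt (fun j => β j.succ) fun j => b j.succ)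

theorem juxt_mul {r : ℕ} (β : Fin r → Multiset I) (b b' : ∀ j, Alg 𝕜 C (β j)) :
    juxt C β (b * b') = juxt C β b * juxt C β b' := by
  induction r with
  | zero => simp [juxt]
  | succ r ih =>
    simp only [juxt]
    rw [← hcomp_mul, ← ih]
    rfl

/-- The image of `a ⊗ b_1 ⊗ ⋯ ⊗ b_r` under `R(ν) ⊗ R(β_1) ⊗ ⋯ ⊗ R(β_r) → R(γ)`,
where `γ = ν + β_1 + ⋯ + β_r`. -/
def par {ν γ : Multiset I} {r : ℕ} {β : Fin r → Multiset I} (h : ν + ∑ j, β j = γ)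
    (a : Alg 𝕜 C ν) (b : ∀ j, Alg 𝕜 C (β j)) : Alg 𝕜 C γ :=
  hcomp C h a (juxt C β b)

theorem par_mul {ν γ : Multiset I} {r : ℕ} {β : Fin r → Multiset I} (h : ν + ∑ j, β j = γ)
    (a a' : Alg 𝕜 C ν) (b b' : ∀ j, Alg 𝕜 C (β j)) :
    par C h (a * a') (b * b') = par C h a b * par C h a' b' := by
  rw [par, juxt_mul, hcomp_mul]
  rfl

/-- The subspace `1_{ν, β} R(γ)` of `R(γ)`, where `1_{ν, β} = 1_ν ⊗ 1_{β_1} ⊗ ⋯ ⊗ 1_{β_r}`. -/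
def parSpace {ν γ : Multiset I} {r : ℕ} {β : Fin r → Multiset I} (h : ν + ∑ j, β j = γ) :
    Submodule 𝕜 (Alg 𝕜 C γ) :=
  LinearMap.range (LinearMap.mulLeft 𝕜 (par (𝕜 := 𝕜) C h 1 1))

theorem mem_parSpace {ν γ : Multiset I} {r : ℕ} {β : Fin r → Multiset I} (h : ν + ∑ j, β j = γ)
    {y : Alg 𝕜 C γ} : y ∈ parSpace C h ↔ par C h 1 1 * y = y := by
  constructor
  · rintro ⟨y, rfl⟩
    rw [LinearMap.mulLeft_apply, ← mul_assoc, ← par_mul, mul_one, mul_one]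
  · exact fun hy => ⟨y, hy⟩

theorem par_mul_mem {ν γ : Multiset I} {r : ℕ} {β : Fin r → Multiset I} (h : ν + ∑ j, β j = γ)
    (a : Alg 𝕜 C ν) (b : ∀ j, Alg 𝕜 C (β j)) (y : Alg 𝕜 C γ) :
    par C h a b * y ∈ parSpace C h := by
  rw [mem_parSpace, ← mul_assoc, ← par_mul, one_mul, one_mul]

/-- The left action of `a ⊗ b_1 ⊗ ⋯ ⊗ b_r` on `1_{ν, β} R(γ)`. -/
def parAct {ν γ : Multiset I} {r : ℕ} {β : Fin r → Multiset I} (h : ν + ∑ j, β j = γ)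
    (a : Alg 𝕜 C ν) (b : ∀ j, Alg 𝕜 C (β j)) : parSpace (𝕜 := 𝕜) C h →ₗ[𝕜] parSpace (𝕜 := 𝕜) C h :=
  (LinearMap.mulLeft 𝕜 (par C h a b)).restrict fun y _ => par_mul_mem C h a b y

/-- The right action of `z ∈ R(γ)` on `1_{ν, β} R(γ)`. -/
def parRight {ν γ : Multiset I} {r : ℕ} {β : Fin r → Multiset I} (h : ν + ∑ j, β j = γ)
    (z : Alg 𝕜 C γ) : parSpace (𝕜 := 𝕜) C h →ₗ[𝕜] parSpace (𝕜 := 𝕜) C h :=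
  (LinearMap.mulRight 𝕜 z).restrict fun y hy => by
    rw [mem_parSpace] at hy ⊢
    rw [LinearMap.mulRight_apply, ← mul_assoc, hy]

/-! ### The grading of `R(ν)` -/

theorem one_mem_gr (ν : Multiset I) : (1 : Alg 𝕜 C ν) ∈ Alg.gr 𝕜 C ν 0 :=
  Submodule.subset_span ⟨[], by simp⟩

theorem gen_mem_gr (ν : Multiset I) (g : Gen I) : gen 𝕜 C ν g ∈ Alg.gr 𝕜 C ν (g.deg C) :=
  Submodule.subset_span ⟨[g], by simp⟩

theorem mul_mem_gr {ν : Multiset I} {d e : ℤ} {a b : Alg 𝕜 C ν} (ha : a ∈ Alg.gr 𝕜 C ν d)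
    (hb : b ∈ Alg.gr 𝕜 C ν e) : a * b ∈ Alg.gr 𝕜 C ν (d + e) := by
  have : Alg.gr 𝕜 C ν d * Alg.gr 𝕜 C ν e ≤ Alg.gr 𝕜 C ν (d + e) := by
    rw [Alg.gr, Alg.gr, Submodule.span_mul_span]
    refine Submodule.span_mono ?_
    rintro _ ⟨_, ⟨l, hl, rfl⟩, _, ⟨l', hl', rfl⟩, rfl⟩
    exact ⟨l ++ l', by simp [hl, hl'], by simp⟩
  exact this (Submodule.mul_mem_mul ha hb)

theorem iSup_gr (ν : Multiset I) : ⨆ d, Alg.gr 𝕜 C ν d = ⊤ := by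
  have key : ∀ a : Alg 𝕜 C ν, a ∈ Submodule.span 𝕜 {y | ∃ l : List (Gen I),
      y = (l.map (gen 𝕜 C ν)).prod} := by
    intro a
    induction a using alg_induction with
    | hc c =>
      rw [Algebra.algebraMap_eq_smul_one]
      exact Submodule.smul_mem _ _ (Submodule.subset_span ⟨[], by simp⟩)
    | hg g => exact Submodule.subset_span ⟨[g], by simp⟩
    | hm a b ha hb =>
      have := Submodule.mul_mem_mul ha hb
      rw [Submodule.span_mul_span] at this
      refine Submodule.span_mono ?_ this
      rintro _ ⟨_, ⟨l, rfl⟩, _, ⟨l', rfl⟩, rfl⟩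
      exact ⟨l ++ l', by simp⟩
    | ha a b ha hb => exact add_mem ha hb
  refine eq_top_iff.2 fun a _ => ?_
  refine Submodule.span_le.2 ?_ (key a)
  rintro _ ⟨l, rfl⟩
  exact Submodule.mem_iSup_of_mem (l.map (Gen.deg C)).sum (Submodule.subset_span ⟨l, rfl, rfl⟩)

theorem gen_shift_mem_gr (γ : Multiset I) (z q : List I) (g : Gen I) :
    gen 𝕜 C γ (g.shift z q) ∈ Alg.gr 𝕜 C γ (g.deg C) := by
  have : (g.shift z q).deg C = g.deg C := by cases g <;> rfl
  exact this ▸ gen_mem_gr C γ (g.shift z q)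

theorem leftPl_one_mem_gr {ν ν' γ : Multiset I} (h : ν + ν' = γ) :
    leftPl (𝕜 := 𝕜) C h 1 ∈ Alg.gr 𝕜 C γ 0 := by
  rw [← sum_idem, map_sum]
  refine Submodule.sum_mem _ fun s _ => ?_
  rw [leftPl_gen]
  exact Submodule.sum_mem _ fun q _ => gen_shift_mem_gr C γ [] q (.idem s)

theorem leftPl_word_mem {ν ν' γ : Multiset I} (h : ν + ν' = γ) (l : List (Gen I)) :
    leftPl (𝕜 := 𝕜) C h (l.map (gen 𝕜 C ν)).prod ∈ Alg.gr 𝕜 C γ (l.map (Gen.deg C)).sum := by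
  induction l with
  | nil => simpa using leftPl_one_mem_gr C h
  | cons g l ih =>
    simp only [List.map_cons, List.prod_cons, List.sum_cons, leftPl_mul]
    refine mul_mem_gr C ?_ ih
    rw [leftPl_gen]
    exact Submodule.sum_mem _ fun q _ => gen_shift_mem_gr C γ [] q g

theorem rightPl_word_mem {ν ν' γ : Multiset I} (h : ν + ν' = γ) (l : List (Gen I)) :
    rightPl (𝕜 := 𝕜) C h (l.map (gen 𝕜 C ν')).prod ∈
      Alg.gr 𝕜 C γ (l.map (Gen.deg C)).sum := by
  induction l with
  | nil => simpa [← leftPl_one] using leftPl_one_mem_gr C h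
  | cons g l ih =>
    simp only [List.map_cons, List.prod_cons, List.sum_cons, rightPl_mul]
    refine mul_mem_gr C ?_ ih
    rw [rightPl_gen]
    exact Submodule.sum_mem _ fun q _ => gen_shift_mem_gr C γ q [] g

theorem hcomp_mem_gr {ν ν' γ : Multiset I} (h : ν + ν' = γ) {a : Alg 𝕜 C ν} {b : Alg 𝕜 C ν'}
    {d e : ℤ} (ha : a ∈ Alg.gr 𝕜 C ν d) (hb : b ∈ Alg.gr 𝕜 C ν' e) :
    hcomp C h a b ∈ Alg.gr 𝕜 C γ (d + e) := by
  refine mul_mem_gr C ?_ ?_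
  · have : Alg.gr 𝕜 C ν d ≤ (Alg.gr 𝕜 C γ d).comap (leftPl C h) := by
      refine Submodule.span_le.2 ?_
      rintro _ ⟨l, rfl, rfl⟩
      exact leftPl_word_mem C h l
    exact this ha
  · have : Alg.gr 𝕜 C ν' e ≤ (Alg.gr 𝕜 C γ e).comap (rightPl C h) := by
      refine Submodule.span_le.2 ?_
      rintro _ ⟨l, rfl, rfl⟩
      exact rightPl_word_mem C h l
    exact this hb

theorem par_one_mem_gr {ν γ : Multiset I} {r : ℕ} {β : Fin r → Multiset I}
    (h : ν + ∑ j, β j = γ) : par (𝕜 := 𝕜) C h 1 1 ∈ Alg.gr 𝕜 C γ 0 := by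
  have hj : ∀ {r : ℕ} (β : Fin r → Multiset I), juxt (𝕜 := 𝕜) C β 1 ∈ Alg.gr 𝕜 C _ 0 := by
    intro r
    induction r with
    | zero => exact fun β => one_mem_gr C _
    | succ r ih =>
      intro β
      have := hcomp_mem_gr C (Fin.sum_univ_succ β).symm (one_mem_gr (𝕜 := 𝕜) C _)
        (ih fun j => β j.succ)
      rwa [add_zero] at this
  have := hcomp_mem_gr C h (one_mem_gr C ν) (hj β)
  rwa [add_zero] at this

theorem exists_homogeneous_sum {ν : Multiset I} (y : Alg 𝕜 C ν) :
    ∃ f : ℤ →₀ Alg 𝕜 C ν, (∀ d, f d ∈ Alg.gr 𝕜 C ν d) ∧ (f.sum fun _ a => a) = y := by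
  have : y ∈ ⨆ d, Alg.gr 𝕜 C ν d := by rw [iSup_gr]; trivial
  obtain ⟨f, hf, hs⟩ := (Submodule.mem_iSup_iff_exists_finsupp _ _).1 this
  exact ⟨f, hf, hs⟩

end

end Algebra

/-! ### Graded modules -/

section Modules

variable (𝕜 : Type u) [Field 𝕜] {I : Type v} [DecidableEq I]

theorem internal_sub {𝕜 : Type u} [Field 𝕜] {V : Type w} [AddCommGroup V] [Module 𝕜 V]
    {G : ℤ → Submodule 𝕜 V} (hG : iSupIndep G) (N : Submodule 𝕜 V) (hN : N ≤ ⨆ d, N ⊓ G d) :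
    iSupIndep (fun d => (G d).comap N.subtype) ∧ ⨆ d, (G d).comap N.subtype = ⊤ := by
  constructor
  · refine iSupIndep_def.2 fun d => Submodule.disjoint_def.2 fun x hx hx' => ?_
    apply Subtype.ext
    refine Submodule.disjoint_def.1 (iSupIndep_def.1 hG d) _ hx ?_
    have : (⨆ (e) (_ : e ≠ d), (G e).comap N.subtype) ≤
        (⨆ (e) (_ : e ≠ d), G e).comap N.subtype :=
      iSup₂_le fun e he => Submodule.comap_mono (le_iSup₂_of_le e he le_rfl)
    exact this hx'
  · refine eq_top_iff.2 fun x _ => ?_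
    have : (⨆ d, N ⊓ G d) ≤ (⨆ d, (G d).comap N.subtype).map N.subtype := by
      refine iSup_le fun d m hm => ?_
      exact ⟨⟨m, hm.1⟩, Submodule.mem_iSup_of_mem d hm.2, rfl⟩
    obtain ⟨y, hy, hyx⟩ := this (hN x.2)
    rwa [← Subtype.ext hyx]

/-- A `ℤ`-graded (left) `R(ν)`-module. -/
structure GrMod (C : BorcherdsCartan I) (ν : Multiset I) where
  carrier : Type w
  [addCommGroup : AddCommGroup carrier]
  [vectorSpace : Module 𝕜 carrier]
  [module : Module (Alg 𝕜 C ν) carrier]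
  [tower : IsScalarTower 𝕜 (Alg 𝕜 C ν) carrier]
  /-- the homogeneous components -/
  gr : ℤ → Submodule 𝕜 carrier
  /- `carrier` is the direct sum of the `gr d` -/
  gr_indep : iSupIndep gr
  gr_iSup : ⨆ d, gr d = ⊤
  smul_mem : ∀ (d e : ℤ) (a : Alg 𝕜 C ν), a ∈ Alg.gr 𝕜 C ν d → ∀ m ∈ gr e, a • m ∈ gr (d + e)

attribute [instance] GrMod.addCommGroup GrMod.vectorSpace GrMod.module GrMod.tower

variable {𝕜}

instance (C : BorcherdsCartan I) (ν : Multiset I) : CoeSort (GrMod.{u, v, w} 𝕜 C ν) (Type w) :=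
  ⟨GrMod.carrier⟩

section

variable {C : BorcherdsCartan I} {ν : Multiset I}

theorem GrMod.internal (M : GrMod.{u, v, w} 𝕜 C ν) : DirectSum.IsInternal M.gr :=
  DirectSum.isInternal_submodule_of_iSupIndep_of_iSup_eq_top M.gr_indep M.gr_iSup

/-- The action of `a ∈ R(ν)` as a `𝕜`-linear map. -/
def GrMod.act (M : GrMod.{u, v, w} 𝕜 C ν) (a : Alg 𝕜 C ν) : M →ₗ[𝕜] M where
  toFun m := a • m
  map_add' := smul_add a
  map_smul' c m := by
    rw [RingHom.id_apply, ← smul_one_smul (Alg 𝕜 C ν) c m, smul_smul, mul_smul_comm, mul_one,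
      smul_assoc]

/-- A graded submodule: one that is spanned by homogeneous elements. -/
def GrMod.IsHomogeneous (M : GrMod.{u, v, w} 𝕜 C ν) (N : Submodule (Alg 𝕜 C ν) M) : Prop :=
  N.restrictScalars 𝕜 ≤ ⨆ d, N.restrictScalars 𝕜 ⊓ M.gr d

/-- `M` is gr-irreducible: it is nonzero and has no graded submodules except `0` and `M`. -/
def GrMod.IsIrreducible (M : GrMod.{u, v, w} 𝕜 C ν) : Prop :=
  Nontrivial M ∧ ∀ N : Submodule (Alg 𝕜 C ν) M, M.IsHomogeneous N → N = ⊥ ∨ N = ⊤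

/-- `M` and `M'` are isomorphic as graded modules (by an isomorphism of degree zero). -/
def GrMod.Iso {ν : Multiset I} (M : GrMod.{u, v, w} 𝕜 C ν) (M' : GrMod.{u, v, w} 𝕜 C ν) : Prop :=
  ∃ φ : M ≃ₗ[Alg 𝕜 C ν] M', ∀ (d : ℤ) (m : M), φ m ∈ M'.gr d ↔ m ∈ M.gr d

/-- A graded submodule, as a graded module. -/
def GrMod.sub (M : GrMod.{u, v, w} 𝕜 C ν) (N : Submodule (Alg 𝕜 C ν) M) (hN : M.IsHomogeneous N) :
    GrMod.{u, v, w} 𝕜 C ν where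
  carrier := ↥(N.restrictScalars 𝕜)
  gr d := (M.gr d).comap (N.restrictScalars 𝕜).subtype
  gr_indep := (internal_sub M.gr_indep (N.restrictScalars 𝕜) hN).1
  gr_iSup := (internal_sub M.gr_indep (N.restrictScalars 𝕜) hN).2
  smul_mem d e a ha m hm := M.smul_mem d e a ha m hm

/-- The (graded) socle of `M`, as a submodule: the sum of all gr-irreducible graded submodules. -/
def GrMod.socle (M : GrMod.{u, v, w} 𝕜 C ν) : Submodule (Alg 𝕜 C ν) M :=
  sSup {N | ∃ hN : M.IsHomogeneous N, (M.sub N hN).IsIrreducible}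

theorem GrMod.socle_isHomogeneous (M : GrMod.{u, v, w} 𝕜 C ν) : M.IsHomogeneous M.socle := by
  have h1 : M.socle.restrictScalars 𝕜 ≤
      sSup (Submodule.restrictScalars 𝕜 ''
        {N | ∃ hN : M.IsHomogeneous N, (M.sub N hN).IsIrreducible}) := by
    intro x hx
    have hx' : x ∈ sSup {N | ∃ hN : M.IsHomogeneous N, (M.sub N hN).IsIrreducible} := hx
    rw [sSup_eq_iSup', Submodule.mem_iSup_iff_exists_finsupp] at hx'
    obtain ⟨f, hf, rfl⟩ := hx'
    refine Submodule.sum_mem _ fun N _ => ?_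
    exact (le_sSup (Set.mem_image_of_mem _ N.2) :
      Submodule.restrictScalars 𝕜 N.1 ≤ _) (hf N)
  refine h1.trans (sSup_le ?_)
  rintro _ ⟨N, hN, rfl⟩
  obtain ⟨hN1, -⟩ := id hN
  refine hN1.trans (iSup_mono fun d => inf_le_inf_right _ ?_)
  intro x hx
  exact (le_sSup hN : N ≤ M.socle) hx

/-- The graded socle of `M`, as a graded module. -/
def GrMod.soc (M : GrMod.{u, v, w} 𝕜 C ν) : GrMod.{u, v, w} 𝕜 C ν :=
  M.sub M.socle M.socle_isHomogeneous

/-- The idempotent of `R(ν)` which is the sum of all `1_s`, `s ∈ Seq(ν)`, such that `s` ends with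
`n` copies of `i`.  It is `1_{ν - n i} ⊗ 1_{n i}` if `ν - n i ∈ ℕ[I]`, and `0` otherwise. -/
def tailIdem (C : BorcherdsCartan I) (ν : Multiset I) (i : I) (n : ℕ) : Alg 𝕜 C ν :=
  ∑ s ∈ (seqs ν).filter fun s => List.replicate n i <:+ s, gen 𝕜 C ν (.idem s)

/-- The subspace `Δ_{i^n} M = (1_{ν - n i} ⊗ 1_{n i}) M` of `M`. -/
def GrMod.delta (M : GrMod.{u, v, w} 𝕜 C ν) (i : I) (n : ℕ) : Submodule 𝕜 M :=
  LinearMap.range (M.act (tailIdem C ν i n))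

/-- `ε_i(M) = max {n ≥ 0 | Δ_{i^n} M ≠ 0}` (for `M ≠ 0`). -/
def GrMod.eps (M : GrMod.{u, v, w} 𝕜 C ν) (i : I) : ℕ :=
  sSup {n : ℕ | M.delta i n ≠ ⊥}

/-! ### The trivial module `V(i^n)` -/

/-- The values of generators on the one-dimensional module `V(i^n)`. -/
def trivGen (i : I) (n : ℕ) : Gen I → 𝕜
  | .idem s => if s = List.replicate n i then 1 else 0
  | .place _ _ _ => 0

theorem trivGen_rel {i : I} (hi : C.a i i ≤ 0) (n : ℕ) {x y : FreeAlgebra 𝕜 (Gen I)}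
    (h : Rel 𝕜 C (Multiset.replicate n i) x y) :
    FreeAlgebra.lift 𝕜 (trivGen (𝕜 := 𝕜) i n) x = FreeAlgebra.lift 𝕜 (trivGen (𝕜 := 𝕜) i n) y := by
  have hmem : ∀ {z q : List I} {j k : I}, z ++ [j, k] ++ q = List.replicate n i →
      j = i ∧ k = i := by
    intro z q j k h
    have hall : ∀ b ∈ z ++ [j, k] ++ q, b = i := by
      rw [h]
      exact fun b hb => List.eq_of_mem_replicate hb
    exact ⟨hall j (by simp), hall k (by simp)⟩
  cases h with
  | idem_self s => simp [trivGen]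
  | idem_ne s t hst =>
    simp only [map_mul, FreeAlgebra.lift_ι_apply, trivGen, map_zero]
    split_ifs with h1 h2 <;> simp_all
  | idem_zero s hs =>
    simp only [FreeAlgebra.lift_ι_apply, trivGen, map_zero]
    rw [if_neg]
    rintro rfl
    exact hs (Multiset.coe_replicate n i)
  | idem_sum =>
    simp only [map_sum, FreeAlgebra.lift_ι_apply, trivGen, map_one]
    rw [Finset.sum_ite_eq' (seqs _) (List.replicate n i), if_pos]
    exact mem_seqs.2 (Multiset.coe_replicate n i)
  | top z p q => simp [trivGen]
  | bot z p q => simp [trivGen]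
  | far z p m p' q => simp [trivGen]
  | double_same z j q => simp [trivGen]
  | double_orth z j k q hjk hf =>
    simp only [map_mul, FreeAlgebra.lift_ι_apply, trivGen, mul_zero]
    rw [if_neg]
    intro h
    exact hjk ((hmem h).1.trans (hmem h).2.symm)
  | double_ne z j k q hjk hf =>
    simp [trivGen, (form_ne_zero hjk hf).1, (form_ne_zero hjk hf).2]
  | slide_real_left z j q hj =>
    simp only [map_mul, map_sub, FreeAlgebra.lift_ι_apply, trivGen, mul_zero, sub_zero]
    rw [if_neg]
    intro h
    have := (hmem h).1
    subst this
    omega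
  | slide_real_right z j q hj =>
    simp only [map_mul, map_sub, FreeAlgebra.lift_ι_apply, trivGen, mul_zero, sub_zero]
    rw [if_neg]
    intro h
    have := (hmem h).1
    subst this
    omega
  | slide_left z j k q hj => simp [trivGen]
  | slide_right z j k q hj => simp [trivGen]
  | braid_real z j k q hj hjk hf =>
    simp only [map_mul, map_sub, map_sum, map_pow, FreeAlgebra.lift_ι_apply, trivGen, mul_zero,
      sub_zero]
    refine (Finset.sum_eq_zero fun c _ => ?_).symm
    rw [if_neg, mul_zero]
    intro h
    have h' : z ++ [j, k] ++ ([j] ++ q) = List.replicate n i := by rw [← h]; simp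
    exact hjk ((hmem h').1.trans (hmem h').2.symm)
  | braid z j k l q hj => simp [trivGen]

/-- The one-dimensional representation of `R(n i)`, for imaginary `i`, on which all dots and
crossings act by zero. -/
def trivRep {i : I} (hi : C.a i i ≤ 0) (n : ℕ) : Alg 𝕜 C (Multiset.replicate n i) →ₐ[𝕜] 𝕜 :=
  Alg.lift 𝕜 (FreeAlgebra.lift 𝕜 (trivGen i n)) (trivGen_rel hi n)

theorem trivRep_gen {i : I} (hi : C.a i i ≤ 0) (n : ℕ) (g : Gen I) :
    trivRep (𝕜 := 𝕜) hi n (gen 𝕜 C _ g) = trivGen i n g := by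
  rw [trivRep, gen, Alg.lift_mk, FreeAlgebra.lift_ι_apply]

theorem trivRep_eq_zero {i : I} (hi : C.a i i ≤ 0) (n : ℕ) {d : ℤ} (hd : d ≠ 0)
    {a : Alg 𝕜 C (Multiset.replicate n i)} (ha : a ∈ Alg.gr 𝕜 C _ d) :
    trivRep (𝕜 := 𝕜) hi n a = 0 := by
  have : Alg.gr 𝕜 C (Multiset.replicate n i) d ≤ LinearMap.ker (trivRep hi n).toLinearMap := by
    refine Submodule.span_le.2 ?_
    rintro _ ⟨l, hl, rfl⟩
    have : ∃ g ∈ l, g.deg C ≠ 0 := by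
      by_contra! h
      apply hd
      rw [← hl]
      exact List.sum_eq_zero (by simpa using h)
    obtain ⟨g, hg, hgd⟩ := this
    have h0 : trivRep (𝕜 := 𝕜) hi n (gen 𝕜 C _ g) = 0 := by
      rw [trivRep_gen]
      cases g with
      | idem s => exact absurd rfl hgd
      | place z p q => rfl
    simp only [SetLike.mem_coe, LinearMap.mem_ker, AlgHom.toLinearMap_apply, map_list_prod]
    refine List.prod_eq_zero ?_
    rw [List.mem_map]
    exact ⟨_, List.mem_map_of_mem hg, h0⟩
  exact this ha

/-- For imaginary `i`, the gr-irreducible module `V(i^n)` over `R(n i)`: the one-dimensional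
trivial module, concentrated in degree zero. -/
def triv (C : BorcherdsCartan I) {i : I} (hi : C.a i i ≤ 0) (n : ℕ) :
    GrMod.{u, v, u} 𝕜 C (Multiset.replicate n i) :=
  letI : Module (Alg 𝕜 C (Multiset.replicate n i)) 𝕜 := Module.compHom 𝕜 (trivRep hi n).toRingHom
  { carrier := 𝕜
    tower := ⟨fun c a m => by
      change trivRep hi n (c • a) * m = c * (trivRep hi n a * m)
      rw [map_smul, smul_eq_mul, mul_assoc]⟩
    gr := fun d => if d = 0 then ⊤ else ⊥
    gr_indep := by
      refine iSupIndep_def.2 fun d => ?_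
      by_cases hd : d = 0
      · have : (⨆ (e : ℤ) (_ : e ≠ d), (if e = 0 then ⊤ else ⊥ : Submodule 𝕜 𝕜)) = ⊥ := by
          refine eq_bot_iff.2 (iSup₂_le fun e he => ?_)
          rw [if_neg (fun h => he (h.trans hd.symm))]
        rw [this]
        exact disjoint_bot_right
      · rw [if_neg hd]
        exact disjoint_bot_left
    gr_iSup := by
      refine eq_top_iff.2 (le_iSup_of_le 0 ?_)
      rw [if_pos rfl]
    smul_mem := by
      intro d e a ha m hm
      change trivRep hi n a * m ∈ _
      by_cases he : e = 0
      · subst he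
        by_cases hd : d = 0
        · simp [hd]
        · rw [trivRep_eq_zero hi n hd ha, zero_mul]
          exact zero_mem _
      · rw [if_neg he, Submodule.mem_bot] at hm
        rw [hm, mul_zero]
        exact zero_mem _ }

end

/-! ### Co-induction -/

section

variable {C : BorcherdsCartan I} {ν : Multiset I} {r : ℕ} {β : Fin r → Multiset I}

/-- The underlying vector space of the outer tensor product `K ⊗ W_1 ⊗ ⋯ ⊗ W_r`. -/
abbrev Outer (K : GrMod.{u, v, w} 𝕜 C ν) (W : ∀ j, GrMod.{u, v, w'} 𝕜 C (β j)) : Type (max u w w') :=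
  K ⊗[𝕜] (⨂[𝕜] j, W j)

/-- The action of `a ⊗ b_1 ⊗ ⋯ ⊗ b_r ∈ R(ν) ⊗ R(β_1) ⊗ ⋯ ⊗ R(β_r)` on `K ⊗ W_1 ⊗ ⋯ ⊗ W_r`. -/
def outerAct (K : GrMod.{u, v, w} 𝕜 C ν) (W : ∀ j, GrMod.{u, v, w'} 𝕜 C (β j))
    (a : Alg 𝕜 C ν) (b : ∀ j, Alg 𝕜 C (β j)) : Outer K W →ₗ[𝕜] Outer K W :=
  TensorProduct.map (K.act a) (PiTensorProduct.map fun j => (W j).act (b j))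

/-- The component of degree `d` of `K ⊗ W_1 ⊗ ⋯ ⊗ W_r`. -/
def outerGr (K : GrMod.{u, v, w} 𝕜 C ν) (W : ∀ j, GrMod.{u, v, w'} 𝕜 C (β j)) (d : ℤ) :
    Submodule 𝕜 (Outer K W) :=
  Submodule.span 𝕜 {t | ∃ (c : ℤ) (e : Fin r → ℤ) (k : K) (x : ∀ j, W j),
    c + ∑ j, e j = d ∧ k ∈ K.gr c ∧ (∀ j, x j ∈ (W j).gr (e j)) ∧
      t = k ⊗ₜ[𝕜] PiTensorProduct.tprod 𝕜 x}

theorem outerGr_indep (K : GrMod.{u, v, w} 𝕜 C ν) (W : ∀ j, GrMod.{u, v, w'} 𝕜 C (β j)) :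
    iSupIndep (outerGr K W) := by
  classical
  let bK := K.internal.collectedBasis fun c => Module.Free.chooseBasis 𝕜 (K.gr c)
  let bW := fun j => (W j).internal.collectedBasis fun c =>
    Module.Free.chooseBasis 𝕜 ((W j).gr c)
  let B := bK.tensorProduct (Basis.piTensorProduct bW)
  have key : ∀ d, ∀ t ∈ outerGr K W d, ∀ p, p.1.1 + ∑ j, (p.2 j).1 ≠ d → B.repr t p = 0 := by
    intro d t ht p hp
    have : outerGr K W d ≤ LinearMap.ker (B.coord p) := by
      refine Submodule.span_le.2 ?_
      rintro _ ⟨c, e, k, x, hce, hk, hx, rfl⟩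
      simp only [SetLike.mem_coe, LinearMap.mem_ker, Module.Basis.coord_apply]
      obtain ⟨p1, p2⟩ := p
      rw [Module.Basis.tensorProduct_repr_tmul_apply, Basis.piTensorProduct_repr_tprod_apply]
      by_cases h1 : c = p1.1
      · have h2 : ∃ j, e j ≠ (p2 j).1 := by
          by_contra! h
          exact hp (by rw [← hce, h1, Finset.sum_congr rfl fun j _ => h j])
        obtain ⟨j, hj⟩ := h2
        have h3 : (bW j).repr (x j) (p2 j) = 0 :=
          (W j).internal.collectedBasis_repr_of_mem_ne _ hj (hx j)
        rw [Finset.prod_eq_zero (Finset.mem_univ j) h3]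
        simp
      · have h3 : bK.repr k p1 = 0 := K.internal.collectedBasis_repr_of_mem_ne _ h1 hk
        rw [h3]
        simp
    exact this ht
  refine iSupIndep_def.2 fun d => Submodule.disjoint_def.2 fun t ht ht' => ?_
  apply B.ext_elem
  intro p
  rw [map_zero, Finsupp.zero_apply]
  by_cases hp : p.1.1 + ∑ j, (p.2 j).1 = d
  · have : (⨆ (e) (_ : e ≠ d), outerGr K W e) ≤ LinearMap.ker (B.coord p) :=
      iSup₂_le fun e he s hs => key e s hs p fun h => he (h.symm.trans hp)
    exact this ht'
  · exact key d t ht p hp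

/-- The maps of degree `d` in
`HOM_{R(ν) ⊗ R(β_1) ⊗ ⋯ ⊗ R(β_r)}(1_{ν, β} R(γ), K ⊗ W_1 ⊗ ⋯ ⊗ W_r)`. -/
def homGr (K : GrMod.{u, v, w} 𝕜 C ν) (W : ∀ j, GrMod.{u, v, w'} 𝕜 C (β j)) {γ : Multiset I}
    (h : ν + ∑ j, β j = γ) (d : ℤ) : Submodule 𝕜 (parSpace (𝕜 := 𝕜) C h →ₗ[𝕜] Outer K W) where
  carrier := {f | (∀ a b y, f (parAct C h a b y) = outerAct K W a b (f y)) ∧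
    ∀ (e : ℤ) (y : parSpace (𝕜 := 𝕜) C h), y.1 ∈ Alg.gr 𝕜 C γ e → f y ∈ outerGr K W (e + d)}
  zero_mem' := ⟨fun a b y => by simp, fun e y _ => by simp⟩
  add_mem' := fun {f g} hf hg =>
    ⟨fun a b y => by simp [hf.1 a b y, hg.1 a b y],
      fun e y hy => add_mem (hf.2 e y hy) (hg.2 e y hy)⟩
  smul_mem' := fun c f hf =>
    ⟨fun a b y => by simp [hf.1 a b y], fun e y hy => Submodule.smul_mem _ c (hf.2 e y hy)⟩

/-- `HOM = ⨁_d (maps of degree d)`, inside the space of linear maps. -/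
def homSpace (K : GrMod.{u, v, w} 𝕜 C ν) (W : ∀ j, GrMod.{u, v, w'} 𝕜 C (β j)) {γ : Multiset I}
    (h : ν + ∑ j, β j = γ) : Submodule 𝕜 (parSpace (𝕜 := 𝕜) C h →ₗ[𝕜] Outer K W) :=
  ⨆ d, homGr K W h d

theorem homGr_comp {K : GrMod.{u, v, w} 𝕜 C ν} {W : ∀ j, GrMod.{u, v, w'} 𝕜 C (β j)}
    {γ : Multiset I} {h : ν + ∑ j, β j = γ} {d e : ℤ} {z : Alg 𝕜 C γ}
    (hz : z ∈ Alg.gr 𝕜 C γ e) {f : parSpace (𝕜 := 𝕜) C h →ₗ[𝕜] Outer K W}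
    (hf : f ∈ homGr K W h d) : f ∘ₗ parRight C h z ∈ homGr K W h (e + d) := by
  refine ⟨fun a b y => ?_, fun e' y hy => ?_⟩
  · rw [LinearMap.comp_apply, LinearMap.comp_apply, ← hf.1]
    congr 1
    exact Subtype.ext (mul_assoc _ _ _)
  · rw [LinearMap.comp_apply, ← add_assoc]
    exact hf.2 (e' + e) _ (mul_mem_gr C hy hz)

theorem homSpace_comp {K : GrMod.{u, v, w} 𝕜 C ν} {W : ∀ j, GrMod.{u, v, w'} 𝕜 C (β j)}
    {γ : Multiset I} {h : ν + ∑ j, β j = γ} (z : Alg 𝕜 C γ)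
    {f : parSpace (𝕜 := 𝕜) C h →ₗ[𝕜] Outer K W} (hf : f ∈ homSpace K W h) :
    f ∘ₗ parRight C h z ∈ homSpace K W h := by
  obtain ⟨g, hg, rfl⟩ := exists_homogeneous_sum C z
  have hadd : f ∘ₗ parRight C h (g.sum fun _ a => a) =
      ∑ e ∈ g.support, f ∘ₗ parRight C h (g e) := by
    ext y
    rw [LinearMap.comp_apply, LinearMap.sum_apply]
    simp only [LinearMap.comp_apply]
    rw [← map_sum]
    congr 1
    apply Subtype.ext
    rw [AddSubmonoidClass.coe_finsetSum]
    exact Finset.mul_sum _ _ _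
  rw [hadd]
  refine Submodule.sum_mem _ fun e _ => ?_
  have : homSpace K W h ≤ (homSpace K W h).comap (LinearMap.lcomp 𝕜 _ (parRight C h (g e))) :=
    iSup_le fun d f hf => Submodule.mem_iSup_of_mem (e + d) (homGr_comp (hg e) hf)
  exact this hf

theorem homGr_indep (K : GrMod.{u, v, w} 𝕜 C ν) (W : ∀ j, GrMod.{u, v, w'} 𝕜 C (β j))
    {γ : Multiset I} (h : ν + ∑ j, β j = γ) : iSupIndep (homGr K W h) := by
  refine iSupIndep_def.2 fun d => Submodule.disjoint_def.2 fun f hf hf' => ?_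
  have key : ∀ (e : ℤ) (y : parSpace (𝕜 := 𝕜) C h), y.1 ∈ Alg.gr 𝕜 C γ e → f y = 0 := by
    intro e y hy
    refine Submodule.disjoint_def.1 (iSupIndep_def.1 (outerGr_indep K W) (e + d)) _
      (hf.2 e y hy) ?_
    have : (⨆ (d') (_ : d' ≠ d), homGr K W h d') ≤
        (⨆ (e') (_ : e' ≠ e + d), outerGr K W e').comap (LinearMap.applyₗ y) := by
      refine iSup₂_le fun d' hd' g hg => ?_
      have hne : e + d' ≠ e + d := fun h => hd' (add_left_cancel h)
      exact Submodule.mem_iSup_of_mem (e + d') (Submodule.mem_iSup_of_mem hne (hg.2 e y hy))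
    exact this hf'
  ext y
  obtain ⟨g, hg, hgy⟩ := exists_homogeneous_sum C y.1
  have hy : y = ∑ e ∈ g.support, (⟨par C h 1 1 * g e, par_mul_mem C h 1 1 (g e)⟩ :
      parSpace (𝕜 := 𝕜) C h) := by
    apply Subtype.ext
    rw [AddSubmonoidClass.coe_finsetSum, ← Finset.mul_sum]
    have h1 := (mem_parSpace C h).1 y.2
    rw [← h1]
    nth_rewrite 1 [← hgy]
    rfl
  rw [hy, map_sum, LinearMap.zero_apply]
  refine Finset.sum_eq_zero fun e _ => key (0 + e) _ (mul_mem_gr C (par_one_mem_gr C h) (hg e))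

/-- The action of `R(γ)` on homomorphisms: `(z • f) y = f (y * z)`. -/
instance homSpaceModule (K : GrMod.{u, v, w} 𝕜 C ν) (W : ∀ j, GrMod.{u, v, w'} 𝕜 C (β j))
    {γ : Multiset I} (h : ν + ∑ j, β j = γ) : Module (Alg 𝕜 C γ) (homSpace K W h) where
  smul z f := ⟨f.1 ∘ₗ parRight C h z, homSpace_comp z f.2⟩
  one_smul f := Subtype.ext <| LinearMap.ext fun y =>
    congrArg f.1 (Subtype.ext (mul_one y.1))
  mul_smul z z' f := Subtype.ext <| LinearMap.ext fun y =>
    congrArg f.1 (Subtype.ext (mul_assoc y.1 z z').symm)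
  smul_zero _ := Subtype.ext (LinearMap.zero_comp _)
  smul_add _ _ _ := Subtype.ext (LinearMap.add_comp _ _ _)
  add_smul z z' f := Subtype.ext <| LinearMap.ext fun y =>
    (congrArg f.1 (Subtype.ext (mul_add y.1 z z'))).trans
      (map_add f.1 (parRight C h z y) (parRight C h z' y))
  zero_smul f := Subtype.ext <| LinearMap.ext fun y =>
    (congrArg f.1 (Subtype.ext (mul_zero y.1))).trans (map_zero f.1)

instance homSpace_tower (K : GrMod.{u, v, w} 𝕜 C ν) (W : ∀ j, GrMod.{u, v, w'} 𝕜 C (β j))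
    {γ : Multiset I} (h : ν + ∑ j, β j = γ) :
    IsScalarTower 𝕜 (Alg 𝕜 C γ) (homSpace K W h) :=
  ⟨fun c z f => Subtype.ext <| LinearMap.ext fun y =>
    (congrArg f.1 (Subtype.ext (mul_smul_comm c y.1 z))).trans
      (map_smul f.1 c (parRight C h z y))⟩

/-- The co-induced module
`HOM_{R(ν) ⊗ R(β_1) ⊗ ⋯ ⊗ R(β_r)}(1_{ν, β} R(γ), K ⊗ W_1 ⊗ ⋯ ⊗ W_r)`,
with `(z • f) y = f (y * z)` for `z ∈ R(γ)`, where `γ = ν + β_1 + ⋯ + β_r`. -/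
def coind (K : GrMod.{u, v, w} 𝕜 C ν) (W : ∀ j, GrMod.{u, v, w'} 𝕜 C (β j)) {γ : Multiset I}
    (h : ν + ∑ j, β j = γ) : GrMod.{u, v, max u v w w'} 𝕜 C γ where
  carrier := ↥(homSpace K W h)
  gr d := (homGr K W h d).comap (homSpace K W h).subtype
  gr_indep := (internal_sub (homGr_indep K W h) (homSpace K W h)
    (iSup_le fun d _ hf => Submodule.mem_iSup_of_mem d ⟨Submodule.mem_iSup_of_mem d hf, hf⟩)).1
  gr_iSup := (internal_sub (homGr_indep K W h) (homSpace K W h)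
    (iSup_le fun d _ hf => Submodule.mem_iSup_of_mem d ⟨Submodule.mem_iSup_of_mem d hf, hf⟩)).2
  smul_mem _ _ _ hz _ hf := by exact homGr_comp (K := K) (W := W) hz hf

/-- For a sequence `m = (m_1, …, m_r)` of natural numbers with sum `n`: the co-induced
`R(ν + n i)`-module of the `R(ν) ⊗ R(m_1 i) ⊗ ⋯ ⊗ R(m_r i)`-module
`K ⊗ V(i^{m_1}) ⊗ ⋯ ⊗ V(i^{m_r})`, for imaginary `i`. -/
def coindTriv (K : GrMod.{u, v, w} 𝕜 C ν) {i : I} (hi : C.a i i ≤ 0) (m : Fin r → ℕ) {n : ℕ}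
    (hm : ∑ j, m j = n) : GrMod.{u, v, max u v w} 𝕜 C (ν + Multiset.replicate n i) :=
  coind K (fun j => triv (𝕜 := 𝕜) C hi (m j)) (γ := ν + Multiset.replicate n i)
    (by rw [← hm, ← Multiset.nsmul_singleton, Finset.sum_smul]; simp only [Multiset.nsmul_singleton])

end

end Modules

end QHA

end

noncomputable section

namespace QHA

/-! ### The defining relations in `R(γ)` -/

section Relations

variable {𝕜 : Type u} [Field 𝕜] {I : Type v} [DecidableEq I] (C : BorcherdsCartan I)
  (γ : Multiset I)

/-! Put γ = ν + ni. Once K ⊗ V(i^μ) is identified with K, an element of the co-induced module is a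
linear map f : R(γ) → K which is R(ν)-linear for left multiplication and satisfies f(xy) = 0 for
every dot x of R(ni), because each dot of R(ni) lies in one of the factors R(μ_j i). Crossings are
forced to act by zero from the left only inside the blocks of μ. `Realization` records the
properties that do not depend on μ, and the structure of the socle is deduced from these alone.

The first ingredient is a spanning statement. Since i is imaginary, strands of colour i slide
through dots and crossings without correction terms. Hence 1_{ν,ni}R(γ) is spanned over R(ν) ⊗ R(ni)
by diagrams which move n marked strands of colour i to the right (`leftPl_one_mul_mem`). If the
bottom of such a diagram ends in i^k with k ≥ n, then either the diagram is an idempotent and k = n,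
or the last unmarked strand at its top has colour i (`sorted_or_exists_append`). The second kind is
killed by every f because ε_i(K) = 0. So, as far as f is concerned, the corner 1_{ν,ni}R(γ)1_{ν,ni}
is the image of R(ν) ⊗ R(ni) (`corner_mem`), and Δ_{i^k} vanishes for k > n.

The second ingredient is nilpotency. The crossings of R(ni) satisfy the nilCoxeter relations, so
every long word in dots and crossings lies in the ideal of the dots, and this ideal kills the module
(`dotIdeal_smul`). Therefore every nonzero f has a nonzero multiple on which R(ni) acts by its
trivial character (`exists_isTrivial`). Such an element is determined by its value at 1
(`eq_zero_of_apply_one`); since K is irreducible, any nonzero homogeneous one generates all the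
others (`exists_leftPl_smul_eq`). Consequently a single such element lies in every nonzero graded
submodule and generates the socle, which is gr-irreducible; it is fixed by 1_{ν,ni}, so ε_i = n.

For the isomorphism, V(i^n) restricts to V(i^μ) on R(μi). A map that is equivariant for R(ν) ⊗ R(ni)
is thus an element of both co-induced modules, with the same annihilator in each. One element z of
R(γ) then carries it to generators of both socles, of equal degree and equal annihilator. A nonzero
map of this kind must be shown to exist. No basis theorem for R(γ) is used: an explicit module is
built on K-valued functions of marked sequences, all relations are verified on it (`ghostGen_rel`),
and evaluation at the sorted sequences yields the map (`exists_hom`). -/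

theorem gen_far (z : List I) (p : Piece I) (m : List I) (p' : Piece I) (q : List I) :
    gen 𝕜 C γ (.place z p (m ++ p'.tgt ++ q)) * gen 𝕜 C γ (.place (z ++ p.src ++ m) p' q) =
      gen 𝕜 C γ (.place (z ++ p.tgt ++ m) p' q) * gen 𝕜 C γ (.place z p (m ++ p'.src ++ q)) := by
  simpa [gen] using rel_eq (Rel.far (𝕜 := 𝕜) (C := C) (ν := γ) z p m p' q)

theorem gen_double_same (z : List I) (i : I) (q : List I) :
    gen 𝕜 C γ (.place z (.cross i i) q) * gen 𝕜 C γ (.place z (.cross i i) q) = 0 := by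
  simpa [gen] using rel_eq (Rel.double_same (𝕜 := 𝕜) (C := C) (ν := γ) z i q)

theorem gen_double_orth (z : List I) {i j : I} (q : List I) (hij : i ≠ j)
    (hf : C.form i j = 0) :
    gen 𝕜 C γ (.place z (.cross j i) q) * gen 𝕜 C γ (.place z (.cross i j) q) =
      gen 𝕜 C γ (.idem (z ++ [i, j] ++ q)) := by
  simpa [gen] using rel_eq (Rel.double_orth (𝕜 := 𝕜) (C := C) (ν := γ) z i j q hij hf)

theorem gen_double_ne (z : List I) {i j : I} (q : List I) (hij : i ≠ j)
    (hf : C.form i j ≠ 0) :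
    gen 𝕜 C γ (.place z (.cross j i) q) * gen 𝕜 C γ (.place z (.cross i j) q) =
      gen 𝕜 C γ (.place z (.dot i) ([j] ++ q)) ^ (-C.a i j).toNat +
        gen 𝕜 C γ (.place (z ++ [i]) (.dot j) q) ^ (-C.a j i).toNat := by
  simpa [gen] using rel_eq (Rel.double_ne (𝕜 := 𝕜) (C := C) (ν := γ) z i j q hij hf)

theorem gen_slide_real_left (z : List I) {i : I} (q : List I) (hi : C.a i i = 2) :
    gen 𝕜 C γ (.place z (.dot i) ([i] ++ q)) * gen 𝕜 C γ (.place z (.cross i i) q) -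
      gen 𝕜 C γ (.place z (.cross i i) q) * gen 𝕜 C γ (.place (z ++ [i]) (.dot i) q) =
      gen 𝕜 C γ (.idem (z ++ [i, i] ++ q)) := by
  simpa [gen] using rel_eq (Rel.slide_real_left (𝕜 := 𝕜) (C := C) (ν := γ) z i q hi)

theorem gen_slide_real_right (z : List I) {i : I} (q : List I) (hi : C.a i i = 2) :
    gen 𝕜 C γ (.place z (.cross i i) q) * gen 𝕜 C γ (.place z (.dot i) ([i] ++ q)) -
      gen 𝕜 C γ (.place (z ++ [i]) (.dot i) q) * gen 𝕜 C γ (.place z (.cross i i) q) =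
      gen 𝕜 C γ (.idem (z ++ [i, i] ++ q)) := by
  simpa [gen] using rel_eq (Rel.slide_real_right (𝕜 := 𝕜) (C := C) (ν := γ) z i q hi)

theorem gen_slide_left (z : List I) {i j : I} (q : List I) (h : ¬(i = j ∧ C.a i i = 2)) :
    gen 𝕜 C γ (.place z (.dot j) ([i] ++ q)) * gen 𝕜 C γ (.place z (.cross i j) q) =
      gen 𝕜 C γ (.place z (.cross i j) q) * gen 𝕜 C γ (.place (z ++ [i]) (.dot j) q) := by
  simpa [gen] using rel_eq (Rel.slide_left (𝕜 := 𝕜) (C := C) (ν := γ) z i j q h)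

theorem gen_slide_right (z : List I) {i j : I} (q : List I) (h : ¬(i = j ∧ C.a i i = 2)) :
    gen 𝕜 C γ (.place z (.cross i j) q) * gen 𝕜 C γ (.place z (.dot i) ([j] ++ q)) =
      gen 𝕜 C γ (.place (z ++ [j]) (.dot i) q) * gen 𝕜 C γ (.place z (.cross i j) q) := by
  simpa [gen] using rel_eq (Rel.slide_right (𝕜 := 𝕜) (C := C) (ν := γ) z i j q h)

theorem gen_braid_real (z : List I) {i j : I} (q : List I) (hi : C.a i i = 2) (hij : i ≠ j)
    (hf : C.form i j ≠ 0) :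
    gen 𝕜 C γ (.place z (.cross j i) ([i] ++ q)) *
          gen 𝕜 C γ (.place (z ++ [j]) (.cross i i) q) *
          gen 𝕜 C γ (.place z (.cross i j) ([i] ++ q)) -
        gen 𝕜 C γ (.place (z ++ [i]) (.cross i j) q) *
          gen 𝕜 C γ (.place z (.cross i i) ([j] ++ q)) *
          gen 𝕜 C γ (.place (z ++ [i]) (.cross j i) q) =
      ∑ c ∈ Finset.range (-C.a i j).toNat,
        gen 𝕜 C γ (.place z (.dot i) ([j, i] ++ q)) ^ c *
          gen 𝕜 C γ (.place (z ++ [i, j]) (.dot i) q) ^ ((-C.a i j).toNat - 1 - c) *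
          gen 𝕜 C γ (.idem (z ++ [i, j, i] ++ q)) := by
  simpa [gen] using rel_eq (Rel.braid_real (𝕜 := 𝕜) (C := C) (ν := γ) z i j q hi hij hf)

theorem gen_braid (z : List I) {i j k : I} (q : List I)
    (h : ¬(i = k ∧ C.a i i = 2 ∧ i ≠ j ∧ C.form i j ≠ 0)) :
    gen 𝕜 C γ (.place z (.cross j k) ([i] ++ q)) *
        gen 𝕜 C γ (.place (z ++ [j]) (.cross i k) q) *
        gen 𝕜 C γ (.place z (.cross i j) ([k] ++ q)) =
      gen 𝕜 C γ (.place (z ++ [k]) (.cross i j) q) *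
        gen 𝕜 C γ (.place z (.cross i k) ([j] ++ q)) *
        gen 𝕜 C γ (.place (z ++ [i]) (.cross j k) q) := by
  simpa [gen] using rel_eq (Rel.braid (𝕜 := 𝕜) (C := C) (ν := γ) z i j k q h)

theorem idem_tgt_mul (γ : Multiset I) (g : Gen I) (s : List I) :
    gen 𝕜 C γ (.idem s) * gen 𝕜 C γ g = if s = g.tgt then gen 𝕜 C γ g else 0 := by
  split_ifs with h
  · rw [h, tgt_mul]
  · rw [← tgt_mul C γ g, ← mul_assoc, idem_mul_idem, if_neg h, zero_mul]

theorem mul_idem_src (γ : Multiset I) (g : Gen I) (s : List I) :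
    gen 𝕜 C γ g * gen 𝕜 C γ (.idem s) = if g.src = s then gen 𝕜 C γ g else 0 := by
  split_ifs with h
  · rw [← h, mul_src]
  · rw [← mul_src C γ g, mul_assoc, idem_mul_idem, if_neg h, mul_zero]

end Relations

/-! ### The trivial character of `R(n i)` -/

section Character

variable {𝕜 : Type u} [Field 𝕜] {I : Type v} [DecidableEq I] {C : BorcherdsCartan I} {i : I}

theorem coe_eq_replicate {s : List I} {n : ℕ} :
    (s : Multiset I) = Multiset.replicate n i ↔ s = List.replicate n i := by
  rw [← Multiset.coe_replicate, Multiset.coe_eq_coe, List.perm_replicate]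

theorem seqs_replicate (n : ℕ) : seqs (Multiset.replicate n i) = {List.replicate n i} := by
  ext s
  rw [mem_seqs, Finset.mem_singleton, coe_eq_replicate]

/-- The weight is a variable with an equation because the sum of the `Multiset.replicate (m j) i`
equals `Multiset.replicate n i` only propositionally, and the two weights give different algebras.
-/
theorem trivGen_rel_of_eq (hi : C.a i i ≤ 0) {n : ℕ} {ν' : Multiset I}
    (hν : ν' = Multiset.replicate n i) {x y : FreeAlgebra 𝕜 (Gen I)} (h : Rel 𝕜 C ν' x y) :
    FreeAlgebra.lift 𝕜 (trivGen (𝕜 := 𝕜) i n) x = FreeAlgebra.lift 𝕜 (trivGen (𝕜 := 𝕜) i n) y := by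
  subst hν
  exact trivGen_rel hi n h

/-- The character of `R(ν')`, where `ν' = n i` with `i` imaginary, killing dots and crossings. -/
def charOf (hi : C.a i i ≤ 0) {n : ℕ} {ν' : Multiset I} (hν : ν' = Multiset.replicate n i) :
    Alg 𝕜 C ν' →ₐ[𝕜] 𝕜 :=
  Alg.lift 𝕜 (FreeAlgebra.lift 𝕜 (trivGen i n)) (trivGen_rel_of_eq hi hν)

theorem charOf_gen (hi : C.a i i ≤ 0) {n : ℕ} {ν' : Multiset I}
    (hν : ν' = Multiset.replicate n i) (g : Gen I) :
    charOf (𝕜 := 𝕜) hi hν (gen 𝕜 C ν' g) = trivGen i n g := by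
  rw [charOf, gen, Alg.lift_mk 𝕜 _ (trivGen_rel_of_eq hi hν), FreeAlgebra.lift_ι_apply]

theorem charOf_rfl (hi : C.a i i ≤ 0) (n : ℕ) :
    charOf (𝕜 := 𝕜) hi (rfl : Multiset.replicate n i = _) = trivRep hi n := rfl

theorem alg_unit_smul {ν : Multiset I} (c : 𝕜) :
    algebraMap 𝕜 (Alg 𝕜 C ν) c = c • 1 := Algebra.algebraMap_eq_smul_one c

theorem leftPl_idem_top {ν ν' γ : Multiset I} (h : ν + ν' = γ) {n : ℕ}
    (hν : ν' = Multiset.replicate n i) (g : Gen I) :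
    leftPl (𝕜 := 𝕜) C h (gen 𝕜 C ν g) = gen 𝕜 C γ (g.shift [] (List.replicate n i)) := by
  rw [leftPl_gen, hν, seqs_replicate, Finset.sum_singleton]

theorem rightPl_gen_replicate {ν' ν'' γ : Multiset I} (h : ν' + ν'' = γ) {k : ℕ}
    (hν : ν' = Multiset.replicate k i) (g : Gen I) :
    rightPl (𝕜 := 𝕜) C h (gen 𝕜 C ν'' g) = gen 𝕜 C γ (g.shift (List.replicate k i) []) := by
  rw [rightPl_gen, hν, seqs_replicate, Finset.sum_singleton]

theorem leftPl_one_replicate {ν ν' γ : Multiset I} (h : ν + ν' = γ) {k l : ℕ}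
    (hν : ν = Multiset.replicate k i) (hν' : ν' = Multiset.replicate l i) :
    leftPl (𝕜 := 𝕜) C h 1 = 1 := by
  subst hν hν'
  have hγ : γ = Multiset.replicate (k + l) i := by rw [← h, Multiset.replicate_add]
  subst hγ
  rw [← sum_idem, ← sum_idem, map_sum, seqs_replicate, seqs_replicate,
    Finset.sum_singleton, Finset.sum_singleton, leftPl_gen, seqs_replicate,
    Finset.sum_singleton]
  simp [Gen.shift]

theorem trivGen_shift_left (k l : ℕ) (g : Gen I) :
    trivGen (𝕜 := 𝕜) i (k + l) (g.shift [] (List.replicate l i)) = trivGen i k g := by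
  cases g with
  | idem s =>
    simp only [Gen.shift, trivGen, List.nil_append, ← List.replicate_append_replicate,
      List.append_cancel_right_eq]
  | place z p q => rfl

theorem trivGen_shift_right (k l : ℕ) (g : Gen I) :
    trivGen (𝕜 := 𝕜) i (k + l) (g.shift (List.replicate k i) []) = trivGen i l g := by
  cases g with
  | idem s =>
    simp only [Gen.shift, trivGen, List.append_nil, ← List.replicate_append_replicate,
      List.append_cancel_left_eq]
  | place z p q => rfl

theorem charOf_hcomp (hi : C.a i i ≤ 0) {ν ν' γ : Multiset I} (h : ν + ν' = γ) {k l N : ℕ}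
    (hν : ν = Multiset.replicate k i) (hν' : ν' = Multiset.replicate l i)
    (hγ : γ = Multiset.replicate N i) (a : Alg 𝕜 C ν) (b : Alg 𝕜 C ν') :
    charOf hi hγ (hcomp C h a b) = charOf hi hν a * charOf hi hν' b := by
  have hN : N = k + l := by
    have := congrArg Multiset.card h
    simpa [hν, hν', hγ] using this.symm
  subst hN
  have h1 : charOf hi hγ (leftPl C h a) = charOf hi hν a := by
    induction a using alg_induction with
    | hc c => simp [alg_unit_smul, map_smul, leftPl_one_replicate h hν hν']
    | hg g => rw [leftPl_idem_top h hν', charOf_gen, charOf_gen, trivGen_shift_left]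
    | hm a b ha hb => rw [leftPl_mul, map_mul, map_mul, ha, hb]
    | ha a b ha hb => rw [map_add, map_add, map_add, ha, hb]
  have h2 : charOf hi hγ (rightPl C h b) = charOf hi hν' b := by
    induction b using alg_induction with
    | hc c => simp [alg_unit_smul, map_smul, ← leftPl_one, leftPl_one_replicate h hν hν']
    | hg g => rw [rightPl_gen_replicate h hν, charOf_gen, charOf_gen, trivGen_shift_right]
    | hm a b ha hb => rw [rightPl_mul, map_mul, map_mul, ha, hb]
    | ha a b ha hb => rw [map_add, map_add, map_add, ha, hb]
  rw [hcomp, map_mul, h1, h2]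

theorem sum_replicate {r : ℕ} (m : Fin r → ℕ) :
    ∑ j, Multiset.replicate (m j) i = Multiset.replicate (∑ j, m j) i := by
  rw [← Multiset.nsmul_singleton, Finset.sum_smul]
  simp only [Multiset.nsmul_singleton]

/-- The restriction of V(i^n) to R(μi) is V(i^μ). This is what allows one and the same map to be an
element of the co-induced modules for different compositions. -/
theorem charOf_juxt (hi : C.a i i ≤ 0) {r : ℕ} (m : Fin r → ℕ) {n : ℕ}
    (hν : ∑ j, Multiset.replicate (m j) i = Multiset.replicate n i)
    (b : ∀ j, Alg 𝕜 C (Multiset.replicate (m j) i)) :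
    charOf hi hν (juxt C _ b) = ∏ j, trivRep hi (m j) (b j) := by
  induction r generalizing n with
  | zero => simp [juxt]
  | succ r ih =>
    rw [juxt, charOf_hcomp hi _ rfl (sum_replicate fun j => m j.succ), Fin.prod_univ_succ, ih,
      charOf_rfl]

theorem juxt_one {r : ℕ} (m : Fin r → ℕ) :
    juxt C (fun j => Multiset.replicate (m j) i) (fun _ => (1 : Alg 𝕜 C _)) = 1 := by
  induction r with
  | zero => rfl
  | succ r ih =>
    rw [juxt, ih fun j => m j.succ, hcomp, leftPl_one, ← rightPl_mul, mul_one, ← leftPl_one,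
      leftPl_one_replicate _ rfl (sum_replicate fun j => m j.succ)]

/-- A dot in `R(m_1 i + ⋯ + m_r i)` comes from one of the factors. -/
theorem exists_juxt_eq_dot (hi : C.a i i ≤ 0) {r : ℕ} (m : Fin r → ℕ) (k l : ℕ)
    (hkl : k + 1 + l = ∑ j, m j) :
    ∃ b : ∀ j, Alg 𝕜 C (Multiset.replicate (m j) i), juxt C _ b =
      gen 𝕜 C _ (.place (List.replicate k i) (.dot i) (List.replicate l i)) ∧
      ∏ j, trivRep hi (m j) (b j) = 0 := by
  induction r generalizing k l with
  | zero => simp at hkl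
  | succ r ih =>
    rw [Fin.sum_univ_succ] at hkl
    -- Strands are numbered from 0. The dot sits in the first block, or in a later one after its
    -- position is shifted by `m 0`. A crossing between two blocks admits no such description.
    by_cases hk : k < m 0
    · obtain ⟨l', hl'⟩ : ∃ l', m 0 = k + 1 + l' := ⟨m 0 - (k + 1), by omega⟩
      refine ⟨Fin.cons (gen 𝕜 C _ (.place (List.replicate k i) (.dot i)
        (List.replicate l' i))) fun _ => 1, ?_, ?_⟩
      · simp only [juxt, Fin.cons_zero, Fin.cons_succ]
        rw [juxt_one fun j => m j.succ, hcomp, ← leftPl_one, ← leftPl_mul, mul_one,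
          leftPl_idem_top _ (sum_replicate fun j => m j.succ)]
        simp only [Gen.shift, List.nil_append, List.replicate_append_replicate]
        congr 3
        omega
      · rw [Fin.prod_univ_succ, Fin.cons_zero, trivRep_gen]
        simp [trivGen]
    · obtain ⟨k', rfl⟩ : ∃ k', k = m 0 + k' := ⟨k - m 0, by omega⟩
      obtain ⟨b, hb, hb'⟩ := ih (fun j => m j.succ) k' l (by omega)
      refine ⟨Fin.cons 1 b, ?_, ?_⟩
      · simp only [juxt, Fin.cons_zero, Fin.cons_succ]
        rw [hb, hcomp, leftPl_one, ← rightPl_mul, one_mul, rightPl_gen_replicate _ rfl]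
        simp only [Gen.shift, List.append_nil, List.replicate_append_replicate]
      · rw [Fin.prod_univ_succ]
        simp only [Fin.cons_succ, hb', mul_zero]

end Character

/-! ### Moving strands of an imaginary colour to the right -/

section Sorting

variable {𝕜 : Type u} [Field 𝕜] {I : Type v} [DecidableEq I] {C : BorcherdsCartan I}
  {γ : Multiset I} {i : I}

variable (𝕜 C γ i) in
/-- The diagram in which a strand coloured `i` crosses the strands `s` from left to right, with
vertical strands `z` on the left and `q` on the right. -/
def strandOver : List I → List I → List I → Alg 𝕜 C γ
  | [], z, q => gen 𝕜 C γ (.idem (z ++ i :: q))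
  | j :: s, z, q => strandOver s (z ++ [j]) q * gen 𝕜 C γ (.place z (.cross i j) (s ++ q))

theorem mul_gen_eq_zero {x : Alg 𝕜 C γ} {u : List I} (hx : x * gen 𝕜 C γ (.idem u) = x) {g : Gen I}
    (h : u ≠ g.tgt) : x * gen 𝕜 C γ g = 0 := by
  rw [← hx, mul_assoc, idem_tgt_mul, if_neg h, mul_zero]

theorem strandOver_src (s z q : List I) :
    strandOver 𝕜 C γ i s z q * gen 𝕜 C γ (.idem (z ++ i :: (s ++ q))) =
      strandOver 𝕜 C γ i s z q := by
  cases s with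
  | nil => simp [strandOver, idem_mul_idem]
  | cons j s => rw [strandOver, mul_assoc, mul_idem_src, if_pos (by simp [Gen.src, Piece.src])]

theorem strandOver_tgt (s z q : List I) :
    gen 𝕜 C γ (.idem (z ++ (s ++ i :: q))) * strandOver 𝕜 C γ i s z q =
      strandOver 𝕜 C γ i s z q := by
  induction s generalizing z with
  | nil => simp [strandOver, idem_mul_idem]
  | cons j s ih =>
    have := ih (z ++ [j])
    simp only [List.append_assoc, List.cons_append, List.nil_append] at this ⊢
    rw [strandOver, ← mul_assoc, this]

theorem strandOver_append (s s' z q : List I) :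
    strandOver 𝕜 C γ i (s ++ s') z q =
      strandOver 𝕜 C γ i s' (z ++ s) q * strandOver 𝕜 C γ i s z (s' ++ q) := by
  induction s generalizing z with
  | nil =>
    have := strandOver_src (𝕜 := 𝕜) (C := C) (γ := γ) (i := i) s' z q
    simp only [List.nil_append, List.append_nil, strandOver, this]
  | cons j s ih =>
    simp only [List.cons_append, strandOver, ih, mul_assoc, List.append_assoc, List.nil_append]

theorem gen_far' (z : List I) (p : Piece I) (m : List I) (p' : Piece I) (q : List I) :
    gen 𝕜 C γ (.place z p (m ++ (p'.tgt ++ q))) * gen 𝕜 C γ (.place (z ++ (p.src ++ m)) p' q) =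
      gen 𝕜 C γ (.place (z ++ (p.tgt ++ m)) p' q) *
        gen 𝕜 C γ (.place z p (m ++ (p'.src ++ q))) := by
  simpa only [List.append_assoc] using gen_far (𝕜 := 𝕜) C γ z p m p' q

/-- The piece lies to the right of all strands that are crossed, so only isotopy is needed. -/
theorem strandOver_mul_right (s z q₁ : List I) (p : Piece I) (q₂ : List I) :
    strandOver 𝕜 C γ i s z (q₁ ++ (p.tgt ++ q₂)) *
        gen 𝕜 C γ (.place (z ++ i :: (s ++ q₁)) p q₂) =
      gen 𝕜 C γ (.place (z ++ (s ++ i :: q₁)) p q₂) *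
        strandOver 𝕜 C γ i s z (q₁ ++ (p.src ++ q₂)) := by
  induction s generalizing z with
  | nil =>
    simp only [strandOver, List.nil_append]
    rw [idem_tgt_mul, mul_idem_src, if_pos (by simp [Gen.tgt]), if_pos (by simp [Gen.src])]
  | cons j s ih =>
    have h1 := ih (z ++ [j])
    have h2 := gen_far' (𝕜 := 𝕜) (C := C) (γ := γ) z (.cross i j) (s ++ q₁) p q₂
    simp only [Piece.src, Piece.tgt, List.append_assoc, List.cons_append, List.nil_append,
      strandOver] at h1 h2 ⊢
    rw [mul_assoc, h2, ← mul_assoc, h1, mul_assoc]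

theorem strandOver_mul_left (s z₁ : List I) (p : Piece I) (z₂ q : List I) :
    strandOver 𝕜 C γ i s (z₁ ++ (p.tgt ++ z₂)) q *
        gen 𝕜 C γ (.place z₁ p (z₂ ++ i :: (s ++ q))) =
      gen 𝕜 C γ (.place z₁ p (z₂ ++ (s ++ i :: q))) *
        strandOver 𝕜 C γ i s (z₁ ++ (p.src ++ z₂)) q := by
  induction s generalizing z₂ with
  | nil =>
    simp only [strandOver, List.nil_append]
    rw [idem_tgt_mul, mul_idem_src, if_pos (by simp [Gen.tgt]), if_pos (by simp [Gen.src])]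
  | cons j s ih =>
    have h1 := ih (z₂ ++ [j])
    have h2 := gen_far' (𝕜 := 𝕜) (C := C) (γ := γ) z₁ p z₂ (.cross i j) (s ++ q)
    simp only [Piece.src, Piece.tgt, List.append_assoc, List.cons_append, List.nil_append,
      strandOver] at h1 h2 ⊢
    rw [mul_assoc, ← h2, ← mul_assoc, h1, mul_assoc]

theorem not_real {j : I} (hi : C.a i i ≤ 0) (P : Prop) : ¬(i = j ∧ C.a i i = 2 ∧ P) :=
  fun h => by omega

/-- A dot slides through because the colour i is not real. A crossing slides through by the braid
relation: its correction term requires both outer strands to have the same real colour, and one of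
them is the moving strand of imaginary colour i. -/
theorem strandOver_mul_piece (hi : C.a i i ≤ 0) (z : List I) (p : Piece I) (q : List I) :
    strandOver 𝕜 C γ i p.tgt z q * gen 𝕜 C γ (.place (z ++ [i]) p q) =
      gen 𝕜 C γ (.place z p (i :: q)) * strandOver 𝕜 C γ i p.src z q := by
  have hid : ∀ (g : Gen I) (u : List I), g.tgt = u →
      gen 𝕜 C γ (.idem u) * gen 𝕜 C γ g = gen 𝕜 C γ g := by
    rintro g u rfl
    exact tgt_mul C γ g
  cases p with
  | dot j =>
    simp only [Piece.tgt, Piece.src, strandOver, List.nil_append]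
    rw [hid _ _ (by simp [Gen.tgt, Piece.tgt]),
      ← gen_slide_left C γ z q (fun h => by omega)]
    rfl
  | cross a b =>
    have := gen_braid (𝕜 := 𝕜) C γ (i := i) (j := a) (k := b) z q (not_real hi _)
    simp only [Piece.tgt, Piece.src, strandOver, List.cons_append, List.nil_append] at this ⊢
    rw [hid _ _ (by simp [Gen.tgt, Piece.tgt]), hid _ _ (by simp [Gen.tgt, Piece.tgt]), ← this,
      mul_assoc]

/-- The path of the moving strand splits into the parts before, across and after the piece; the
outer two parts commute with it by isotopy. -/
theorem strandOver_mul_inner (hi : C.a i i ≤ 0) (z s₁ : List I) (p : Piece I) (s₂ q : List I) :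
    strandOver 𝕜 C γ i (s₁ ++ (p.tgt ++ s₂)) z q *
        gen 𝕜 C γ (.place (z ++ i :: s₁) p (s₂ ++ q)) =
      gen 𝕜 C γ (.place (z ++ s₁) p (s₂ ++ i :: q)) *
        strandOver 𝕜 C γ i (s₁ ++ (p.src ++ s₂)) z q := by
  have h1 := strandOver_mul_right (𝕜 := 𝕜) (C := C) (γ := γ) (i := i) s₁ z [] p (s₂ ++ q)
  have h2 := strandOver_mul_piece (𝕜 := 𝕜) (γ := γ) hi (z ++ s₁) p (s₂ ++ q)
  have h3 := strandOver_mul_left (𝕜 := 𝕜) (C := C) (γ := γ) (i := i) s₂ (z ++ s₁) p [] q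
  simp only [strandOver_append, List.append_assoc, List.append_nil,
    List.nil_append] at h1 h2 h3 ⊢
  rw [mul_assoc, h1, mul_assoc, ← mul_assoc _ (gen 𝕜 C γ _), h2, ← mul_assoc, ← mul_assoc, h3]
  simp only [mul_assoc]

theorem strandOver_mul_dot (hi : C.a i i ≤ 0) (s z q : List I) :
    strandOver 𝕜 C γ i s z q * gen 𝕜 C γ (.place z (.dot i) (s ++ q)) =
      gen 𝕜 C γ (.place (z ++ s) (.dot i) q) * strandOver 𝕜 C γ i s z q := by
  induction s generalizing z with
  | nil =>
    simp only [strandOver, List.nil_append, List.append_nil]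
    rw [idem_tgt_mul, mul_idem_src, if_pos (by simp [Gen.tgt, Piece.tgt]),
      if_pos (by simp [Gen.src, Piece.src])]
  | cons j s ih =>
    have h1 := ih (z ++ [j])
    have h2 := gen_slide_right (𝕜 := 𝕜) C γ (i := i) (j := j) z (s ++ q) (fun h => by omega)
    simp only [List.append_assoc, List.cons_append, List.nil_append, strandOver] at h1 h2 ⊢
    rw [mul_assoc, h2, ← mul_assoc, h1, mul_assoc]

/-- The crossing of the two parallel strands of colour i is carried past the strands of `s` one at a
time. Each passage is a braid relation with bottom colours i, i, j, again without correction term.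
-/
theorem strandOver_mul_cross (hi : C.a i i ≤ 0) (s z q : List I) :
    strandOver 𝕜 C γ i s z (i :: q) * (strandOver 𝕜 C γ i s (z ++ [i]) q *
        gen 𝕜 C γ (.place z (.cross i i) (s ++ q))) =
      gen 𝕜 C γ (.place (z ++ s) (.cross i i) q) *
        (strandOver 𝕜 C γ i s z (i :: q) * strandOver 𝕜 C γ i s (z ++ [i]) q) := by
  induction s generalizing z with
  | nil =>
    simp [strandOver, idem_tgt_mul, mul_idem_src, Gen.src, Gen.tgt, Piece.src,
      Piece.tgt]
  | cons j s ih =>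
    have h1 := ih (z ++ [j])
    have h2 := gen_braid (𝕜 := 𝕜) C γ (i := i) (j := i) (k := j) z (s ++ q) (not_real hi _)
    have h3 := strandOver_mul_left (𝕜 := 𝕜) (C := C) (γ := γ) (i := i) s z (.cross i j) [] q
    simp only [Piece.src, Piece.tgt, List.append_assoc, List.cons_append, List.nil_append,
      strandOver, mul_assoc] at h1 h2 h3 ⊢
    have e1 : gen 𝕜 C γ (.place z (.cross i j) (s ++ i :: q)) *
          (strandOver 𝕜 C γ i s (z ++ [i, j]) q *
            (gen 𝕜 C γ (.place (z ++ [i]) (.cross i j) (s ++ q)) *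
              gen 𝕜 C γ (.place z (.cross i i) (j :: (s ++ q))))) =
        strandOver 𝕜 C γ i s (z ++ [j, i]) q *
          (gen 𝕜 C γ (.place (z ++ [j]) (.cross i i) (s ++ q)) *
            (gen 𝕜 C γ (.place z (.cross i j) (i :: (s ++ q))) *
              gen 𝕜 C γ (.place (z ++ [i]) (.cross i j) (s ++ q)))) := by
      rw [← mul_assoc, ← h3, mul_assoc, h2]
    rw [e1, ← mul_assoc (strandOver 𝕜 C γ i s (z ++ [j, i]) q), ← mul_assoc, h1]
    simp only [mul_assoc]
    congr 2
    rw [← mul_assoc _ (gen 𝕜 C γ (.place z (.cross i j) (i :: (s ++ q)))), h3, mul_assoc]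

end Sorting

/-! ### Marked sequences and sorting diagrams -/

section Marked

variable {I : Type v} {i : I}

/-- The colours of a marked sequence: marked strands (`none`) have colour `i`. -/
abbrev colours (i : I) (t : List (Option I)) : List I := t.map (·.getD i)

/-- The number of marked strands. -/
def marks (t : List (Option I)) : ℕ := t.countP Option.isNone

@[simp] theorem marks_nil : marks ([] : List (Option I)) = 0 := rfl

@[simp] theorem marks_some (j : I) (t : List (Option I)) : marks (some j :: t) = marks t := by
  simp [marks]

@[simp] theorem marks_none (t : List (Option I)) : marks (none :: t) = marks t + 1 := by
  simp [marks]

@[simp] theorem marks_append (t t' : List (Option I)) :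
    marks (t ++ t') = marks t + marks t' := List.countP_append

end Marked

section Sorting

variable {𝕜 : Type u} [Field 𝕜] {I : Type v} [DecidableEq I] {C : BorcherdsCartan I}
  {γ : Multiset I} {i : I}

variable (𝕜 C γ i) in
/-- The diagram which moves the marked strands of a marked sequence to the right, without
crossings between two marked or two unmarked strands. -/
def sortDiag : List (Option I) → List I → List I → Alg 𝕜 C γ
  | [], z, q => gen 𝕜 C γ (.idem (z ++ q))
  | some j :: t, z, q => sortDiag t (z ++ [j]) q
  | none :: t, z, q =>
    strandOver 𝕜 C γ i t.reduceOption z (List.replicate (marks t) i ++ q) *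
      sortDiag t (z ++ [i]) q

theorem sortDiag_src (t : List (Option I)) (z q : List I) :
    sortDiag 𝕜 C γ i t z q * gen 𝕜 C γ (.idem (z ++ (colours i t ++ q))) =
      sortDiag 𝕜 C γ i t z q := by
  induction t generalizing z with
  | nil => simp [sortDiag, idem_mul_idem]
  | cons x t ih =>
    have := ih (z ++ [x.getD i])
    cases x <;>
      simp only [colours, sortDiag, List.map_cons, List.append_assoc, List.cons_append,
        List.nil_append, Option.getD_none, Option.getD_some, mul_assoc] at this ⊢ <;>
      rw [this]

theorem sortDiag_tgt (t : List (Option I)) (z q : List I) :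
    gen 𝕜 C γ (.idem (z ++ (t.reduceOption ++ (List.replicate (marks t) i ++ q)))) *
      sortDiag 𝕜 C γ i t z q = sortDiag 𝕜 C γ i t z q := by
  induction t generalizing z with
  | nil => simp [sortDiag, idem_mul_idem]
  | cons x t ih =>
    cases x with
    | some j => simpa [sortDiag] using ih (z ++ [j])
    | none =>
      have := strandOver_tgt (𝕜 := 𝕜) (C := C) (γ := γ) (i := i) t.reduceOption z
        (List.replicate (marks t) i ++ q)
      rw [sortDiag, ← mul_assoc]
      simp only [List.reduceOption_cons_of_none, marks_none, List.replicate_succ,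
        List.cons_append]
      rw [this]

theorem sortDiag_mul_left (t : List (Option I)) (z₁ : List I) (p : Piece I) (z₂ q : List I) :
    sortDiag 𝕜 C γ i t (z₁ ++ (p.tgt ++ z₂)) q *
        gen 𝕜 C γ (.place z₁ p (z₂ ++ (colours i t ++ q))) =
      gen 𝕜 C γ (.place z₁ p (z₂ ++ (t.reduceOption ++ (List.replicate (marks t) i ++ q)))) *
        sortDiag 𝕜 C γ i t (z₁ ++ (p.src ++ z₂)) q := by
  induction t generalizing z₂ with
  | nil =>
    simp only [sortDiag, idem_tgt_mul, mul_idem_src]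
    simp [Gen.src, Gen.tgt]
  | cons x t ih =>
    have h1 := ih (z₂ ++ [x.getD i])
    cases x with
    | some j => simpa [sortDiag] using h1
    | none =>
      have h2 := strandOver_mul_left (𝕜 := 𝕜) (C := C) (γ := γ) (i := i) t.reduceOption z₁ p z₂
        (List.replicate (marks t) i ++ q)
      simp only [colours, sortDiag, List.map_cons, List.append_assoc, List.cons_append,
        List.nil_append, Option.getD_none, List.reduceOption_cons_of_none, marks_none,
        List.replicate_succ] at h1 h2 ⊢
      rw [mul_assoc, h1, ← mul_assoc, h2, mul_assoc]

variable (𝕜 C γ i) in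
/-- Generators on the sorted strands: either on the unmarked strands or on the `c` marked strands. -/
def sortedGens (c : ℕ) (z q : List I) : Set (Alg 𝕜 C γ) :=
  {x | ∃ z₁ p z₂, x = gen 𝕜 C γ (.place (z ++ z₁) p (z₂ ++ (List.replicate c i ++ q)))} ∪
    {x | ∃ s k p l, List.replicate k i ++ (p.src ++ List.replicate l i) = List.replicate c i ∧
      p.tgt = p.src ∧
      x = gen 𝕜 C γ (.place (z ++ (s ++ List.replicate k i)) p (List.replicate l i ++ q))}

variable (𝕜 C γ i) in
/-- The span of the sorting diagrams over the algebra generated by `sortedGens`. -/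
def sortSpan (c : ℕ) (z q : List I) : Submodule 𝕜 (Alg 𝕜 C γ) :=
  Submodule.span 𝕜 {y | ∃ h ∈ Submonoid.closure (sortedGens 𝕜 C γ i c z q), ∃ t,
    marks t = c ∧ y = h * sortDiag 𝕜 C γ i t z q}

theorem sortDiag_mem_sortSpan (t : List (Option I)) (z q : List I) :
    sortDiag 𝕜 C γ i t z q ∈ sortSpan 𝕜 C γ i (marks t) z q :=
  Submodule.subset_span ⟨1, one_mem _, t, rfl, (one_mul _).symm⟩

theorem mul_mem_sortSpan {c : ℕ} {z q : List I} {x y : Alg 𝕜 C γ}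
    (hx : x ∈ Submonoid.closure (sortedGens 𝕜 C γ i c z q)) (hy : y ∈ sortSpan 𝕜 C γ i c z q) :
    x * y ∈ sortSpan 𝕜 C γ i c z q := by
  have : sortSpan 𝕜 C γ i c z q ≤
      (sortSpan 𝕜 C γ i c z q).comap (LinearMap.mulLeft 𝕜 x) := by
    refine Submodule.span_le.2 ?_
    rintro _ ⟨h, hh, t, ht, rfl⟩
    exact Submodule.subset_span ⟨x * h, mul_mem hx hh, t, ht, (mul_assoc _ _ _).symm⟩
  exact this hy

/-- The vertical strand `j` is reinterpreted as one more unmarked strand of the sequence to be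
sorted. -/
theorem sortSpan_some_le (c : ℕ) (z : List I) (j : I) (q : List I) :
    sortSpan 𝕜 C γ i c (z ++ [j]) q ≤ sortSpan 𝕜 C γ i c z q := by
  refine Submodule.span_le.2 ?_
  rintro _ ⟨h, hh, t, ht, rfl⟩
  refine Submodule.subset_span ⟨h, Submonoid.closure_mono ?_ hh, some j :: t, by simpa, rfl⟩
  rintro x (⟨z₁, p, z₂, rfl⟩ | ⟨s, k, p, l, h1, h2, rfl⟩)
  · exact Or.inl ⟨j :: z₁, p, z₂, by simp⟩
  · exact Or.inr ⟨j :: s, k, p, l, h1, h2, by simp⟩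

/-- The generators above a sorting diagram are pulled upwards through the additional strand one by
one: those on the unmarked strands by `strandOver_mul_inner`, those on the marked strands by
`strandOver_mul_right`. Pairs whose end sequences do not match multiply to zero. -/
theorem strandOver_mul_mem_sortSpan (hi : C.a i i ≤ 0) {c : ℕ} {z q : List I} (s : List I)
    {y : Alg 𝕜 C γ} (hy : y ∈ sortSpan 𝕜 C γ i c (z ++ [i]) q) :
    strandOver 𝕜 C γ i s z (List.replicate c i ++ q) * y ∈ sortSpan 𝕜 C γ i (c + 1) z q := by
  have key : ∀ h ∈ Submonoid.closure (sortedGens 𝕜 C γ i c (z ++ [i]) q), ∀ s t, marks t = c →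
      strandOver 𝕜 C γ i s z (List.replicate c i ++ q) *
        (h * sortDiag 𝕜 C γ i t (z ++ [i]) q) ∈ sortSpan 𝕜 C γ i (c + 1) z q := by
    intro h hh
    induction hh using Submonoid.closure_induction_left with
    | one =>
      rintro s t rfl
      rw [one_mul]
      -- If the sequences match, the product is by definition the sorting diagram of `none :: t`.
      by_cases hs : s = t.reduceOption
      · subst hs
        have := sortDiag_mem_sortSpan (𝕜 := 𝕜) (C := C) (γ := γ) (i := i) (none :: t) z q
        rwa [marks_none, sortDiag] at this
      · rw [← strandOver_src, ← sortDiag_tgt, mul_assoc, ← mul_assoc (gen 𝕜 C γ _),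
          idem_mul_idem, if_neg]
        · simp
        · simpa using hs
    | mul_left x hx y hy ih =>
      intro s t ht
      have h0 : ∀ g : Gen I, z ++ i :: (s ++ (List.replicate c i ++ q)) ≠ g.tgt →
          strandOver 𝕜 C γ i s z (List.replicate c i ++ q) *
            (gen 𝕜 C γ g * y * sortDiag 𝕜 C γ i t (z ++ [i]) q) ∈
            sortSpan 𝕜 C γ i (c + 1) z q := by
        intro g hg
        rw [mul_assoc, ← mul_assoc, mul_gen_eq_zero (strandOver_src s z _) hg, zero_mul]
        exact zero_mem _
      obtain ⟨z₁, p, z₂, rfl⟩ | ⟨s', k, p, l, h1, h2, rfl⟩ := hx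
      · by_cases hs : s = z₁ ++ (p.tgt ++ z₂)
        · subst hs
          have := strandOver_mul_inner (𝕜 := 𝕜) (γ := γ) hi z z₁ p z₂
            (List.replicate c i ++ q)
          simp only [List.append_assoc, List.cons_append, List.nil_append] at this ⊢
          rw [mul_assoc, ← mul_assoc, this, mul_assoc]
          refine mul_mem_sortSpan (Submonoid.subset_closure (Or.inl ⟨z₁, p, z₂, ?_⟩)) (ih _ _ ht)
          simp [List.replicate_succ]
        · apply h0
          intro h
          apply hs
          simp only [Gen.tgt, List.append_assoc, List.cons_append, List.nil_append,
            List.append_cancel_left_eq, List.cons.injEq, true_and] at h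
          simpa only [← List.append_assoc, List.append_cancel_right_eq] using h
      · by_cases hs : s = s'
        · subst hs
          have := strandOver_mul_right (𝕜 := 𝕜) (C := C) (γ := γ) (i := i) s z
            (List.replicate k i) p (List.replicate l i ++ q)
          have h3 : List.replicate k i ++ (p.src ++ (List.replicate l i ++ q)) =
              List.replicate c i ++ q := by rw [← h1]; simp
          rw [h2, h3] at this
          simp only [List.append_assoc, List.cons_append, List.nil_append] at this ⊢
          rw [mul_assoc, ← mul_assoc, this, mul_assoc]
          -- At the top the additional strand stands to the left of the other marked strands, hence
          -- `k + 1`.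
          refine mul_mem_sortSpan (Submonoid.subset_closure
            (Or.inr ⟨s, k + 1, p, l, ?_, h2, ?_⟩)) (ih _ _ ht)
          · simp [List.replicate_succ, h1]
          · simp [List.replicate_succ]
        · apply h0
          intro h
          apply hs
          have h3 : List.replicate k i ++ (p.src ++ (List.replicate l i ++ q)) =
              List.replicate c i ++ q := by rw [← h1]; simp
          simp only [Gen.tgt, h2, List.append_assoc, List.cons_append, List.nil_append, h3,
            List.append_cancel_left_eq, List.cons.injEq, true_and] at h
          simpa only [← List.append_assoc, List.append_cancel_right_eq] using h
  have : sortSpan 𝕜 C γ i c (z ++ [i]) q ≤ (sortSpan 𝕜 C γ i (c + 1) z q).comap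
      (LinearMap.mulLeft 𝕜 (strandOver 𝕜 C γ i s z (List.replicate c i ++ q))) := by
    refine Submodule.span_le.2 ?_
    rintro _ ⟨h, hh, t, ht, rfl⟩
    exact key h hh s t ht
  exact this hy

/-- Every generator attached at the bottom of a sorting diagram can be pushed to its top, or changes
the sequence that is sorted, or closes a double crossing. Which of these happens depends on the
marks of the strands it touches. -/
theorem sortDiag_mul_gen (hi : C.a i i ≤ 0) (t : List (Option I)) (z q z' : List I) (p : Piece I)
    (q' : List I) (ht : colours i t = z' ++ (p.tgt ++ q')) :
    sortDiag 𝕜 C γ i t z q * gen 𝕜 C γ (.place (z ++ z') p (q' ++ q)) ∈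
      sortSpan 𝕜 C γ i (marks t) z q := by
  induction t generalizing z z' with
  | nil =>
    cases p <;> simp [Piece.tgt] at ht
  | cons x t ih =>
    cases z' with
    | cons j z' =>
      simp only [colours, List.map_cons, List.cons_append, List.cons.injEq] at ht
      obtain ⟨rfl, ht⟩ := ht
      have h1 := ih (z ++ [x.getD i]) z' ht
      simp only [List.append_assoc, List.cons_append, List.nil_append] at h1
      cases x with
      | some j =>
        rw [marks_some]
        exact sortSpan_some_le _ _ _ _ h1
      | none =>
        rw [sortDiag, marks_none, mul_assoc]
        exact strandOver_mul_mem_sortSpan hi _ h1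
    | nil =>
      cases p with
      | dot j =>
        simp only [Piece.tgt, colours, List.map_cons, List.cons_append, List.nil_append,
          List.cons.injEq] at ht
        obtain ⟨rfl, rfl⟩ := ht
        cases x with
        | some j =>
          have h1 := sortDiag_mul_left (𝕜 := 𝕜) (C := C) (γ := γ) (i := i) t z (.dot j) [] q
          simp only [Piece.tgt, Piece.src, List.append_nil, List.nil_append] at h1
          simp only [sortDiag, marks_some, List.append_nil, Option.getD_some]
          rw [h1]
          exact mul_mem_sortSpan (Submonoid.subset_closure (Or.inl ⟨[], .dot j, t.reduceOption,
            by simp⟩)) (by simpa [sortDiag] using sortDiag_mem_sortSpan (some j :: t) z q)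
        | none =>
          have h1 := sortDiag_mul_left (𝕜 := 𝕜) (C := C) (γ := γ) (i := i) t z (.dot i) [] q
          have h2 := strandOver_mul_dot (𝕜 := 𝕜) (γ := γ) hi t.reduceOption z
            (List.replicate (marks t) i ++ q)
          simp only [Piece.tgt, Piece.src, List.append_nil, List.nil_append] at h1
          simp only [sortDiag, marks_none, List.append_nil, Option.getD_none]
          rw [mul_assoc, h1, ← mul_assoc, h2, mul_assoc]
          refine mul_mem_sortSpan (Submonoid.subset_closure (Or.inr ⟨t.reduceOption, 0, .dot i,
            marks t, ?_, rfl, by simp⟩)) (by simpa [sortDiag] using sortDiag_mem_sortSpan (none :: t) z q)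
          simp [Piece.src, List.replicate_succ]
      | cross a b =>
        cases t with
        | nil => simp [Piece.tgt] at ht
        | cons y t =>
          simp only [Piece.tgt, colours, List.map_cons, List.cons_append, List.nil_append,
            List.cons.injEq] at ht
          obtain ⟨rfl, rfl, rfl⟩ := ht
          have h1 := sortDiag_mul_left (𝕜 := 𝕜) (C := C) (γ := γ) (i := i) t z
            (.cross (y.getD i) (x.getD i)) [] q
          cases x with
          | some b =>
            cases y with
            | some a =>
              simp only [Piece.tgt, Piece.src, List.append_nil, List.nil_append, sortDiag,
                marks_some, Option.getD_some, List.append_assoc, List.cons_append] at h1 ⊢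
              rw [h1]
              refine mul_mem_sortSpan (Submonoid.subset_closure (Or.inl ⟨[], .cross a b,
                t.reduceOption, by simp⟩)) ?_
              simpa [sortDiag] using sortDiag_mem_sortSpan (some a :: some b :: t) z q
            | none =>
              simp only [Piece.tgt, Piece.src, List.append_nil, List.nil_append, sortDiag,
                marks_some, marks_none, Option.getD_some, Option.getD_none, List.append_assoc,
                List.cons_append] at h1 ⊢
              -- The new crossing moves the marked strand to the right, and so extends the diagram
              -- to the sorting diagram of `none :: some b :: t`.
              rw [mul_assoc, h1, ← mul_assoc]
              simpa [sortDiag, strandOver] using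
                sortDiag_mem_sortSpan (𝕜 := 𝕜) (C := C) (γ := γ) (i := i) (none :: some b :: t) z q
          | none =>
            cases y with
            | none =>
              have h2 := strandOver_mul_cross (𝕜 := 𝕜) (γ := γ) hi t.reduceOption z
                (List.replicate (marks t) i ++ q)
              simp only [Piece.tgt, Piece.src, List.append_nil, List.nil_append, sortDiag,
                marks_none, Option.getD_none, List.append_assoc,
                List.cons_append, List.reduceOption_cons_of_none, List.replicate_succ] at h1 ⊢
              -- Two marked strands cross: the crossing is pushed to the top, where it becomes a
              -- crossing of the two leftmost marked strands.
              rw [mul_assoc, mul_assoc, h1, ← mul_assoc (strandOver 𝕜 C γ i _ (z ++ [i]) _),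
                ← mul_assoc, h2, mul_assoc, mul_assoc]
              refine mul_mem_sortSpan (Submonoid.subset_closure (Or.inr ⟨t.reduceOption, 0,
                .cross i i, marks t, ?_, rfl, by simp⟩)) ?_
              · simp [Piece.src, List.replicate_succ]
              · simpa [sortDiag, List.replicate_succ] using
                  sortDiag_mem_sortSpan (𝕜 := 𝕜) (C := C) (γ := γ) (i := i) (none :: none :: t) z q
            | some a =>
              -- The marked strand crosses `a` twice. The quadratic relation replaces the double
              -- crossing by zero, by an idempotent or by powers of dots on the two strands; the
              -- dots then slide up through the rest of the marked strand.
              set rq := t.reduceOption ++ (List.replicate (marks t) i ++ q) with hrq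
              have h3 := sortDiag_mem_sortSpan (𝕜 := 𝕜) (C := C) (γ := γ) (i := i)
                (some a :: none :: t) z q
              have hdl : strandOver 𝕜 C γ i t.reduceOption (z ++ [a])
                    (List.replicate (marks t) i ++ q) *
                  gen 𝕜 C γ (.place z (.dot a) ([i] ++ rq)) =
                  gen 𝕜 C γ (.place z (.dot a) (t.reduceOption ++ (List.replicate (marks t + 1) i
                    ++ q))) * strandOver 𝕜 C γ i t.reduceOption (z ++ [a])
                    (List.replicate (marks t) i ++ q) := by
                have := strandOver_mul_left (𝕜 := 𝕜) (C := C) (γ := γ) (i := i) t.reduceOption z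
                  (.dot a) [] (List.replicate (marks t) i ++ q)
                simpa [Piece.src, Piece.tgt, List.replicate_succ] using this
              have hdr : strandOver 𝕜 C γ i t.reduceOption (z ++ [a])
                    (List.replicate (marks t) i ++ q) *
                  gen 𝕜 C γ (.place (z ++ [a]) (.dot i) rq) =
                  gen 𝕜 C γ (.place (z ++ (a :: t.reduceOption)) (.dot i)
                    (List.replicate (marks t) i ++ q)) *
                    strandOver 𝕜 C γ i t.reduceOption (z ++ [a])
                    (List.replicate (marks t) i ++ q) := by
                have := strandOver_mul_dot (𝕜 := 𝕜) (γ := γ) hi t.reduceOption (z ++ [a])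
                  (List.replicate (marks t) i ++ q)
                simpa using this
              have hpow : ∀ (x x' s : Alg 𝕜 C γ) (m : ℕ), s * x = x' * s →
                  s * x ^ m = x' ^ m * s := fun x x' s m h => by
                induction m with
                | zero => simp
                | succ m ih => rw [pow_succ, ← mul_assoc, ih, mul_assoc, h, ← mul_assoc, pow_succ]
              simp only [Piece.tgt, Piece.src, List.append_nil, List.nil_append, sortDiag,
                marks_some, marks_none, Option.getD_some, Option.getD_none, List.append_assoc,
                List.cons_append, List.reduceOption_cons_of_some, strandOver] at h1 h3 ⊢
              rw [mul_assoc, h1, ← mul_assoc, mul_assoc (strandOver 𝕜 C γ i _ _ _)]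
              by_cases hai : a = i
              · subst hai
                rw [gen_double_same]
                simp
              by_cases hf : C.form a i = 0
              · rw [gen_double_orth C γ z _ hai hf, mul_assoc]
                have : gen 𝕜 C γ (.idem (z ++ [a, i] ++ rq)) *
                    sortDiag 𝕜 C γ i t (z ++ [a, i]) q = sortDiag 𝕜 C γ i t (z ++ [a, i]) q := by
                  have := sortDiag_tgt (𝕜 := 𝕜) (C := C) (γ := γ) (i := i) t (z ++ [a, i]) q
                  simpa [hrq] using this
                rw [this]
                exact h3
              · rw [gen_double_ne C γ z _ hai hf, mul_add, add_mul, hpow _ _ _ _ hdl,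
                  hpow _ _ _ _ hdr, mul_assoc, mul_assoc]
                refine add_mem (mul_mem_sortSpan (Submonoid.pow_mem _ (Submonoid.subset_closure ?_)
                  _) h3) (mul_mem_sortSpan (Submonoid.pow_mem _ (Submonoid.subset_closure ?_) _) h3)
                · exact Or.inl ⟨[], .dot a, t.reduceOption, by simp⟩
                · refine Or.inr ⟨a :: t.reduceOption, 0, .dot i, marks t, ?_, rfl, by simp⟩
                  simp [Piece.src, List.replicate_succ]

end Sorting

/-! ### Spanning of 1_{ν,ni} R(ν + ni) over R(ν) ⊗ R(ni) -/

section Spanning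

variable {𝕜 : Type u} [Field 𝕜] {I : Type v} [DecidableEq I] {C : BorcherdsCartan I}
  {γ : Multiset I} {i : I}

theorem marks_map_some (s : List I) : marks (s.map some) = 0 := by
  induction s with
  | nil => rfl
  | cons j s ih => simpa using ih

theorem marks_replicate_none (n : ℕ) : marks (List.replicate n (none : Option I)) = n := by
  induction n with
  | zero => rfl
  | succ n ih => simpa [List.replicate_succ] using ih

theorem reduceOption_map_some (s : List I) : (s.map some).reduceOption = s := by
  induction s with
  | nil => rfl
  | cons j s ih => simpa using ih

/-- The sorted marked sequence with unmarked strands `s` and `n` marked strands. -/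
def sortedSeq (s : List I) (n : ℕ) : List (Option I) := s.map some ++ List.replicate n none

@[simp] theorem colours_sortedSeq (s : List I) (n : ℕ) :
    colours i (sortedSeq s n) = s ++ List.replicate n i := by
  simp [sortedSeq, colours, Function.comp_def]

@[simp] theorem marks_sortedSeq (s : List I) (n : ℕ) : marks (sortedSeq s n) = n := by
  simp [sortedSeq, marks_map_some, marks_replicate_none]

@[simp] theorem reduceOption_sortedSeq (s : List I) (n : ℕ) :
    (sortedSeq s n).reduceOption = s := by
  simp [sortedSeq, List.reduceOption_append, reduceOption_map_some]

theorem sortDiag_sortedSeq (s : List I) (n : ℕ) (z q : List I) :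
    sortDiag 𝕜 C γ i (sortedSeq s n) z q =
      gen 𝕜 C γ (.idem (z ++ (s ++ (List.replicate n i ++ q)))) := by
  induction s generalizing z with
  | cons j s ih =>
    have := ih (z ++ [j])
    simpa [sortedSeq, sortDiag] using this
  | nil =>
    simp only [sortedSeq, List.map_nil, List.nil_append]
    induction n generalizing z with
    | zero => simp [sortDiag]
    | succ n ih =>
      rw [List.replicate_succ, sortDiag, ih, marks_replicate_none, List.reduceOption_replicate_none,
        strandOver, idem_mul_idem, if_pos (by simp)]
      simp [List.replicate_succ]

/-- It suffices to multiply by generators: a matching idempotent changes nothing, a dot or crossing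
is absorbed by `sortDiag_mul_gen`, and a generator with the wrong top sequence gives zero. -/
theorem mul_mem_sortSpan_right (hi : C.a i i ≤ 0) {n : ℕ} {x : Alg 𝕜 C γ}
    (hx : x ∈ sortSpan 𝕜 C γ i n [] []) (y : Alg 𝕜 C γ) : x * y ∈ sortSpan 𝕜 C γ i n [] [] := by
  induction y using alg_induction generalizing x with
  | hc c =>
    rw [alg_unit_smul, mul_smul_comm, mul_one]
    exact Submodule.smul_mem _ _ hx
  | hm a b ha hb => rw [← mul_assoc]; exact hb (ha hx)
  | ha a b ha hb => rw [mul_add]; exact add_mem (ha hx) (hb hx)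
  | hg g =>
    have : sortSpan 𝕜 C γ i n [] [] ≤
        (sortSpan 𝕜 C γ i n [] []).comap (LinearMap.mulRight 𝕜 (gen 𝕜 C γ g)) := by
      refine Submodule.span_le.2 ?_
      rintro _ ⟨h, hh, t, rfl, rfl⟩
      simp only [SetLike.mem_coe, Submodule.mem_comap, LinearMap.mulRight_apply]
      rw [mul_assoc]
      refine mul_mem_sortSpan hh ?_
      have h1 := sortDiag_src (𝕜 := 𝕜) (C := C) (γ := γ) (i := i) t [] []
      rw [List.nil_append, List.append_nil] at h1
      by_cases hg : colours i t = g.tgt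
      · cases g with
        | idem s =>
          rw [Gen.tgt] at hg
          rw [← hg, h1]
          exact sortDiag_mem_sortSpan t [] []
        | place z p q =>
          have := sortDiag_mul_gen (𝕜 := 𝕜) (γ := γ) hi t [] [] z p q
            (by rw [hg, Gen.tgt, List.append_assoc])
          simpa using this
      · rw [mul_gen_eq_zero h1 hg]
        exact zero_mem _
    exact this hx

variable {ν ν' : Multiset I} {n : ℕ}

theorem leftPl_idem_eq (h : ν + ν' = γ) (hν : ν' = Multiset.replicate n i) (s : List I) :
    leftPl (𝕜 := 𝕜) C h (gen 𝕜 C ν (.idem s)) = gen 𝕜 C γ (.idem (s ++ List.replicate n i)) := by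
  rw [leftPl_idem_top h hν]
  simp [Gen.shift]

theorem leftPl_idem_mul_rightPl (h : ν + ν' = γ) (s : List I) {g : Gen I}
    (hg : (g.src : Multiset I) = ν') :
    leftPl (𝕜 := 𝕜) C h (gen 𝕜 C ν (.idem s)) * rightPl C h (gen 𝕜 C ν' g) =
      gen 𝕜 C γ (g.shift s []) := by
  by_cases hs : (s : Multiset I) = ν
  swap
  · rw [idem_eq_zero C hs, map_zero, zero_mul, gen_eq_zero]
    rw [Gen.shift_src, ← h, List.append_nil, ← Multiset.coe_add, hg]
    exact fun h' => hs (add_right_cancel h')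
  have hgt := g.coe_src ▸ hg
  rw [leftPl_gen, rightPl_gen, Finset.sum_mul_sum,
    Finset.sum_eq_single_of_mem g.tgt (mem_seqs.2 hgt),
    Finset.sum_eq_single_of_mem s (mem_seqs.2 hs)]
  · have := tgt_mul (𝕜 := 𝕜) C γ (g.shift s [])
    rw [Gen.shift_tgt] at this
    simpa [Gen.shift] using this
  · intro z hz hne
    rw [Gen.shift, idem_tgt_mul, if_neg]
    rw [Gen.shift_tgt]
    simpa using hne.symm
  · intro q hq hne
    refine Finset.sum_eq_zero fun z hz => ?_
    rw [Gen.shift, idem_tgt_mul, if_neg]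
    have hl : s.length = z.length := by
      have := congrArg Multiset.card (hs.trans (mem_seqs.1 hz).symm)
      simpa using this
    rw [Gen.shift_tgt]
    intro h'
    simp only [List.nil_append, List.append_nil] at h'
    exact hne (List.append_inj h' hl).2

variable (𝕜 C i) in
/-- The span of the sorting diagrams over `R(ν) ⊗ R(n i)`. -/
def markedSortSpan (h : ν + ν' = γ) (n : ℕ) : Submodule 𝕜 (Alg 𝕜 C γ) :=
  Submodule.span 𝕜 {y | ∃ a c t, marks t = n ∧
    y = leftPl C h a * rightPl C h c * sortDiag 𝕜 C γ i t [] []}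

theorem sortSpan_le (h : ν + ν' = γ) (hν : ν' = Multiset.replicate n i) :
    sortSpan 𝕜 C γ i n [] [] ≤ markedSortSpan 𝕜 C i h n := by
  refine Submodule.span_le.2 ?_
  rintro _ ⟨x, hx, t, ht, rfl⟩
  simp only [SetLike.mem_coe]
  induction hx using Submonoid.closure_induction_left with
  | one =>
    have h1 := sortDiag_tgt (𝕜 := 𝕜) (C := C) (γ := γ) (i := i) t [] []
    rw [List.nil_append, List.append_nil, ht, ← leftPl_idem_eq h hν] at h1
    -- The empty word is the unit of R(γ), not 1_{ν,ν'}; the idempotent at the top of the sorting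
    -- diagram makes up for the difference.
    refine Submodule.subset_span ⟨gen 𝕜 C ν (.idem t.reduceOption), 1, t, ht, ?_⟩
    rw [← leftPl_one, ← leftPl_mul, mul_one, h1, one_mul]
  | mul_left x hx y hy ih =>
    have key : markedSortSpan 𝕜 C i h n ≤
        (markedSortSpan 𝕜 C i h n).comap (LinearMap.mulLeft 𝕜 x) := by
      refine Submodule.span_le.2 ?_
      rintro _ ⟨a, c, t, ht, rfl⟩
      simp only [SetLike.mem_coe, Submodule.mem_comap, LinearMap.mulLeft_apply]
      obtain ⟨z₁, p, z₂, rfl⟩ | ⟨s, k, p, l, h1, h2, rfl⟩ := hx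
      · refine Submodule.subset_span ⟨gen 𝕜 C ν (.place z₁ p z₂) * a, c, t, ht, ?_⟩
        rw [leftPl_mul, leftPl_idem_top h hν]
        simp [Gen.shift, mul_assoc]
      · refine Submodule.subset_span ⟨gen 𝕜 C ν (.idem s) * a, gen 𝕜 C ν' (.place
          (List.replicate k i) p (List.replicate l i)) * c, t, ht, ?_⟩
        have h3 := leftPl_idem_mul_rightPl (𝕜 := 𝕜) (C := C) h s (g := .place
          (List.replicate k i) p (List.replicate l i))
          (by rw [Gen.src, List.append_assoc, h1, hν, Multiset.coe_replicate])
        simp only [Gen.shift, List.append_nil] at h3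
        -- A generator on the marked strands comes with an idempotent on the unmarked ones, and it
        -- is moved past `a` because R(ν) and R(ni) commute.
        rw [leftPl_mul, rightPl_mul, mul_assoc (leftPl C h (gen 𝕜 C ν _)),
          ← mul_assoc (leftPl C h a), leftPl_comm C h a (gen 𝕜 C ν' _), List.nil_append,
          List.append_nil, ← h3]
        simp only [mul_assoc]
    rw [mul_assoc]
    exact key ih

/-- The idempotent 1_{ν,ni} is the sum of the sorting diagrams of the sequences that are already
sorted, and the span is a right ideal. -/
theorem leftPl_one_mul_mem (hi : C.a i i ≤ 0) (h : ν + ν' = γ)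
    (hν : ν' = Multiset.replicate n i) (y : Alg 𝕜 C γ) :
    leftPl C h 1 * y ∈ markedSortSpan 𝕜 C i h n := by
  refine sortSpan_le h hν (mul_mem_sortSpan_right hi ?_ y)
  rw [← sum_idem, map_sum]
  refine Submodule.sum_mem _ fun s _ => ?_
  rw [leftPl_idem_eq h hν]
  have := sortDiag_mem_sortSpan (𝕜 := 𝕜) (C := C) (γ := γ) (i := i) (sortedSeq s n) [] []
  simpa [sortDiag_sortedSeq] using this

theorem exists_append_of_colours {t : List (Option I)} {k : ℕ}
    (h : colours i t = List.replicate k i) (ht : t.reduceOption ≠ []) :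
    ∃ s, t.reduceOption = s ++ [i] := by
  have h1 : t.reduceOption = List.replicate t.reduceOption.length i := by
    rw [List.eq_replicate_iff]
    refine ⟨rfl, fun j hj => ?_⟩
    rw [List.reduceOption_mem_iff] at hj
    have : j ∈ colours i t := List.mem_map.2 ⟨some j, hj, rfl⟩
    rw [h] at this
    exact List.eq_of_mem_replicate this
  obtain ⟨l, hl⟩ := Nat.exists_eq_succ_of_ne_zero (fun h => ht (List.length_eq_zero_iff.1 h))
  rw [hl, Nat.succ_eq_add_one, List.replicate_succ'] at h1
  exact ⟨_, h1⟩

theorem eq_replicate_none_of_reduceOption {t : List (Option I)} (ht : t.reduceOption = []) :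
    t = List.replicate t.length none := by
  rw [List.eq_replicate_iff]
  refine ⟨rfl, fun x hx => ?_⟩
  cases x with
  | none => rfl
  | some j =>
    rw [← List.reduceOption_mem_iff, ht] at hx
    simp at hx

theorem eq_map_some_of_marks {t : List (Option I)} (ht : marks t = 0) :
    t = t.reduceOption.map some := by
  induction t with
  | nil => rfl
  | cons x t ih =>
    cases x with
    | none => simp at ht
    | some j => simpa using ih (by simpa using ht)

/-- A marked sequence whose colours end with `k ≥ n` strands of colour `i`, where `n` is the number
of marks, is sorted, or its last unmarked strand has colour `i`. -/
theorem sorted_or_exists_append {t : List (Option I)} {s : List I} {k : ℕ}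
    (ht : colours i t = s ++ List.replicate k i) (hk : marks t ≤ k) :
    (k = marks t ∧ t = sortedSeq s k) ∨ ∃ s', t.reduceOption = s' ++ [i] := by
  -- The last `k` entries of `t` all have colour i. If all of them are marked, the bound on the
  -- number of marks leaves none for `t₁`; otherwise the last unmarked entry among them is the last
  -- unmarked entry of `t`.
  obtain ⟨t₁, t₂, rfl, h1, h2⟩ := List.map_eq_append_iff.1 ht
  by_cases h3 : t₂.reduceOption = []
  · left
    have h4 := eq_replicate_none_of_reduceOption h3
    have h5 : t₂.length = k := by simpa using congrArg List.length h2
    rw [h5] at h4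
    subst h4
    rw [marks_append, marks_replicate_none] at hk ⊢
    have h6 : marks t₁ = 0 := by omega
    refine ⟨by omega, ?_⟩
    have h7 := eq_map_some_of_marks h6
    rw [sortedSeq]
    rw [h7, List.map_map] at h1
    have : t₁.reduceOption = s := by simpa [Function.comp_def] using h1
    rw [← this, ← h7]
  · right
    obtain ⟨s', hs'⟩ := exists_append_of_colours h2 h3
    exact ⟨t₁.reduceOption ++ s', by rw [List.reduceOption_append, hs', List.append_assoc]⟩

variable (𝕜 C i) in
/-- The right ideal generated by the idempotents `1_s ⊗ 1_{n i}` such that `s` ends with `i`. -/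
def tailIdeal (h : ν + ν' = γ) : Submodule 𝕜 (Alg 𝕜 C γ) :=
  Submodule.span 𝕜 {y | ∃ a s x, y = leftPl C h (a * gen 𝕜 C ν (.idem (s ++ [i]))) * x}

theorem tailIdeal_mul (h : ν + ν' = γ) {x : Alg 𝕜 C γ} (hx : x ∈ tailIdeal 𝕜 C i h)
    (y : Alg 𝕜 C γ) : x * y ∈ tailIdeal 𝕜 C i h := by
  have : tailIdeal 𝕜 C i h ≤ (tailIdeal 𝕜 C i h).comap (LinearMap.mulRight 𝕜 y) := by
    refine Submodule.span_le.2 ?_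
    rintro _ ⟨a, s, x, rfl⟩
    exact Submodule.subset_span ⟨a, s, x * y, mul_assoc _ _ _⟩
  exact this hx

variable (𝕜 C) in
/-- The image of `R(ν) ⊗ R(ν')`. -/
def parabolic (h : ν + ν' = γ) : Submodule 𝕜 (Alg 𝕜 C γ) :=
  Submodule.span 𝕜 {y | ∃ a c, y = leftPl C h a * rightPl C h c}

/-- Of the sorting diagrams only those with bottom `s ++ List.replicate k i` survive. A sorted one,
possible only for k = n, contributes to the parabolic part; any other one has an unmarked strand of
colour i just before the marked strands at its top. -/
theorem mem_sup_of_idem (hi : C.a i i ≤ 0) (h : ν + ν' = γ)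
    (hν : ν' = Multiset.replicate n i) (y : Alg 𝕜 C γ) (s : List I) {k : ℕ} (hk : n ≤ k) :
    leftPl C h 1 * y * gen 𝕜 C γ (.idem (s ++ List.replicate k i)) ∈
      (if k = n then parabolic 𝕜 C h else ⊥) ⊔ tailIdeal 𝕜 C i h := by
  have key : markedSortSpan 𝕜 C i h n ≤
      ((if k = n then parabolic 𝕜 C h else ⊥) ⊔ tailIdeal 𝕜 C i h).comap
        (LinearMap.mulRight 𝕜 (gen 𝕜 C γ (.idem (s ++ List.replicate k i)))) := by
    refine Submodule.span_le.2 ?_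
    rintro _ ⟨a, c, t, rfl, rfl⟩
    simp only [SetLike.mem_coe, Submodule.mem_comap, LinearMap.mulRight_apply]
    have h1 := sortDiag_src (𝕜 := 𝕜) (C := C) (γ := γ) (i := i) t [] []
    rw [List.nil_append, List.append_nil] at h1
    by_cases ht : colours i t = s ++ List.replicate k i
    swap
    · rw [← h1, mul_assoc, mul_assoc, mul_assoc, idem_mul_idem, if_neg ht]
      simp
    rw [mul_assoc, ← ht, h1]
    obtain ⟨hk', hs⟩ | ⟨s', hs'⟩ := sorted_or_exists_append ht hk
    · refine Submodule.mem_sup_left ?_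
      rw [if_pos hk']
      refine Submodule.subset_span ⟨a * gen 𝕜 C ν (.idem s), c, ?_⟩
      rw [hs, sortDiag_sortedSeq, leftPl_mul, leftPl_idem_eq h hν, hk', ← leftPl_idem_eq h hν,
        mul_assoc, mul_assoc, leftPl_comm]
      simp [← leftPl_idem_eq h hν]
    · refine Submodule.mem_sup_right ?_
      refine Submodule.subset_span ⟨a, s', rightPl C h c * sortDiag 𝕜 C γ i t [] [], ?_⟩
      have h2 := sortDiag_tgt (𝕜 := 𝕜) (C := C) (γ := γ) (i := i) t [] []
      rw [List.nil_append, List.append_nil, ← leftPl_idem_eq h hν, hs'] at h2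
      rw [leftPl_mul, mul_assoc, mul_assoc, ← mul_assoc (leftPl C h (gen 𝕜 C ν _)), leftPl_comm,
        mul_assoc (rightPl C h c), h2]
  exact key (leftPl_one_mul_mem hi h hν y)

theorem mul_idem_mem_tailIdeal (hi : C.a i i ≤ 0) (h : ν + ν' = γ)
    (hν : ν' = Multiset.replicate n i) (y : Alg 𝕜 C γ) (s : List I) {k : ℕ} (hk : n < k) :
    leftPl C h 1 * y * gen 𝕜 C γ (.idem (s ++ List.replicate k i)) ∈ tailIdeal 𝕜 C i h := by
  have := mem_sup_of_idem hi h hν y s hk.le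
  rwa [if_neg (by omega), bot_sup_eq] at this

/-- A Mackey-type decomposition with all but the trivial term collected in `tailIdeal`, which cannot
be seen by maps into K when ε_i(K) = 0. -/
theorem corner_mem (hi : C.a i i ≤ 0) (h : ν + ν' = γ)
    (hν : ν' = Multiset.replicate n i) (y : Alg 𝕜 C γ) :
    leftPl C h 1 * y * leftPl C h 1 ∈ parabolic 𝕜 C h ⊔ tailIdeal 𝕜 C i h := by
  nth_rewrite 2 [← sum_idem]
  rw [map_sum, Finset.mul_sum]
  refine Submodule.sum_mem _ fun s _ => ?_
  have := mem_sup_of_idem hi h hν y s le_rfl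
  rwa [if_pos rfl, ← leftPl_idem_eq h hν] at this

end Spanning

/-! ### Nilpotency in `R(n i)` -/

section NilCoxeter

variable {A : Type*} [MonoidWithZero A] {τ : ℕ → A}

/-- `descend τ k d = τ_{k+d-1} ⋯ τ_{k+1} τ_k`. -/
def descend (τ : ℕ → A) (k : ℕ) : ℕ → A
  | 0 => 1
  | d + 1 => descend τ (k + 1) d * τ k

theorem descend_far (hc : ∀ k l, k + 1 < l → τ k * τ l = τ l * τ k) {j k : ℕ} (hjk : j + 1 < k)
    (d : ℕ) : descend τ k d * τ j = τ j * descend τ k d := by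
  induction d generalizing k with
  | zero => simp [descend]
  | succ d ih => rw [descend, mul_assoc, ← hc j k hjk, ← mul_assoc, ih (by omega), mul_assoc]

/-- Moving left, `τ j` commutes with the factors below `τ (j - 1)`, meets `τ j * τ (j - 1)`, where
the braid relation turns it into `τ (j - 1)`, and commutes with all the remaining factors. -/
theorem descend_mul (hb : ∀ k, τ k * τ (k + 1) * τ k = τ (k + 1) * τ k * τ (k + 1))
    (hc : ∀ k l, k + 1 < l → τ k * τ l = τ l * τ k) {j k d : ℕ} (hkj : k < j)
    (hjd : j < k + d) : descend τ k d * τ j = τ (j - 1) * descend τ k d := by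
  induction d generalizing k with
  | zero => omega
  | succ d ih =>
    by_cases hj : j = k + 1
    · subst hj
      obtain ⟨d, rfl⟩ : ∃ d', d = d' + 1 := ⟨d - 1, by omega⟩
      rw [descend, descend, mul_assoc, mul_assoc, ← mul_assoc (τ (k + 1)), ← hb,
        Nat.add_sub_cancel, ← mul_assoc, ← mul_assoc, descend_far hc (by omega)]
      simp only [mul_assoc]
    · rw [descend, mul_assoc, hc k j (by omega), ← mul_assoc, ih (by omega) (by omega), mul_assoc]

/-- This is the decomposition of a permutation along the cosets of the symmetric group on one letter
fewer. In the nilCoxeter monoid a word either vanishes or is rewritten without changing its length,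
so the lengths can be counted. -/
theorem exists_word_mul_descend (h0 : ∀ k, τ k * τ k = 0)
    (hb : ∀ k, τ k * τ (k + 1) * τ k = τ (k + 1) * τ k * τ (k + 1))
    (hc : ∀ k l, k + 1 < l → τ k * τ l = τ l * τ k) (n : ℕ) (l : List ℕ)
    (hl : ∀ j ∈ l, j < n + 1) :
    (l.map τ).prod = 0 ∨ ∃ (l' : List ℕ) (k d : ℕ), (∀ j ∈ l', j < n) ∧ k + d = n + 1 ∧
      l.length = l'.length + d ∧ (l.map τ).prod = (l'.map τ).prod * descend τ k d := by
  induction l using List.reverseRecOn with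
  | nil => exact Or.inr ⟨[], n + 1, 0, by simp, rfl, rfl, by simp [descend]⟩
  | append_singleton l j ih =>
    rw [List.map_append, List.prod_append]
    obtain h | ⟨l', k, d, h1, h2, h3, h4⟩ := ih fun j hj => hl j (by simp [hj])
    · exact Or.inl (by rw [h, zero_mul])
    have hj := hl j (by simp)
    simp only [List.map_cons, List.map_nil, List.prod_singleton, List.length_append,
      List.length_singleton]
    rw [h4, mul_assoc]
    have happ : ∀ j', j' < n → descend τ k d * τ j = τ j' * descend τ k d →
        ∃ (l'' : List ℕ) (k' d' : ℕ), (∀ j ∈ l'', j < n) ∧ k' + d' = n + 1 ∧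
        l.length + 1 = l''.length + d' ∧
        (l'.map τ).prod * (descend τ k d * τ j) = (l''.map τ).prod * descend τ k' d' := by
      intro j' hj' hjj
      refine ⟨l' ++ [j'], k, d, ?_, h2, by simp; omega, by simp [hjj, mul_assoc]⟩
      intro x hx
      obtain hx | hx := List.mem_append.1 hx
      · exact h1 x hx
      · rw [List.mem_singleton.1 hx]; exact hj'
    rcases lt_trichotomy (j + 1) k with hk | hk | hk
    · exact Or.inr (happ j (by omega) (descend_far hc hk d))
    · subst hk
      exact Or.inr ⟨l', j, d + 1, h1, by omega, by omega, rfl⟩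
    · by_cases hjk : j = k
      · subst hjk
        obtain ⟨d, rfl⟩ : ∃ d', d = d' + 1 := ⟨d - 1, by omega⟩
        left
        rw [descend, mul_assoc, h0, mul_zero, mul_zero]
      · exact Or.inr (happ (j - 1) (by omega) (descend_mul hb hc (by omega) (by omega)))

/-- Long words in the generators of a nilCoxeter monoid vanish. -/
theorem prod_eq_zero_of_length (h0 : ∀ k, τ k * τ k = 0)
    (hb : ∀ k, τ k * τ (k + 1) * τ k = τ (k + 1) * τ k * τ (k + 1))
    (hc : ∀ k l, k + 1 < l → τ k * τ l = τ l * τ k) (n : ℕ) (l : List ℕ)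
    (hl : ∀ j ∈ l, j < n) (hn : n * n < l.length) : (l.map τ).prod = 0 := by
  induction n generalizing l with
  | zero =>
    cases l with
    | nil => simp at hn
    | cons j l => exact absurd (hl j (by simp)) (by omega)
  | succ n ih =>
    obtain h | ⟨l', k, d, h1, h2, h3, h4⟩ := exists_word_mul_descend h0 hb hc n l hl
    · exact h
    -- Since d ≤ n + 1, the word `l'` has more than (n + 1)² - (n + 1) ≥ n² letters.
    · rw [h4, ih l' h1 (by nlinarith), zero_mul]

end NilCoxeter

section Nilpotent

variable {𝕜 : Type u} [Field 𝕜] {I : Type v} [DecidableEq I] {C : BorcherdsCartan I} {i : I}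
  {n : ℕ}

variable (𝕜 C i) in
/-- The crossing of the strands `k` and `k + 1` in `R(n i)`, where strands are numbered from `0`. -/
def tauRep (n k : ℕ) : Alg 𝕜 C (Multiset.replicate n i) :=
  gen 𝕜 C _ (.place (List.replicate k i) (.cross i i) (List.replicate (n - 2 - k) i))

theorem gen_replicate_eq_zero {g : Gen I} (hg : g.src ≠ List.replicate n i) :
    gen 𝕜 C (Multiset.replicate n i) g = 0 :=
  gen_eq_zero C fun h => hg (coe_eq_replicate.1 h)

/-- The difference `n - 2 - k` is then truncated to 0 and the bottom sequence is too long, so the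
generator vanishes. Thanks to this the nilCoxeter relations hold for all indices, without bounds. -/
theorem tauRep_eq_zero {k : ℕ} (hk : n < k + 2) : tauRep 𝕜 C i n k = 0 := by
  refine gen_replicate_eq_zero fun h => ?_
  have := congrArg List.length h
  simp [Gen.src, Piece.src] at this
  omega

theorem tauRep_far (k l : ℕ) (hkl : k + 1 < l) :
    tauRep 𝕜 C i n k * tauRep 𝕜 C i n l = tauRep 𝕜 C i n l * tauRep 𝕜 C i n k := by
  by_cases hl : n < l + 2
  · rw [tauRep_eq_zero hl]; simp
  obtain ⟨m, rfl⟩ : ∃ m, l = k + 2 + m := ⟨l - (k + 2), by omega⟩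
  obtain ⟨q, rfl⟩ : ∃ q, n = k + 2 + m + 2 + q := ⟨n - (k + 2 + m + 2), by omega⟩
  have := gen_far (𝕜 := 𝕜) C (Multiset.replicate (k + 2 + m + 2 + q) i) (List.replicate k i)
    (.cross i i) (List.replicate m i) (.cross i i) (List.replicate q i)
  have e1 : List.replicate (k + 2 + m + 2 + q - 2 - k) i =
      List.replicate m i ++ [i, i] ++ List.replicate q i := by
    rw [show k + 2 + m + 2 + q - 2 - k = m + 2 + q by omega]
    simp only [← List.replicate_append_replicate]
    rfl
  have e2 : List.replicate (k + 2 + m) i =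
      List.replicate k i ++ [i, i] ++ List.replicate m i := by
    simp only [← List.replicate_append_replicate]
    rfl
  rw [tauRep, tauRep, e1, e2, show k + 2 + m + 2 + q - 2 - (k + 2 + m) = q by omega]
  exact this

theorem tauRep_braid (hi : C.a i i ≤ 0) (k : ℕ) :
    tauRep 𝕜 C i n k * tauRep 𝕜 C i n (k + 1) * tauRep 𝕜 C i n k =
      tauRep 𝕜 C i n (k + 1) * tauRep 𝕜 C i n k * tauRep 𝕜 C i n (k + 1) := by
  by_cases hl : n < k + 1 + 2
  · rw [tauRep_eq_zero hl]; simp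
  obtain ⟨q, rfl⟩ : ∃ q, n = k + 3 + q := ⟨n - (k + 3), by omega⟩
  have := gen_braid (𝕜 := 𝕜) C (Multiset.replicate (k + 3 + q) i) (i := i) (j := i) (k := i)
    (List.replicate k i) (List.replicate q i) (not_real hi _)
  rw [tauRep, tauRep, show k + 3 + q - 2 - k = q + 1 by omega,
    show k + 3 + q - 2 - (k + 1) = q by omega, List.replicate_succ' (n := k), List.replicate_succ (n := q)]
  exact this

theorem tauRep_sq (k : ℕ) : tauRep 𝕜 C i n k * tauRep 𝕜 C i n k = 0 := gen_double_same C _ _ _ _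

variable (𝕜 C i n) in
/-- The right ideal of `R(n i)` generated by the dots. -/
def dotIdeal : Submodule 𝕜 (Alg 𝕜 C (Multiset.replicate n i)) :=
  Submodule.span 𝕜 {y | ∃ (k l : ℕ) (x : Alg 𝕜 C _), k + 1 + l = n ∧
    y = gen 𝕜 C _ (.place (List.replicate k i) (.dot i) (List.replicate l i)) * x}

theorem dot_mul_mem {k l : ℕ} (h : k + 1 + l = n) (x : Alg 𝕜 C (Multiset.replicate n i)) :
    gen 𝕜 C _ (.place (List.replicate k i) (.dot i) (List.replicate l i)) * x ∈
      dotIdeal 𝕜 C i n := Submodule.subset_span ⟨k, l, x, h, rfl⟩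

/-- The nonzero images of the generators in `R(n i)`. -/
theorem gen_place_cases (z : List I) (p : Piece I) (q : List I) :
    gen 𝕜 C (Multiset.replicate n i) (.place z p q) = 0 ∨
      (∃ k l, k + 1 + l = n ∧ gen 𝕜 C (Multiset.replicate n i) (.place z p q) =
        gen 𝕜 C _ (.place (List.replicate k i) (.dot i) (List.replicate l i))) ∨
      ∃ k, k + 2 ≤ n ∧ gen 𝕜 C (Multiset.replicate n i) (.place z p q) = tauRep 𝕜 C i n k := by
  by_cases h : (Gen.place z p q).src = List.replicate n i
  swap
  · exact Or.inl (gen_replicate_eq_zero h)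
  right
  rw [Gen.src, List.append_eq_replicate_iff, List.append_eq_replicate_iff] at h
  obtain ⟨hl, ⟨-, hz, hp⟩, hq⟩ := h
  cases p with
  | dot j =>
    left
    obtain rfl : j = i := by simpa [Piece.src] using hp
    refine ⟨z.length, q.length, by simpa [Piece.src] using hl, ?_⟩
    rw [← hz, ← hq]
  | cross a b =>
    right
    obtain ⟨rfl, rfl⟩ : a = i ∧ b = i := by simpa [Piece.src] using hp
    have : z.length + 2 + q.length = n := by simpa [Piece.src] using hl
    refine ⟨z.length, by omega, ?_⟩
    rw [tauRep, show n - 2 - z.length = q.length by omega, ← hz, ← hq]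

/-- Between strands of the imaginary colour i dots slide through crossings without correction, so a
dot under a crossing can be brought above it. Hence the right ideal generated by the dots is also a
left ideal. -/
theorem gen_mul_mem_dotIdeal (hi : C.a i i ≤ 0) (g : Gen I)
    {x : Alg 𝕜 C (Multiset.replicate n i)} (hx : x ∈ dotIdeal 𝕜 C i n) :
    gen 𝕜 C _ g * x ∈ dotIdeal 𝕜 C i n := by
  have : dotIdeal 𝕜 C i n ≤ (dotIdeal 𝕜 C i n).comap (LinearMap.mulLeft 𝕜 (gen 𝕜 C _ g)) := by
    refine Submodule.span_le.2 ?_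
    rintro _ ⟨k, l, x, hkl, rfl⟩
    simp only [SetLike.mem_coe, Submodule.mem_comap, LinearMap.mulLeft_apply]
    cases g with
    | idem s =>
      rw [← mul_assoc, idem_tgt_mul]
      split_ifs
      · exact dot_mul_mem hkl x
      · simp
    | place z p q =>
      obtain h | ⟨k', l', h', h⟩ | ⟨j, hj, h⟩ := gen_place_cases (𝕜 := 𝕜) (C := C) (i := i)
        (n := n) z p q
      · rw [h, zero_mul]; exact zero_mem _
      · rw [h]; exact dot_mul_mem h' _
      · rw [h, ← mul_assoc]
        rcases lt_trichotomy k j with hkj | rfl | hkj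
        · obtain ⟨m, rfl⟩ : ∃ m, j = k + 1 + m := ⟨j - (k + 1), by omega⟩
          obtain ⟨r, rfl⟩ : ∃ r, l = m + 2 + r := ⟨l - (m + 2), by omega⟩
          have h1 := gen_far (𝕜 := 𝕜) C (Multiset.replicate n i) (List.replicate k i)
            (.dot i) (List.replicate m i) (.cross i i) (List.replicate r i)
          have e1 : List.replicate (m + 2 + r) i =
              List.replicate m i ++ [i, i] ++ List.replicate r i := by
            simp only [← List.replicate_append_replicate]
            rfl
          have e2 : List.replicate (k + 1 + m) i =
              List.replicate k i ++ [i] ++ List.replicate m i := by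
            simp only [← List.replicate_append_replicate]
            rfl
          have e3 : tauRep 𝕜 C i n (k + 1 + m) * gen 𝕜 C _ (.place (List.replicate k i) (.dot i)
              (List.replicate (m + 2 + r) i)) = gen 𝕜 C _ (.place (List.replicate k i) (.dot i)
              (List.replicate (m + 2 + r) i)) * tauRep 𝕜 C i n (k + 1 + m) := by
            rw [tauRep, show n - 2 - (k + 1 + m) = r by omega, e1, e2]
            exact h1.symm
          rw [e3, mul_assoc]
          exact dot_mul_mem (by omega) _
        · obtain ⟨r, rfl⟩ : ∃ r, l = r + 1 := ⟨l - 1, by omega⟩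
          have h1 := gen_slide_right (𝕜 := 𝕜) C (Multiset.replicate n i) (i := i) (j := i)
            (List.replicate k i) (List.replicate r i) (fun h => by omega)
          rw [List.singleton_append, ← List.replicate_succ, ← List.replicate_succ'] at h1
          rw [tauRep, show n - 2 - k = r by omega, h1, mul_assoc]
          exact dot_mul_mem (by omega) _
        · by_cases hk : k = j + 1
          · subst hk
            have h1 := gen_slide_left (𝕜 := 𝕜) C (Multiset.replicate n i) (i := i) (j := i)
              (List.replicate j i) (List.replicate l i) (fun h => by omega)
            rw [List.singleton_append, ← List.replicate_succ, ← List.replicate_succ'] at h1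
            rw [tauRep, show n - 2 - j = l by omega, ← h1, mul_assoc]
            exact dot_mul_mem (by omega) _
          · obtain ⟨m, rfl⟩ : ∃ m, k = j + 2 + m := ⟨k - (j + 2), by omega⟩
            have h1 := gen_far (𝕜 := 𝕜) C (Multiset.replicate n i) (List.replicate j i)
              (.cross i i) (List.replicate m i) (.dot i) (List.replicate l i)
            have e1 : List.replicate (m + 1 + l) i =
                List.replicate m i ++ [i] ++ List.replicate l i := by
              simp only [← List.replicate_append_replicate]
              rfl
            have e2 : List.replicate (j + 2 + m) i =
                List.replicate j i ++ [i, i] ++ List.replicate m i := by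
              simp only [← List.replicate_append_replicate]
              rfl
            have e3 : tauRep 𝕜 C i n j * gen 𝕜 C _ (.place (List.replicate (j + 2 + m) i) (.dot i)
                (List.replicate l i)) = gen 𝕜 C _ (.place (List.replicate (j + 2 + m) i) (.dot i)
                (List.replicate l i)) * tauRep 𝕜 C i n j := by
              rw [tauRep, show n - 2 - j = m + 1 + l by omega, e1, e2]
              exact h1
            rw [e3, mul_assoc]
            exact dot_mul_mem (by omega) _
  exact this hx

theorem mul_mem_dotIdeal (hi : C.a i i ≤ 0) (a : Alg 𝕜 C (Multiset.replicate n i))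
    {x : Alg 𝕜 C (Multiset.replicate n i)} (hx : x ∈ dotIdeal 𝕜 C i n) :
    a * x ∈ dotIdeal 𝕜 C i n := by
  induction a using alg_induction generalizing x with
  | hc c =>
    rw [alg_unit_smul, smul_mul_assoc, one_mul]
    exact Submodule.smul_mem _ _ hx
  | hg g => exact gen_mul_mem_dotIdeal hi g hx
  | hm a b ha hb => rw [mul_assoc]; exact ha (hb hx)
  | ha a b ha hb => rw [add_mul]; exact add_mem (ha hx) (hb hx)

variable (𝕜 C) in
/-- The product in `R(ν)` of a list of dots and crossings. -/
def placeWord (ν : Multiset I) (l : List (List I × Piece I × List I)) : Alg 𝕜 C ν :=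
  (l.map fun x => gen 𝕜 C ν (.place x.1 x.2.1 x.2.2)).prod

/-- Long words in dots and crossings belong to the ideal of `R(n i)` generated by the dots. -/
theorem placeWord_mem_dotIdeal (hi : C.a i i ≤ 0) (l : List (List I × Piece I × List I))
    (hl : n * n < l.length) : placeWord 𝕜 C (Multiset.replicate n i) l ∈ dotIdeal 𝕜 C i n := by
  -- A word containing a dot is in the ideal because the ideal is two-sided. A nonzero word without
  -- dots is a word in the crossings, to which the nilCoxeter bound applies.
  have key : ∀ l : List (List I × Piece I × List I),
      placeWord 𝕜 C (Multiset.replicate n i) l ∈ dotIdeal 𝕜 C i n ∨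
      ∃ l' : List ℕ, (∀ j ∈ l', j < n) ∧ l'.length = l.length ∧
        placeWord 𝕜 C (Multiset.replicate n i) l = (l'.map (tauRep 𝕜 C i n)).prod := by
    intro l
    induction l with
    | nil => exact Or.inr ⟨[], by simp, rfl, by simp [placeWord]⟩
    | cons x l ih =>
      have h1 : placeWord 𝕜 C (Multiset.replicate n i) (x :: l) =
        gen 𝕜 C _ (.place x.1 x.2.1 x.2.2) * placeWord 𝕜 C _ l := by simp [placeWord]
      rw [h1]
      obtain ih | ⟨l', h2, h3, h4⟩ := ih
      · exact Or.inl (gen_mul_mem_dotIdeal hi _ ih)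
      · obtain h | ⟨k, l, h', h⟩ | ⟨k, hk, h⟩ := gen_place_cases (𝕜 := 𝕜) (C := C) (i := i)
          (n := n) x.1 x.2.1 x.2.2
        · rw [h, zero_mul]; exact Or.inl (zero_mem _)
        · rw [h]; exact Or.inl (dot_mul_mem h' _)
        · refine Or.inr ⟨k :: l', ?_, by simp [h3], by simp [h, h4]⟩
          intro j hj
          obtain rfl | hj := List.mem_cons.1 hj
          · omega
          · exact h2 j hj
  obtain h | ⟨l', h1, h2, h3⟩ := key l
  · exact h
  · rw [h3, prod_eq_zero_of_length tauRep_sq (tauRep_braid hi) tauRep_far n l' h1 (by omega)]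
    exact zero_mem _

end Nilpotent

/-! ### The module induced from `K ⊗ V(i^n)` -/

section Ghost

variable {𝕜 : Type u} [Field 𝕜] {I : Type v} [DecidableEq I] {C : BorcherdsCartan I}
  {ν : Multiset I} {i : I}

theorem mul_pow_of_mul_eq {A : Type*} [Monoid A] {s x x' : A} (h : s * x = x' * s) (m : ℕ) :
    s * x ^ m = x' ^ m * s := by
  induction m with
  | zero => simp
  | succ m ih => rw [pow_succ, ← mul_assoc, ih, mul_assoc, h, ← mul_assoc, pow_succ]

variable (𝕜 C ν i) in
/-- The effect on a strand coloured `a` of a double crossing with a marked strand. -/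
def doubleCoef (a : I) (z q : List I) : Alg 𝕜 C ν :=
  -- The quadratic relation yields dots on both strands. The dot on the marked strand acts by zero,
  -- so only the power of the dot on `a` remains.
  if a = i then 0 else if C.form a i = 0 then 1 else
    gen 𝕜 C ν (.place z (.dot a) q) ^ (-C.a a i).toNat

variable (𝕜 C ν i) in
/-- The effect on the unmarked strands of a piece whose top strands are marked as indicated. -/
def ghostCoef : Piece I → List (Option I) → List I → List I → Alg 𝕜 C ν
  | .dot j, [some _], z, q => gen 𝕜 C ν (.place z (.dot j) q)
  | .cross a b, [some _, some _], z, q => gen 𝕜 C ν (.place z (.cross a b) q)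
  -- The crossing has moved the marked strand to the right, which merely lengthens a sorting
  -- diagram.
  | .cross _ _, [some _, none], _, _ => 1
  | .cross a _, [none, some _], z, q => doubleCoef 𝕜 C ν i a z q
  -- This covers dots on marked strands and crossings of two marked strands, which act by zero on
  -- V(i^n).
  | _, _, _, _ => 0

/-- The passage from the marks at the top of a piece to those at its bottom. -/
def Piece.permute {α : Type*} : Piece I → List α → List α
  | .dot _, l => l
  | .cross _ _, l => l.reverse

/-- Functions which associate to strands on the left and on the right a diagram which is
nontrivial only on the strands in between, with top `t` and bottom `b`. -/
inductive IsLocal (f : List I → List I → Alg 𝕜 C ν) : List I → List I → Prop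
  | zero (t b : List I) : (∀ z q, f z q = 0) → IsLocal f t b
  | one (t : List I) : (∀ z q, f z q = 1) → IsLocal f t t
  | piece (p : Piece I) : (∀ z q, f z q = gen 𝕜 C ν (.place z p q)) → IsLocal f p.tgt p.src
  | dots (j : I) (k : ℕ) : (∀ z q, f z q = gen 𝕜 C ν (.place z (.dot j) q) ^ k) →
      IsLocal f [j] [j]

/-- Zero, one, generators and powers of dots all inherit the commutation of pieces on disjoint
strands. -/
theorem IsLocal.far {f f' : List I → List I → Alg 𝕜 C ν} {t b t' b' : List I}
    (hf : IsLocal f t b) (hf' : IsLocal f' t' b') (z m q : List I) :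
    f z (m ++ (t' ++ q)) * f' (z ++ (b ++ m)) q =
      f' (z ++ (t ++ m)) q * f z (m ++ (b' ++ q)) := by
  have key := fun p m p' => gen_far' (𝕜 := 𝕜) (C := C) (γ := ν) z p m p' q
  cases hf with
  | zero _ _ hf => simp [hf]
  | one _ hf => simp [hf]
  | piece p hf =>
    cases hf' with
    | zero _ _ hf' => simp [hf']
    | one _ hf' => simp [hf']
    | piece p' hf' => rw [hf, hf, hf', hf', key]
    | dots j' k' hf' =>
      simp only [hf, hf']
      exact mul_pow_of_mul_eq (key p m (.dot j')) k'
  | dots j k hf =>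
    cases hf' with
    | zero _ _ hf' => simp [hf']
    | one _ hf' => simp [hf']
    | piece p' hf' =>
      simp only [hf, hf']
      exact (mul_pow_of_mul_eq (key (.dot j) m p').symm k).symm
    | dots j' k' hf' =>
      simp only [hf, hf']
      exact (mul_pow_of_mul_eq (mul_pow_of_mul_eq (key (.dot j) m (.dot j')) k').symm k).symm

theorem isLocal_doubleCoef (a : I) : IsLocal (doubleCoef 𝕜 C ν i a) [a] [a] := by
  by_cases h1 : a = i
  · exact .zero _ _ fun z q => by rw [doubleCoef, if_pos h1]
  by_cases h2 : C.form a i = 0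
  · exact .one _ fun z q => by rw [doubleCoef, if_neg h1, if_pos h2]
  · exact .dots a _ fun z q => by rw [doubleCoef, if_neg h1, if_neg h2]

theorem Piece.colours_permute {p : Piece I} {tp : List (Option I)} (h : colours i tp = p.tgt) :
    colours i (p.permute tp) = p.src := by
  cases p with
  | dot j => exact h
  | cross a b => simp only [Piece.permute, colours, List.map_reverse] at h ⊢; rw [h]; rfl

theorem Piece.marks_permute (p : Piece I) (tp : List (Option I)) :
    marks (p.permute tp) = marks tp := by
  cases p with
  | dot j => rfl
  | cross a b => simp [Piece.permute, marks, List.countP_reverse]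

theorem colours_eq_cons {tp : List (Option I)} {j : I} {l : List I} (h : colours i tp = j :: l) :
    ∃ x t, tp = x :: t ∧ x.getD i = j ∧ colours i t = l := by
  cases tp with
  | nil => simp at h
  | cons x t =>
    simp only [colours, List.map_cons, List.cons.injEq] at h
    exact ⟨x, t, rfl, h.1, h.2⟩

theorem colours_eq_nil {tp : List (Option I)} (h : colours i tp = []) : tp = [] := by
  simpa using h

theorem isLocal_ghostCoef {p : Piece I} {tp : List (Option I)} (h : colours i tp = p.tgt) :
    IsLocal (ghostCoef 𝕜 C ν i p tp) tp.reduceOption (p.permute tp).reduceOption := by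
  cases p with
  | dot j =>
    obtain ⟨x, t, rfl, hx, ht⟩ := colours_eq_cons h
    obtain rfl := colours_eq_nil ht
    cases x with
    | none => exact .zero _ _ fun z q => rfl
    | some x =>
      obtain rfl : x = j := hx
      exact .piece (.dot x) fun z q => rfl
  | cross a b =>
    obtain ⟨x, t, rfl, hx, ht⟩ := colours_eq_cons h
    obtain ⟨y, t, rfl, hy, ht⟩ := colours_eq_cons ht
    obtain rfl := colours_eq_nil ht
    cases x with
    | none =>
      cases y with
      | none => exact .zero _ _ fun z q => rfl
      | some y =>
        obtain rfl : y = a := hy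
        exact isLocal_doubleCoef y
    | some x =>
      cases y with
      | none => exact .one _ fun z q => rfl
      | some y =>
        obtain rfl : y = a := hy
        obtain rfl : x = b := hx
        exact .piece (.cross y x) fun z q => rfl

theorem IsLocal.idem_mul {f : List I → List I → Alg 𝕜 C ν} {t b : List I}
    (hf : IsLocal f t b) (z q : List I) :
    gen 𝕜 C ν (.idem (z ++ (t ++ q))) * f z q = f z q * gen 𝕜 C ν (.idem (z ++ (b ++ q))) := by
  cases hf with
  | zero _ _ hf => simp [hf]
  | one _ hf => simp [hf]
  | piece p hf =>
    rw [hf, idem_tgt_mul, mul_idem_src, if_pos (by simp [Gen.tgt]), if_pos (by simp [Gen.src])]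
  | dots j k hf =>
    rw [hf]
    refine mul_pow_of_mul_eq ?_ k
    rw [idem_tgt_mul, mul_idem_src, if_pos (by simp [Gen.tgt, Piece.tgt]),
      if_pos (by simp [Gen.src, Piece.src])]

variable (i) in
/-- The action of a generator on `K`-valued functions on marked sequences. -/
def ghostAct (K : GrMod.{u, v, w} 𝕜 C ν) :
    Gen I → (List (Option I) → K) →ₗ[𝕜] (List (Option I) → K)
  -- The value `F t` plays the role of f(`sortDiag t`) for an element f of the co-induced module.
  -- The action of a generator g is modelled on f(`sortDiag t` · g), with the product rewritten as
  -- in `sortDiag_mul_gen`.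
  | .idem s => LinearMap.pi fun t => if colours i t = s then LinearMap.proj t else 0
  | .place z p q => LinearMap.pi fun t =>
    if colours i t = z ++ (p.tgt ++ q) then
      K.act (ghostCoef 𝕜 C ν i p ((t.drop z.length).take p.tgt.length)
        (t.take z.length).reduceOption (t.drop (z.length + p.tgt.length)).reduceOption) ∘ₗ
      LinearMap.proj (t.take z.length ++ (p.permute ((t.drop z.length).take p.tgt.length) ++
        t.drop (z.length + p.tgt.length)))
    else 0

variable (K : GrMod.{u, v, w} 𝕜 C ν) (F : List (Option I) → K)

theorem ghostAct_idem (s : List I) (t : List (Option I)) :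
    ghostAct i K (.idem s) F t = if colours i t = s then F t else 0 := by
  simp only [ghostAct, LinearMap.pi_apply]
  split_ifs <;> rfl

theorem ghostAct_of_ne {g : Gen I} {t : List (Option I)} (h : colours i t ≠ g.tgt) :
    ghostAct i K g F t = 0 := by
  cases g with
  | idem s => rw [ghostAct_idem]; exact if_neg h
  | place z p q =>
    simp only [ghostAct, LinearMap.pi_apply]
    rw [if_neg (by rwa [Gen.tgt, List.append_assoc] at h)]
    rfl

theorem ghostAct_place {z q : List I} {p : Piece I} {t tz tp tq : List (Option I)}
    (ht : t = tz ++ (tp ++ tq)) (hz : colours i tz = z) (hp : colours i tp = p.tgt)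
    (hq : colours i tq = q) :
    ghostAct i K (.place z p q) F t =
      ghostCoef 𝕜 C ν i p tp tz.reduceOption tq.reduceOption •
        F (tz ++ (p.permute tp ++ tq)) := by
  have h1 : tz.length = z.length := by rw [← hz]; simp
  have h2 : tp.length = p.tgt.length := by rw [← hp]; simp
  subst ht
  simp only [ghostAct, LinearMap.pi_apply]
  rw [if_pos (by simp [colours, ← hz, ← hp, ← hq])]
  rw [← h1, ← h2, List.drop_left, List.take_left, List.take_left, ← List.drop_drop,
    List.drop_left, List.drop_left]
  rfl

theorem exists_of_colours {z p q : List I} {t : List (Option I)}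
    (h : colours i t = z ++ p ++ q) :
    ∃ tz tp tq, t = tz ++ (tp ++ tq) ∧ colours i tz = z ∧ colours i tp = p ∧ colours i tq = q := by
  rw [List.append_assoc] at h
  obtain ⟨tz, t', rfl, h1, h2⟩ := List.map_eq_append_iff.1 h
  obtain ⟨tp, tq, rfl, h2, h3⟩ := List.map_eq_append_iff.1 h2
  exact ⟨tz, tp, tq, rfl, h1, h2, h3⟩

theorem ghostAct_cases (z : List I) (p : Piece I) (q : List I) (t : List (Option I)) :
    (∀ F, ghostAct i K (.place z p q) F t = 0) ∨
      ∃ tz tp tq, t = tz ++ (tp ++ tq) ∧ colours i tz = z ∧ colours i tp = p.tgt ∧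
        colours i tq = q ∧ ∀ F, ghostAct i K (.place z p q) F t =
          ghostCoef 𝕜 C ν i p tp tz.reduceOption tq.reduceOption •
            F (tz ++ (p.permute tp ++ tq)) := by
  by_cases h : colours i t = (Gen.place z p q).tgt
  · obtain ⟨tz, tp, tq, ht, hz, hp, hq⟩ := exists_of_colours h
    exact Or.inr ⟨tz, tp, tq, ht, hz, hp, hq, fun F => ghostAct_place K F ht hz hp hq⟩
  · exact Or.inl fun F => ghostAct_of_ne K F h

/-- The space of the module induced from `K ⊗ V(i^n)`. -/
def ghostSpace (n : ℕ) : Submodule 𝕜 (List (Option I) → K) where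
  carrier := {F | ∀ t, gen 𝕜 C ν (.idem t.reduceOption) • F t = F t ∧ (marks t ≠ n → F t = 0)}
  zero_mem' := fun t => ⟨smul_zero _, fun _ => rfl⟩
  add_mem' := fun hF hG t => ⟨by rw [Pi.add_apply, smul_add, (hF t).1, (hG t).1],
    fun ht => by rw [Pi.add_apply, (hF t).2 ht, (hG t).2 ht, add_zero]⟩
  smul_mem' := fun c F hF t => ⟨by
    rw [Pi.smul_apply]
    exact ((K.act _).map_smul c (F t)).trans (congrArg _ (hF t).1),
    fun ht => by rw [Pi.smul_apply, (hF t).2 ht, smul_zero]⟩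

theorem ghostAct_mem {n : ℕ} {F : List (Option I) → K} (hF : F ∈ ghostSpace K n) (g : Gen I) :
    ghostAct i K g F ∈ ghostSpace K n := by
  intro t
  cases g with
  | idem s =>
    rw [ghostAct_idem]
    split_ifs
    · exact hF t
    · simp
  | place z p q =>
    obtain h | ⟨tz, tp, tq, rfl, hz, hp, hq, h⟩ := ghostAct_cases (i := i) K z p q t
    · rw [h]; simp
    · rw [h]
      constructor
      · have := (isLocal_ghostCoef (𝕜 := 𝕜) (C := C) (ν := ν) hp).idem_mul tz.reduceOption
          tq.reduceOption
        rw [smul_smul, List.reduceOption_append, List.reduceOption_append, this, ← smul_smul,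
          ← List.reduceOption_append, ← List.reduceOption_append, (hF _).1]
      · intro hm
        rw [(hF _).2, smul_zero]
        simpa [Piece.marks_permute] using hm

variable (i) in
/-- The action of a generator on `ghostSpace`. -/
def ghostGen (n : ℕ) (g : Gen I) : Module.End 𝕜 (ghostSpace K n) :=
  (ghostAct i K g).restrict fun _ hF => ghostAct_mem K hF g

theorem ghostGen_apply {n : ℕ} (g : Gen I) (F : ghostSpace K n) (t : List (Option I)) :
    (ghostGen i K n g F).1 t = ghostAct i K g F.1 t := rfl

end Ghost

/-! ### Identities in R(ν) between the coefficients of the action -/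

section GhostRelations

variable {𝕜 : Type u} [Field 𝕜] {I : Type v} [DecidableEq I] {C : BorcherdsCartan I}
  {ν : Multiset I} {i : I}

theorem BorcherdsCartan.form_comm (C : BorcherdsCartan I) (i j : I) : C.form i j = C.form j i :=
  C.symm i j

theorem doubleCoef_slide_left {a b : I} (h : ¬(a = b ∧ C.a a a = 2)) (z q : List I) :
    doubleCoef 𝕜 C ν i b z ([a] ++ q) * gen 𝕜 C ν (.place z (.cross a b) q) =
      gen 𝕜 C ν (.place z (.cross a b) q) * doubleCoef 𝕜 C ν i b (z ++ [a]) q := by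
  rw [doubleCoef, doubleCoef]
  split_ifs
  · simp
  · simp
  · exact (mul_pow_of_mul_eq (gen_slide_left C ν z q h).symm _).symm

theorem doubleCoef_slide_right {a b : I} (h : ¬(a = b ∧ C.a a a = 2)) (z q : List I) :
    gen 𝕜 C ν (.place z (.cross a b) q) * doubleCoef 𝕜 C ν i a z ([b] ++ q) =
      doubleCoef 𝕜 C ν i a (z ++ [b]) q * gen 𝕜 C ν (.place z (.cross a b) q) := by
  rw [doubleCoef, doubleCoef]
  split_ifs
  · simp
  · simp
  · exact mul_pow_of_mul_eq (gen_slide_right C ν z q h) _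

theorem dot_comm (a b : I) (z m q : List I) :
    Commute (gen 𝕜 C ν (.place z (.dot a) (m ++ (b :: q))))
      (gen 𝕜 C ν (.place (z ++ (a :: m)) (.dot b) q)) := by
  rw [commute_iff_eq]
  simpa [Piece.src, Piece.tgt] using gen_far' (𝕜 := 𝕜) (C := C) (γ := ν) z (.dot a) m (.dot b) q

/-- The product of the m-th powers of the two dots is symmetric, and the element XY commutes with a
crossing of two strands of equal real colour: the two corrections cancel. It is needed when both
strands cross a marked strand twice. -/
theorem real_pair_comm {a : I} (ha : C.a a a = 2) (z q : List I) (m : ℕ) :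
    gen 𝕜 C ν (.place z (.dot a) (a :: q)) ^ m * gen 𝕜 C ν (.place (z ++ [a]) (.dot a) q) ^ m *
        gen 𝕜 C ν (.place z (.cross a a) q) =
      gen 𝕜 C ν (.place z (.cross a a) q) *
        (gen 𝕜 C ν (.place z (.dot a) (a :: q)) ^ m *
          gen 𝕜 C ν (.place (z ++ [a]) (.dot a) q) ^ m) := by
  have hc : Commute (gen 𝕜 C ν (.place z (.dot a) (a :: q)))
      (gen 𝕜 C ν (.place (z ++ [a]) (.dot a) q)) := dot_comm a a z [] q
  have h1 := gen_slide_real_left (𝕜 := 𝕜) C ν z q ha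
  have h2 := gen_slide_real_right (𝕜 := 𝕜) C ν z q ha
  have h3 : gen 𝕜 C ν (.idem (z ++ [a, a] ++ q)) * gen 𝕜 C ν (.place z (.dot a) (a :: q)) =
      gen 𝕜 C ν (.place z (.dot a) (a :: q)) * gen 𝕜 C ν (.idem (z ++ [a, a] ++ q)) := by
    rw [idem_tgt_mul, mul_idem_src, if_pos (by simp [Gen.tgt, Piece.tgt]),
      if_pos (by simp [Gen.src, Piece.src])]
  rw [← hc.mul_pow]
  refine (mul_pow_of_mul_eq ?_ m).symm
  rw [sub_eq_iff_eq_add] at h1 h2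
  simp only [List.singleton_append] at h1 h2
  set X := gen 𝕜 C ν (.place z (.dot a) (a :: q))
  set Y := gen 𝕜 C ν (.place (z ++ [a]) (.dot a) q)
  set T := gen 𝕜 C ν (.place z (.cross a a) q)
  set e := gen 𝕜 C ν (.idem (z ++ [a, a] ++ q))
  have h4 : Y * T = T * X - e := by rw [h2]; abel
  rw [mul_assoc X, h4, mul_sub, ← mul_assoc X, h1, add_mul, h3, mul_assoc T, hc.eq]
  abel

/-- Sliding a power of a dot through a real crossing produces the divided difference of that power.
With m = -a_{ai} this is precisely the correction term of the braid relation whose middle strand is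
marked: undoing the double crossing on one side or the other puts the m dots on either of the outer
strands. -/
theorem real_pow_slide {a : I} (ha : C.a a a = 2) (z q : List I) (m : ℕ) :
    gen 𝕜 C ν (.place z (.cross a a) q) * gen 𝕜 C ν (.place z (.dot a) (a :: q)) ^ m -
        gen 𝕜 C ν (.place (z ++ [a]) (.dot a) q) ^ m * gen 𝕜 C ν (.place z (.cross a a) q) =
      ∑ c ∈ Finset.range m, gen 𝕜 C ν (.place z (.dot a) (a :: q)) ^ c *
        gen 𝕜 C ν (.place (z ++ [a]) (.dot a) q) ^ (m - 1 - c) *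
        gen 𝕜 C ν (.idem (z ++ (a :: a :: q))) := by
  have hc : Commute (gen 𝕜 C ν (.place z (.dot a) (a :: q)))
      (gen 𝕜 C ν (.place (z ++ [a]) (.dot a) q)) := dot_comm a a z [] q
  have h2 := gen_slide_real_right (𝕜 := 𝕜) C ν z q ha
  have h3 : gen 𝕜 C ν (.idem (z ++ [a, a] ++ q)) * gen 𝕜 C ν (.place z (.dot a) (a :: q)) =
      gen 𝕜 C ν (.place z (.dot a) (a :: q)) * gen 𝕜 C ν (.idem (z ++ [a, a] ++ q)) := by
    rw [idem_tgt_mul, mul_idem_src, if_pos (by simp [Gen.tgt, Piece.tgt]),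
      if_pos (by simp [Gen.src, Piece.src])]
  simp only [List.append_assoc, List.cons_append, List.nil_append] at h2 h3
  rw [← Finset.sum_mul]
  set X := gen 𝕜 C ν (.place z (.dot a) (a :: q))
  set Y := gen 𝕜 C ν (.place (z ++ [a]) (.dot a) q)
  set T := gen 𝕜 C ν (.place z (.cross a a) q)
  set e := gen 𝕜 C ν (.idem (z ++ a :: a :: q))
  induction m with
  | zero => simp
  | succ m ih =>
    rw [sub_eq_iff_eq_add] at h2 ih ⊢
    rw [Nat.add_sub_cancel, hc.geom_sum₂_succ_eq, pow_succ', ← mul_assoc, h2, add_mul,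
      mul_assoc Y, ih, mul_pow_of_mul_eq h3, pow_succ' Y]
    simp only [mul_add, add_mul, mul_assoc]
    abel

/-- The coefficients of the two sides of a braid relation. -/
def braidCoefs (𝕜 : Type u) [Field 𝕜] (C : BorcherdsCartan I) (ν : Multiset I) (i : I)
    (x y w : Option I) (z q : List I) : Alg 𝕜 C ν × Alg 𝕜 C ν :=
  let a := w.getD i
  let b := y.getD i
  let c := x.getD i
  (ghostCoef 𝕜 C ν i (.cross b c) [x, y] z ([w].reduceOption ++ q) *
      ghostCoef 𝕜 C ν i (.cross a c) [x, w] (z ++ [y].reduceOption) q *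
      ghostCoef 𝕜 C ν i (.cross a b) [y, w] z ([x].reduceOption ++ q),
    ghostCoef 𝕜 C ν i (.cross a b) [y, w] (z ++ [x].reduceOption) q *
      ghostCoef 𝕜 C ν i (.cross a c) [x, w] z ([y].reduceOption ++ q) *
      ghostCoef 𝕜 C ν i (.cross b c) [x, y] (z ++ [w].reduceOption) q)

/-- With two or more marks both coefficients contain a crossing of two marked strands and vanish.
With the mark on the right at the top both reduce to the same crossing. The cases left are a mark on
the left, a mark in the middle, and no mark. -/
theorem braidCoefs_eq (hi : C.a i i ≤ 0) (x y w : Option I) (z q : List I)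
    (h : ¬(w.getD i = x.getD i ∧ C.a (w.getD i) (w.getD i) = 2 ∧ w.getD i ≠ y.getD i ∧
      C.form (w.getD i) (y.getD i) ≠ 0)) :
    (braidCoefs 𝕜 C ν i x y w z q).1 = (braidCoefs 𝕜 C ν i x y w z q).2 := by
  rcases x with _ | c <;> rcases y with _ | b <;> rcases w with _ | a <;>
    simp only [braidCoefs, ghostCoef, Option.getD_none, Option.getD_some, zero_mul, mul_zero,
      mul_one, one_mul, List.reduceOption_nil, List.reduceOption_cons_of_none,
      List.reduceOption_cons_of_some, List.append_nil, List.nil_append] at h ⊢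
  · -- marked strand at the left
    by_cases hab : a = b ∧ C.a a a = 2
    · obtain ⟨rfl, ha⟩ := hab
      simp only [doubleCoef]
      split_ifs
      · simp
      · simp
      · rw [List.singleton_append]
        exact (real_pair_comm ha z q _).trans (mul_assoc _ _ _).symm
    · have h1 := doubleCoef_slide_right (𝕜 := 𝕜) (ν := ν) (i := i) hab z q
      have h2 := doubleCoef_slide_left (𝕜 := 𝕜) (ν := ν) (i := i) hab z q
      have h3 := (isLocal_doubleCoef (𝕜 := 𝕜) (C := C) (ν := ν) (i := i) a).far
        (isLocal_doubleCoef (i := i) b) z [] q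
      simp only [List.append_nil, List.nil_append] at h3
      rw [mul_assoc, ← h1, ← mul_assoc, h2, mul_assoc, ← h3, mul_assoc]
  · -- marked strand in the middle
    by_cases hac : a = c ∧ C.a a a = 2
    · obtain ⟨rfl, ha⟩ := hac
      have hai : a ≠ i := by rintro rfl; omega
      have hf : C.form a i = 0 := by
        by_contra hf
        exact h ⟨rfl, ha, hai, hf⟩
      simp [doubleCoef, hai, hf]
    · exact doubleCoef_slide_right hac z q
  · exact gen_braid C ν z q h

theorem braidCoefs_real (hi : C.a i i ≤ 0) (x y w : Option I) (z q : List I)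
    (h1 : w.getD i = x.getD i) (h2 : C.a (w.getD i) (w.getD i) = 2) (h3 : w.getD i ≠ y.getD i)
    (h4 : C.form (w.getD i) (y.getD i) ≠ 0) :
    (braidCoefs 𝕜 C ν i x y w z q).1 - (braidCoefs 𝕜 C ν i x y w z q).2 =
      ∑ c ∈ Finset.range (-C.a (w.getD i) (y.getD i)).toNat,
        ghostCoef 𝕜 C ν i (.dot (w.getD i)) [x] z ([y, w].reduceOption ++ q) ^ c *
          ghostCoef 𝕜 C ν i (.dot (w.getD i)) [w] (z ++ [x, y].reduceOption) q ^
            ((-C.a (w.getD i) (y.getD i)).toNat - 1 - c) *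
          gen 𝕜 C ν (.idem (z ++ ([x, y, w].reduceOption ++ q))) := by
  -- The outer strands have real colour and hence are unmarked; only the middle one may be marked.
  rcases w with _ | a
  · simp only [Option.getD_none] at h2; omega
  rcases x with _ | c
  · simp only [Option.getD_none, Option.getD_some] at h1 h2; subst h1; omega
  obtain rfl : a = c := h1
  rcases y with _ | b
  · simp only [braidCoefs, ghostCoef, Option.getD_none, Option.getD_some,
      mul_one, one_mul, List.reduceOption_nil, List.reduceOption_cons_of_none,
      List.reduceOption_cons_of_some, List.append_nil, List.nil_append] at h2 h3 h4 ⊢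
    rw [doubleCoef, doubleCoef, if_neg h3, if_neg h4, if_neg h3, if_neg h4]
    exact real_pow_slide h2 z q _
  · simpa [braidCoefs, ghostCoef] using gen_braid_real C ν z q h2 h3 h4

end GhostRelations

/-! ### The defining relations on functions of marked sequences -/

section GhostModule

variable {𝕜 : Type u} [Field 𝕜] {I : Type v} [DecidableEq I] {C : BorcherdsCartan I}
  {ν : Multiset I} {i : I} {K : GrMod.{u, v, w} 𝕜 C ν} {n : ℕ}

theorem coe_colours (t : List (Option I)) :
    (colours i t : Multiset I) = (t.reduceOption : Multiset I) + Multiset.replicate (marks t) i := by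
  induction t with
  | nil => simp
  | cons x t ih =>
    cases x with
    | none =>
      rw [marks_none, Multiset.replicate_succ, Multiset.add_cons, List.reduceOption_cons_of_none,
        ← ih]
      rfl
    | some j =>
      rw [marks_some, List.reduceOption_cons_of_some, ← Multiset.cons_coe, Multiset.cons_add, ← ih]
      rfl

theorem ghostSpace_idem_smul (F : ghostSpace K n) (t : List (Option I)) :
    gen 𝕜 C ν (.idem t.reduceOption) • F.1 t = F.1 t := (F.2 t).1

theorem ghostSpace_apply_eq_zero {γ : Multiset I} (h : ν + Multiset.replicate n i = γ)
    (F : ghostSpace K n) {t : List (Option I)} (ht : (colours i t : Multiset I) ≠ γ) :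
    F.1 t = 0 := by
  by_cases hm : marks t = n
  · rw [← ghostSpace_idem_smul, idem_eq_zero, zero_smul]
    intro h'
    apply ht
    rw [coe_colours, h', hm, h]
  · exact (F.2 t).2 hm

theorem ghostGen_of_ne {g : Gen I} {t : List (Option I)} (h : colours i t ≠ g.tgt)
    (F : ghostSpace K n) : (ghostGen i K n g F).1 t = 0 := ghostAct_of_ne K F.1 h

theorem ghostGen_idem (s : List I) (F : ghostSpace K n) (t : List (Option I)) :
    (ghostGen i K n (.idem s) F).1 t = if colours i t = s then F.1 t else 0 :=
  ghostAct_idem K F.1 s t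

theorem ghostGen_place {z q : List I} {p : Piece I} {t tz tp tq : List (Option I)}
    (ht : t = tz ++ (tp ++ tq)) (hz : colours i tz = z) (hp : colours i tp = p.tgt)
    (hq : colours i tq = q) (F : ghostSpace K n) :
    (ghostGen i K n (.place z p q) F).1 t =
      ghostCoef 𝕜 C ν i p tp tz.reduceOption tq.reduceOption •
        F.1 (tz ++ (p.permute tp ++ tq)) := ghostAct_place K F.1 ht hz hp hq

theorem ghostGen_cross {z q : List I} {a b : I} {t tz tq : List (Option I)} {x y : Option I}
    (ht : t = tz ++ x :: y :: tq) (hz : colours i tz = z) (hx : x.getD i = b) (hy : y.getD i = a)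
    (hq : colours i tq = q) (F : ghostSpace K n) :
    (ghostGen i K n (.place z (.cross a b) q) F).1 t =
      ghostCoef 𝕜 C ν i (.cross a b) [x, y] tz.reduceOption tq.reduceOption •
        F.1 (tz ++ y :: x :: tq) :=
  ghostGen_place (tp := [x, y]) ht hz (by simp [Piece.tgt, hx, hy]) hq F

theorem ghostGen_dot_pow {z q : List I} {a : I} {t tz tq : List (Option I)} {x : Option I}
    (ht : t = tz ++ x :: tq) (hz : colours i tz = z) (hx : x.getD i = a)
    (hq : colours i tq = q) (m : ℕ) (F : ghostSpace K n) :
    ((ghostGen i K n (.place z (.dot a) q) ^ m) F).1 t =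
      ghostCoef 𝕜 C ν i (.dot a) [x] tz.reduceOption tq.reduceOption ^ m • F.1 t := by
  induction m generalizing F with
  | zero => simp
  | succ m ih =>
    rw [pow_succ, Module.End.mul_apply, ih, pow_succ, mul_smul,
      ghostGen_place (tp := [x]) ht hz (by simp [Piece.tgt, hx]) hq, ht]
    rfl

theorem ghostGen_dot {z q : List I} {a : I} {t tz tq : List (Option I)} {x : Option I}
    (ht : t = tz ++ x :: tq) (hz : colours i tz = z) (hx : x.getD i = a)
    (hq : colours i tq = q) (F : ghostSpace K n) :
    (ghostGen i K n (.place z (.dot a) q) F).1 t =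
      ghostCoef 𝕜 C ν i (.dot a) [x] tz.reduceOption tq.reduceOption • F.1 t := by
  simpa using ghostGen_dot_pow ht hz hx hq 1 F

theorem ghostGen_pow_of_ne {g : Gen I} {t : List (Option I)} (h : colours i t ≠ g.tgt) {m : ℕ}
    (hm : m ≠ 0) (F : ghostSpace K n) : ((ghostGen i K n g ^ m) F).1 t = 0 := by
  obtain ⟨m, rfl⟩ := Nat.exists_eq_succ_of_ne_zero hm
  rw [Nat.succ_eq_add_one, pow_succ', Module.End.mul_apply, ghostGen_of_ne h]

theorem ghostEnd_ext {f g : Module.End 𝕜 (ghostSpace K n)}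
    (h : ∀ F t, (f F).1 t = (g F).1 t) : f = g :=
  LinearMap.ext fun F => Subtype.ext (funext (h F))

theorem exists_two {z q : List I} {a b : I} {t : List (Option I)}
    (h : colours i t = z ++ [a, b] ++ q) :
    ∃ tz x y tq, t = tz ++ x :: y :: tq ∧ colours i tz = z ∧ x.getD i = a ∧ y.getD i = b ∧
      colours i tq = q := by
  obtain ⟨tz, tp, tq, rfl, h1, h2, h3⟩ := exists_of_colours h
  obtain ⟨x, t, rfl, hx, h2⟩ := colours_eq_cons h2
  obtain ⟨y, t, rfl, hy, h2⟩ := colours_eq_cons h2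
  obtain rfl := colours_eq_nil h2
  exact ⟨tz, x, y, tq, rfl, h1, hx, hy, h3⟩

theorem exists_three {z q : List I} {a b c : I} {t : List (Option I)}
    (h : colours i t = z ++ [a, b, c] ++ q) :
    ∃ tz x y w tq, t = tz ++ x :: y :: w :: tq ∧ colours i tz = z ∧ x.getD i = a ∧ y.getD i = b ∧
      w.getD i = c ∧ colours i tq = q := by
  obtain ⟨tz, x, y, tq, rfl, h1, hx, hy, h3⟩ :=
    exists_two (z := z) (a := a) (b := b) (q := c :: q) (t := t) (by simpa using h)
  obtain ⟨w, t, rfl, hw, h4⟩ := colours_eq_cons h3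
  exact ⟨tz, x, y, w, t, rfl, h1, hx, hy, hw, h4⟩

theorem ghostGen_far (z : List I) (p : Piece I) (m : List I) (p' : Piece I) (q : List I) :
    ghostGen i K n (.place z p (m ++ p'.tgt ++ q)) *
        ghostGen i K n (.place (z ++ p.src ++ m) p' q) =
      ghostGen i K n (.place (z ++ p.tgt ++ m) p' q) *
        ghostGen i K n (.place z p (m ++ p'.src ++ q)) := by
  refine ghostEnd_ext fun F t => ?_
  simp only [Module.End.mul_apply]
  by_cases h : colours i t = z ++ p.tgt ++ (m ++ p'.tgt ++ q)
  swap
  · rw [ghostGen_of_ne h, ghostGen_of_ne]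
    simpa [Gen.tgt] using h
  obtain ⟨tz, tp, t', rfl, hz, hp, h⟩ := exists_of_colours h
  obtain ⟨tm, tp', tq, rfl, hm, hp', hq⟩ := exists_of_colours h
  rw [ghostGen_place rfl hz hp h,
    ghostGen_place (tz := tz ++ (p.permute tp ++ tm)) (tp := tp') (tq := tq) (by simp)
      (by simp [colours, ← hz, ← hm, ← Piece.colours_permute hp]) hp' hq,
    ghostGen_place (tz := tz ++ (tp ++ tm)) (tp := tp') (tq := tq) (by simp)
      (by simp [colours, ← hz, ← hm, ← hp]) hp' hq,
    ghostGen_place (tz := tz) (tp := tp) (tq := tm ++ (p'.permute tp' ++ tq)) (by simp) hz hp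
      (by simp [colours, ← hm, ← hq, ← Piece.colours_permute hp']), smul_smul, smul_smul]
  have := (isLocal_ghostCoef (𝕜 := 𝕜) (C := C) (ν := ν) hp).far (isLocal_ghostCoef hp')
    tz.reduceOption tm.reduceOption tq.reduceOption
  simp only [List.reduceOption_append, List.append_assoc] at this ⊢
  rw [this]

theorem ghostGen_braid_apply (z : List I) (a b c : I) (q : List I) {x y w : Option I}
    {tz tq : List (Option I)} (hz : colours i tz = z) (hx : x.getD i = c) (hy : y.getD i = b)
    (hw : w.getD i = a) (hq : colours i tq = q) (F : ghostSpace K n) :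
    ((ghostGen i K n (.place z (.cross b c) ([a] ++ q)) *
        ghostGen i K n (.place (z ++ [b]) (.cross a c) q) *
        ghostGen i K n (.place z (.cross a b) ([c] ++ q))) F).1 (tz ++ x :: y :: w :: tq) =
      (braidCoefs 𝕜 C ν i x y w tz.reduceOption tq.reduceOption).1 •
        F.1 (tz ++ w :: y :: x :: tq) ∧
    ((ghostGen i K n (.place (z ++ [c]) (.cross a b) q) *
        ghostGen i K n (.place z (.cross a c) ([b] ++ q)) *
        ghostGen i K n (.place (z ++ [a]) (.cross b c) q)) F).1 (tz ++ x :: y :: w :: tq) =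
      (braidCoefs 𝕜 C ν i x y w tz.reduceOption tq.reduceOption).2 •
        F.1 (tz ++ w :: y :: x :: tq) := by
  subst hz hx hy hw hq
  constructor
  · rw [Module.End.mul_apply, Module.End.mul_apply,
      ghostGen_cross (tz := tz) (tq := w :: tq) rfl rfl rfl rfl (by simp),
      ghostGen_cross (tz := tz ++ [y]) (tq := tq) (by simp) (by simp) rfl rfl rfl,
      ghostGen_cross (tz := tz) (tq := x :: tq) (by simp) rfl rfl rfl (by simp), smul_smul,
      smul_smul]
    simp only [braidCoefs, List.reduceOption_append, ← List.reduceOption_append [_] tq,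
      List.singleton_append, mul_assoc]
  · rw [Module.End.mul_apply, Module.End.mul_apply,
      ghostGen_cross (tz := tz ++ [x]) (tq := tq) (by simp) (by simp) rfl rfl rfl,
      ghostGen_cross (tz := tz) (tq := y :: tq) (by simp) rfl rfl rfl (by simp),
      ghostGen_cross (tz := tz ++ [w]) (tq := tq) (by simp) (by simp) rfl rfl rfl, smul_smul,
      smul_smul]
    simp only [braidCoefs, List.reduceOption_append, ← List.reduceOption_append [_] tq,
      List.append_assoc, List.cons_append, List.nil_append, mul_assoc]

theorem ghostGen_slide (z : List I) (a b : I) (q : List I) {x y : Option I}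
    {tz tq : List (Option I)} (hz : colours i tz = z) (hx : x.getD i = b) (hy : y.getD i = a)
    (hq : colours i tq = q) (F : ghostSpace K n) :
    ((ghostGen i K n (.place z (.dot b) ([a] ++ q)) *
        ghostGen i K n (.place z (.cross a b) q)) F).1 (tz ++ x :: y :: tq) =
      (ghostCoef 𝕜 C ν i (.dot b) [x] tz.reduceOption ([y].reduceOption ++ tq.reduceOption) *
        ghostCoef 𝕜 C ν i (.cross a b) [x, y] tz.reduceOption tq.reduceOption) •
        F.1 (tz ++ y :: x :: tq) ∧
    ((ghostGen i K n (.place z (.cross a b) q) *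
        ghostGen i K n (.place (z ++ [a]) (.dot b) q)) F).1 (tz ++ x :: y :: tq) =
      (ghostCoef 𝕜 C ν i (.cross a b) [x, y] tz.reduceOption tq.reduceOption *
        ghostCoef 𝕜 C ν i (.dot b) [x] (tz.reduceOption ++ [y].reduceOption) tq.reduceOption) •
        F.1 (tz ++ y :: x :: tq) ∧
    ((ghostGen i K n (.place z (.cross a b) q) *
        ghostGen i K n (.place z (.dot a) ([b] ++ q))) F).1 (tz ++ x :: y :: tq) =
      (ghostCoef 𝕜 C ν i (.cross a b) [x, y] tz.reduceOption tq.reduceOption *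
        ghostCoef 𝕜 C ν i (.dot a) [y] tz.reduceOption ([x].reduceOption ++ tq.reduceOption)) •
        F.1 (tz ++ y :: x :: tq) ∧
    ((ghostGen i K n (.place (z ++ [b]) (.dot a) q) *
        ghostGen i K n (.place z (.cross a b) q)) F).1 (tz ++ x :: y :: tq) =
      (ghostCoef 𝕜 C ν i (.dot a) [y] (tz.reduceOption ++ [x].reduceOption) tq.reduceOption *
        ghostCoef 𝕜 C ν i (.cross a b) [x, y] tz.reduceOption tq.reduceOption) •
        F.1 (tz ++ y :: x :: tq) := by
  subst hz hx hy hq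
  simp only [Module.End.mul_apply, ← List.reduceOption_append, mul_smul, List.singleton_append]
  refine ⟨?_, ?_, ?_, ?_⟩
  · rw [ghostGen_dot (tz := tz) (tq := y :: tq) rfl rfl rfl (by simp),
      ghostGen_cross (tz := tz) (tq := tq) rfl rfl rfl rfl rfl]
  · rw [ghostGen_cross (tz := tz) (tq := tq) rfl rfl rfl rfl rfl,
      ghostGen_dot (tz := tz ++ [y]) (tq := tq) (by simp) (by simp) rfl rfl]
  · rw [ghostGen_cross (tz := tz) (tq := tq) rfl rfl rfl rfl rfl,
      ghostGen_dot (tz := tz) (tq := x :: tq) rfl rfl rfl (by simp)]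
  · rw [ghostGen_dot (tz := tz ++ [x]) (tq := tq) (by simp) (by simp) rfl rfl,
      ghostGen_cross (tz := tz) (tq := tq) rfl rfl rfl rfl rfl]

theorem ghostGen_double (z : List I) (a b : I) (q : List I) {x y : Option I}
    {tz tq : List (Option I)} (hz : colours i tz = z) (hx : x.getD i = a) (hy : y.getD i = b)
    (hq : colours i tq = q) (F : ghostSpace K n) :
    ((ghostGen i K n (.place z (.cross b a) q) *
        ghostGen i K n (.place z (.cross a b) q)) F).1 (tz ++ x :: y :: tq) =
      (ghostCoef 𝕜 C ν i (.cross b a) [x, y] tz.reduceOption tq.reduceOption *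
        ghostCoef 𝕜 C ν i (.cross a b) [y, x] tz.reduceOption tq.reduceOption) •
        F.1 (tz ++ x :: y :: tq) := by
  rw [Module.End.mul_apply, ghostGen_cross (tz := tz) (tq := tq) rfl hz hx hy hq,
    ghostGen_cross (tz := tz) (tq := tq) rfl hz hy hx hq, mul_smul]

/-- At a given marked sequence each product of generators is a coefficient in R(ν) applied to one
value of `F`. Each relation of R(γ) thereby becomes an identity between coefficients, checked for
every choice of marks. Idempotents on the right-hand side are absorbed because `F t` lies in the
corresponding weight space of K. -/
theorem ghostGen_rel (hi : C.a i i ≤ 0) {γ : Multiset I} (h : ν + Multiset.replicate n i = γ)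
    {x y : FreeAlgebra 𝕜 (Gen I)} (hxy : Rel 𝕜 C γ x y) :
    FreeAlgebra.lift 𝕜 (ghostGen i K n) x = FreeAlgebra.lift 𝕜 (ghostGen i K n) y := by
  cases hxy with
  | idem_self s =>
    simp only [map_mul, FreeAlgebra.lift_ι_apply]
    refine ghostEnd_ext fun F t => ?_
    simp only [Module.End.mul_apply, ghostGen_idem]
    split_ifs <;> rfl
  | idem_ne s s' hs =>
    simp only [map_mul, FreeAlgebra.lift_ι_apply, map_zero]
    refine ghostEnd_ext fun F t => ?_
    simp only [Module.End.mul_apply, ghostGen_idem]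
    split_ifs with h1 h2
    · exact absurd (h1.symm.trans h2) hs
    · rfl
    · rfl
  | idem_zero s hs =>
    simp only [FreeAlgebra.lift_ι_apply, map_zero]
    refine ghostEnd_ext fun F t => ?_
    rw [ghostGen_idem]
    split_ifs with h1
    · exact ghostSpace_apply_eq_zero h F (by rwa [h1])
    · rfl
  | idem_sum =>
    simp only [map_sum, FreeAlgebra.lift_ι_apply, map_one]
    refine ghostEnd_ext fun F t => ?_
    have h1 : ((∑ s ∈ seqs γ, ghostGen i K n (.idem s)) F).1 t =
        ∑ s ∈ seqs γ, (ghostGen i K n (.idem s) F).1 t := by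
      rw [LinearMap.sum_apply, AddSubmonoidClass.coe_finsetSum, Finset.sum_apply]
    rw [h1]
    simp only [ghostGen_idem]
    rw [Finset.sum_ite_eq]
    split_ifs with h2
    · rfl
    · exact (ghostSpace_apply_eq_zero h F fun h3 => h2 (mem_seqs.2 h3)).symm
  | top z p q =>
    simp only [map_mul, FreeAlgebra.lift_ι_apply]
    refine ghostEnd_ext fun F t => ?_
    rw [Module.End.mul_apply, ghostGen_idem]
    split_ifs with h1
    · rfl
    · exact (ghostGen_of_ne h1 F).symm
  | bot z p q =>
    simp only [map_mul, FreeAlgebra.lift_ι_apply]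
    refine ghostEnd_ext fun F t => ?_
    rw [Module.End.mul_apply]
    by_cases h1 : colours i t = (Gen.place z p q).tgt
    swap
    · rw [ghostGen_of_ne h1, ghostGen_of_ne h1]
    obtain ⟨tz, tp, tq, rfl, hz, hp, hq⟩ := exists_of_colours h1
    rw [ghostGen_place rfl hz hp hq, ghostGen_place rfl hz hp hq, ghostGen_idem, if_pos]
    simp [colours, ← hz, ← hq, ← Piece.colours_permute hp]
  | far z p m p' q =>
    simp only [map_mul, FreeAlgebra.lift_ι_apply]
    exact ghostGen_far z p m p' q
  | double_same z a q =>
    simp only [map_mul, FreeAlgebra.lift_ι_apply, map_zero]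
    refine ghostEnd_ext fun F t => ?_
    by_cases h1 : colours i t = (Gen.place z (.cross a a) q).tgt
    swap
    · rw [Module.End.mul_apply, ghostGen_of_ne h1]; rfl
    obtain ⟨tz, x, y, tq, rfl, hz, hx, hy, hq⟩ := exists_two h1
    rw [ghostGen_double z a a q hz hx hy hq]
    have : ghostCoef 𝕜 C ν i (.cross a a) [x, y] tz.reduceOption tq.reduceOption *
        ghostCoef 𝕜 C ν i (.cross a a) [y, x] tz.reduceOption tq.reduceOption = 0 := by
      cases x <;> cases y <;> simp [ghostCoef, doubleCoef, gen_double_same] at hx hy ⊢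
      · exact fun h => absurd hx.symm h
      · exact fun h => absurd hy.symm h
    rw [this, zero_smul]
    rfl
  | double_orth z a b q hab hf =>
    simp only [map_mul, FreeAlgebra.lift_ι_apply]
    refine ghostEnd_ext fun F t => ?_
    rw [ghostGen_idem]
    split_ifs with h1
    swap
    · rw [Module.End.mul_apply, ghostGen_of_ne h1]
    obtain ⟨tz, x, y, tq, rfl, hz, hx, hy, hq⟩ := exists_two h1
    rw [ghostGen_double z a b q hz hx hy hq]
    have hf' : C.form b a = 0 := by rw [C.form_comm, hf]
    cases x with
    | none =>
      obtain rfl : i = a := hx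
      cases y with
      | none => exact absurd hy hab
      | some y => simp [ghostCoef, doubleCoef, hab.symm, hf']
    | some x =>
      obtain rfl : x = a := hx
      cases y with
      | none =>
        obtain rfl : i = b := hy
        simp [ghostCoef, doubleCoef, hab, hf]
      | some y =>
        obtain rfl : y = b := hy
        rw [ghostCoef, ghostCoef, gen_double_orth C ν _ _ hab hf]
        have := ghostSpace_idem_smul F (tz ++ some x :: some y :: tq)
        simpa [List.reduceOption_append] using this
  | double_ne z a b q hab hf =>
    simp only [map_mul, FreeAlgebra.lift_ι_apply, map_add, map_pow]
    refine ghostEnd_ext fun F t => ?_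
    have hadd : ∀ f g : Module.End 𝕜 (ghostSpace K n),
      ((f + g) F).1 t = (f F).1 t + (g F).1 t := fun _ _ => rfl
    have hf' : C.form b a ≠ 0 := by rwa [C.form_comm]
    rw [hadd]
    by_cases h1 : colours i t = z ++ [a, b] ++ q
    swap
    · rw [Module.End.mul_apply, ghostGen_of_ne h1, ghostGen_pow_of_ne _ (form_ne_zero hab hf).1,
        ghostGen_pow_of_ne _ (form_ne_zero hab hf).2, add_zero]
      · simpa [Gen.tgt, Piece.tgt] using h1
      · simpa [Gen.tgt, Piece.tgt] using h1
    obtain ⟨tz, x, y, tq, rfl, hz, hx, hy, hq⟩ := exists_two h1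
    rw [ghostGen_double z a b q hz hx hy hq,
      ghostGen_dot_pow (tz := tz) (tq := y :: tq) rfl hz hx (by simp [hy, ← hq]),
      ghostGen_dot_pow (tz := tz ++ [x]) (tq := tq) (by simp) (by simp [hx, ← hz]) hy hq,
      ← add_smul]
    congr 1
    have h2 := (form_ne_zero hab hf).1
    have h3 := (form_ne_zero hab hf).2
    cases x with
    | none =>
      obtain rfl : i = a := hx
      cases y with
      | none => exact absurd hy hab
      | some y =>
        obtain rfl : y = b := hy
        simp [ghostCoef, doubleCoef, hab.symm, hf', zero_pow h2, List.reduceOption_append]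
    | some x =>
      obtain rfl : x = a := hx
      cases y with
      | none =>
        obtain rfl : i = b := hy
        simp [ghostCoef, doubleCoef, hab, hf, zero_pow h3]
      | some y =>
        obtain rfl : y = b := hy
        simpa [ghostCoef, List.reduceOption_append] using gen_double_ne C ν _ _ hab hf
  | slide_real_left z a q ha =>
    simp only [map_mul, FreeAlgebra.lift_ι_apply, map_sub]
    refine ghostEnd_ext fun F t => ?_
    have hsub : ∀ f g : Module.End 𝕜 (ghostSpace K n),
      ((f - g) F).1 t = (f F).1 t - (g F).1 t := fun _ _ => rfl
    rw [hsub, ghostGen_idem]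
    split_ifs with h1
    swap
    · rw [Module.End.mul_apply, ghostGen_of_ne, Module.End.mul_apply, ghostGen_of_ne, sub_zero]
      · simpa [Gen.tgt, Piece.tgt] using h1
      · simpa [Gen.tgt, Piece.tgt] using h1
    obtain ⟨tz, x, y, tq, rfl, hz, hx, hy, hq⟩ := exists_two h1
    have h2 := ghostGen_slide z a a q hz hx hy hq F
    rw [h2.1, h2.2.1, ← sub_smul]
    -- A marked strand has the imaginary colour i, whereas the colour here is real; so both strands
    -- are unmarked.
    cases x with
    | none => obtain rfl : i = a := hx; omega
    | some x =>
      cases y with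
      | none => obtain rfl : i = a := hy; omega
      | some y =>
        obtain rfl : x = a := hx
        obtain rfl : y = x := hy
        have h3 := gen_slide_real_left (𝕜 := 𝕜) C ν tz.reduceOption tq.reduceOption ha
        simp only [ghostCoef, List.reduceOption_cons_of_some, List.reduceOption_nil]
        rw [h3]
        have := ghostSpace_idem_smul F (tz ++ some y :: some y :: tq)
        simpa [List.reduceOption_append] using this
  | slide_real_right z a q ha =>
    simp only [map_mul, FreeAlgebra.lift_ι_apply, map_sub]
    refine ghostEnd_ext fun F t => ?_
    have hsub : ∀ f g : Module.End 𝕜 (ghostSpace K n),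
      ((f - g) F).1 t = (f F).1 t - (g F).1 t := fun _ _ => rfl
    rw [hsub, ghostGen_idem]
    split_ifs with h1
    swap
    · rw [Module.End.mul_apply, ghostGen_of_ne, Module.End.mul_apply, ghostGen_of_ne, sub_zero]
      · simpa [Gen.tgt, Piece.tgt] using h1
      · simpa [Gen.tgt, Piece.tgt] using h1
    obtain ⟨tz, x, y, tq, rfl, hz, hx, hy, hq⟩ := exists_two h1
    have h2 := ghostGen_slide z a a q hz hx hy hq F
    rw [h2.2.2.1, h2.2.2.2, ← sub_smul]
    cases x with
    | none => obtain rfl : i = a := hx; omega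
    | some x =>
      cases y with
      | none => obtain rfl : i = a := hy; omega
      | some y =>
        obtain rfl : x = a := hx
        obtain rfl : y = x := hy
        have h3 := gen_slide_real_right (𝕜 := 𝕜) C ν tz.reduceOption tq.reduceOption ha
        simp only [ghostCoef, List.reduceOption_cons_of_some, List.reduceOption_nil]
        rw [h3]
        have := ghostSpace_idem_smul F (tz ++ some y :: some y :: tq)
        simpa [List.reduceOption_append] using this
  | slide_left z a b q hab =>
    simp only [map_mul, FreeAlgebra.lift_ι_apply]
    refine ghostEnd_ext fun F t => ?_
    by_cases h1 : colours i t = z ++ [b, a] ++ q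
    swap
    · rw [Module.End.mul_apply, ghostGen_of_ne, Module.End.mul_apply, ghostGen_of_ne]
      · simpa [Gen.tgt, Piece.tgt] using h1
      · simpa [Gen.tgt, Piece.tgt] using h1
    obtain ⟨tz, x, y, tq, rfl, hz, hx, hy, hq⟩ := exists_two h1
    have h2 := ghostGen_slide z a b q hz hx hy hq F
    rw [h2.1, h2.2.1]
    congr 1
    cases x with
    | none => simp [ghostCoef]
    | some x =>
      obtain rfl : x = b := hx
      cases y with
      | none => simp [ghostCoef]
      | some y =>
        obtain rfl : y = a := hy
        exact gen_slide_left C ν _ _ hab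
  | slide_right z a b q hab =>
    simp only [map_mul, FreeAlgebra.lift_ι_apply]
    refine ghostEnd_ext fun F t => ?_
    by_cases h1 : colours i t = z ++ [b, a] ++ q
    swap
    · rw [Module.End.mul_apply, ghostGen_of_ne, Module.End.mul_apply, ghostGen_of_ne]
      · simpa [Gen.tgt, Piece.tgt] using h1
      · simpa [Gen.tgt, Piece.tgt] using h1
    obtain ⟨tz, x, y, tq, rfl, hz, hx, hy, hq⟩ := exists_two h1
    have h2 := ghostGen_slide z a b q hz hx hy hq F
    rw [h2.2.2.1, h2.2.2.2]
    congr 1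
    cases y with
    | none => simp [ghostCoef]
    | some y =>
      obtain rfl : y = a := hy
      cases x with
      | none =>
        simp only [ghostCoef, List.reduceOption_cons_of_none, List.reduceOption_nil,
          List.append_nil, List.nil_append]
        -- The coefficient is zero, one or a power of the dot on `y`, and each of these commutes
        -- with that dot.
        by_cases hyi : y = i
        · simp [doubleCoef, hyi]
        by_cases hf : C.form y i = 0
        · simp [doubleCoef, hyi, hf]
        · rw [doubleCoef, if_neg hyi, if_neg hf, ← pow_succ, ← pow_succ']
      | some x =>
        obtain rfl : x = b := hx
        exact gen_slide_right C ν _ _ hab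
  | braid z a b c q hb =>
    simp only [map_mul, FreeAlgebra.lift_ι_apply]
    refine ghostEnd_ext fun F t => ?_
    by_cases h1 : colours i t = z ++ [c, b, a] ++ q
    swap
    · rw [mul_assoc, Module.End.mul_apply, ghostGen_of_ne, mul_assoc, Module.End.mul_apply,
        ghostGen_of_ne]
      · simpa [Gen.tgt, Piece.tgt] using h1
      · simpa [Gen.tgt, Piece.tgt] using h1
    obtain ⟨tz, x, y, w, tq, rfl, hz, hx, hy, hw, hq⟩ := exists_three h1
    have h2 := ghostGen_braid_apply z a b c q hz hx hy hw hq F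
    rw [h2.1, h2.2, braidCoefs_eq hi]
    rwa [hx, hy, hw]
  | braid_real z a b q ha hab hf =>
    simp only [map_mul, FreeAlgebra.lift_ι_apply, map_sub, map_sum, map_pow]
    refine ghostEnd_ext fun F t => ?_
    have hsub : ∀ f g : Module.End 𝕜 (ghostSpace K n),
      ((f - g) F).1 t = (f F).1 t - (g F).1 t := fun _ _ => rfl
    have hsum : ∀ (s : Finset ℕ) (f : ℕ → Module.End 𝕜 (ghostSpace K n)),
        ((∑ c ∈ s, f c) F).1 t = ∑ c ∈ s, (f c F).1 t := fun s f => by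
      rw [LinearMap.sum_apply, AddSubmonoidClass.coe_finsetSum, Finset.sum_apply]
    rw [hsub, hsum]
    by_cases h1 : colours i t = z ++ [a, b, a] ++ q
    swap
    · rw [mul_assoc, Module.End.mul_apply, ghostGen_of_ne, mul_assoc, Module.End.mul_apply,
        ghostGen_of_ne, sub_zero]
      · refine (Finset.sum_eq_zero fun c _ => ?_).symm
        have hp : ∀ (g : Gen I) (m : ℕ) (F' : ghostSpace K n), colours i t ≠ g.tgt →
            F'.1 t = 0 → ((ghostGen i K n g ^ m) F').1 t = 0 := by
          intro g m F' hg hF'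
          cases m with
          | zero => exact hF'
          | succ m => exact ghostGen_pow_of_ne hg m.succ_ne_zero F'
        rw [Module.End.mul_apply, Module.End.mul_apply]
        refine hp _ _ _ (by simpa [Gen.tgt, Piece.tgt] using h1) (hp _ _ _
          (by simpa [Gen.tgt, Piece.tgt] using h1) ?_)
        rw [ghostGen_idem, if_neg h1]
      · simpa [Gen.tgt, Piece.tgt] using h1
      · simpa [Gen.tgt, Piece.tgt] using h1
    obtain ⟨tz, x, y, w, tq, rfl, hz, hx, hy, hw, hq⟩ := exists_three h1
    have h2 := ghostGen_braid_apply z a b a q hz hx hy hw hq F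
    have h3 := braidCoefs_real (𝕜 := 𝕜) (ν := ν) hi x y w tz.reduceOption tq.reduceOption
      (by rw [hw, hx]) (by rwa [hw]) (by rwa [hw, hy]) (by rwa [hw, hy])
    rw [h2.1, h2.2]
    have hw' : w = some a := by
      cases w with
      | none => obtain rfl : i = a := hw; omega
      | some w => exact congrArg some hw
    have hx' : x = some a := by
      cases x with
      | none => obtain rfl : i = a := hx; omega
      | some x => exact congrArg some hx
    subst hw' hx'
    rw [← sub_smul, h3, Finset.sum_smul, hw, hy]
    refine Finset.sum_congr rfl fun c _ => ?_
    rw [Module.End.mul_apply, Module.End.mul_apply,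
      ghostGen_dot_pow (tz := tz) (tq := y :: some a :: tq) rfl hz hx (by simp [hy, ← hq]),
      ghostGen_dot_pow (tz := tz ++ [some a, y]) (tq := tq) (by simp) (by simp [hy, ← hz]) hw hq,
      ghostGen_idem, if_pos h1, mul_smul, mul_smul]
    have h4 := ghostSpace_idem_smul F (tz ++ some a :: y :: some a :: tq)
    have h5 : (tz ++ some a :: y :: some a :: tq).reduceOption =
        tz.reduceOption ++ ([some a, y, some a].reduceOption ++ tq.reduceOption) := by
      rw [← List.reduceOption_append, ← List.reduceOption_append]; rfl
    rw [← h5, h4, List.reduceOption_append, ← List.reduceOption_append [y, some a]]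
    rfl

end GhostModule

/-! ### Evaluation at sorted sequences and the resulting map into K -/

section GhostEvaluation

variable {𝕜 : Type u} [Field 𝕜] {I : Type v} [DecidableEq I] {C : BorcherdsCartan I}
  {ν γ : Multiset I} {i : I} (K : GrMod.{u, v, w} 𝕜 C ν) {n : ℕ}

/-- The action of `R(ν + n i)` on `ghostSpace`. -/
def ghostRep (hi : C.a i i ≤ 0) (h : ν + Multiset.replicate n i = γ) :
    Alg 𝕜 C γ →ₐ[𝕜] Module.End 𝕜 (ghostSpace K n) :=
  Alg.lift 𝕜 (FreeAlgebra.lift 𝕜 (ghostGen i K n)) (ghostGen_rel hi h)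

theorem ghostRep_gen (hi : C.a i i ≤ 0) (h : ν + Multiset.replicate n i = γ) (g : Gen I) :
    ghostRep K hi h (gen 𝕜 C γ g) = ghostGen i K n g := by
  rw [ghostRep, gen, Alg.lift_mk 𝕜 _ (ghostGen_rel hi h), FreeAlgebra.lift_ι_apply]

/-- The sum of the values at the sorted sequences. -/
def ghostEval (n : ℕ) : ghostSpace K n →ₗ[𝕜] K :=
  (∑ s ∈ seqs ν, LinearMap.proj (sortedSeq s n)) ∘ₗ (ghostSpace K n).subtype

theorem ghostEval_apply (F : ghostSpace K n) :
    ghostEval K n F = ∑ s ∈ seqs ν, F.1 (sortedSeq s n) := by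
  rw [ghostEval, LinearMap.comp_apply, LinearMap.sum_apply]
  rfl

variable {K}

theorem idem_smul_sortedSeq (F : ghostSpace K n) (s : List I) :
    gen 𝕜 C ν (.idem s) • F.1 (sortedSeq s n) = F.1 (sortedSeq s n) := by
  have := ghostSpace_idem_smul F (sortedSeq s n)
  rwa [reduceOption_sortedSeq] at this

theorem ghostGen_shift_sortedSeq (g : Gen I) (F : ghostSpace K n) (s : List I) :
    (ghostGen i K n (g.shift [] (List.replicate n i)) F).1 (sortedSeq s n) =
      if s = g.tgt then gen 𝕜 C ν g • F.1 (sortedSeq g.src n) else 0 := by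
  split_ifs with hs
  swap
  · apply ghostGen_of_ne
    rw [Gen.shift_tgt, colours_sortedSeq]
    simpa using hs
  subst hs
  cases g with
  | idem u =>
    simp only [Gen.shift, Gen.tgt, Gen.src, ghostGen_idem, colours_sortedSeq, List.nil_append,
      if_true, idem_smul_sortedSeq]
  | place z p q =>
    have hcol : ∀ l : List I, colours i (l.map some) = l := fun l => by
      simp [colours, Function.comp_def]
    have h1 : sortedSeq (Gen.place z p q).tgt n =
        z.map some ++ (p.tgt.map some ++ sortedSeq q n) := by
      simp [sortedSeq, Gen.tgt]
    have h2 : sortedSeq (Gen.place z p q).src n =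
        z.map some ++ (p.src.map some ++ sortedSeq q n) := by
      simp [sortedSeq, Gen.src]
    rw [Gen.shift, ghostGen_place h1 (by simp [hcol]) (hcol _) (colours_sortedSeq q n), h2,
      reduceOption_map_some, reduceOption_sortedSeq]
    cases p <;> rfl

theorem gen_smul_sum (g : Gen I) (F : ghostSpace K n) :
    gen 𝕜 C ν g • ghostEval K n F = gen 𝕜 C ν g • F.1 (sortedSeq g.src n) := by
  by_cases hg : (g.src : Multiset I) = ν
  swap
  · rw [gen_eq_zero C hg, zero_smul, zero_smul]
  rw [ghostEval_apply, Finset.smul_sum, Finset.sum_eq_single_of_mem g.src (mem_seqs.2 hg)]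
  intro s _ hs
  rw [← idem_smul_sortedSeq, smul_smul, mul_idem_src, if_neg hs.symm, zero_smul]

/-- At a sorted sequence a generator of R(ν) meets unmarked strands only, and its coefficient is the
generator itself. Summing over all sequences of weight ν assembles the weight components of an
element of K. -/
theorem ghostEval_leftPl (hi : C.a i i ≤ 0) (h : ν + Multiset.replicate n i = γ) (a : Alg 𝕜 C ν)
    (F : ghostSpace K n) :
    ghostEval K n (ghostRep K hi h (leftPl C h a) F) = a • ghostEval K n F := by
  have hg : ∀ (g : Gen I) (F : ghostSpace K n),
      ghostEval K n (ghostRep K hi h (leftPl C h (gen 𝕜 C ν g)) F) =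
        gen 𝕜 C ν g • ghostEval K n F := by
    intro g F
    rw [leftPl_idem_top h rfl, ghostRep_gen, gen_smul_sum, ghostEval_apply]
    simp only [ghostGen_shift_sortedSeq]
    rw [Finset.sum_ite_eq']
    split_ifs with h1
    · rfl
    · rw [gen_eq_zero C fun h2 => h1 (mem_seqs.2 (g.coe_src ▸ h2)), zero_smul]
  have h1 : ∀ F : ghostSpace K n,
      ghostEval K n (ghostRep K hi h (leftPl C h 1) F) = ghostEval K n F := by
    intro F
    rw [← sum_idem, map_sum, map_sum, LinearMap.sum_apply, map_sum]
    simp only [hg]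
    rw [← Finset.sum_smul, sum_idem, one_smul]
  induction a using alg_induction generalizing F with
  | hc c =>
    rw [alg_unit_smul, map_smul, map_smul, LinearMap.smul_apply, map_smul, h1, smul_assoc, one_smul]
  | hg g => exact hg g F
  | hm a b ha hb => rw [leftPl_mul, map_mul, Module.End.mul_apply, ha, hb, mul_smul]
  | ha a b ha hb => rw [map_add, map_add, LinearMap.add_apply, map_add, ha, hb, add_smul]

/-- The piece starts beyond the unmarked strands, so all the strands it touches are marked and its
coefficient is zero. -/
theorem ghostGen_place_sortedSeq {z z' s q : List I} {p : Piece I} (hz : z.length = s.length)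
    (F : ghostSpace K n) :
    (ghostGen i K n (.place (z ++ z') p q) F).1 (sortedSeq s n) = 0 := by
  obtain h | ⟨tz, tp, tq, ht, htz, htp, htq, h⟩ :=
    ghostAct_cases (i := i) K (z ++ z') p q (sortedSeq s n)
  · exact h F.1
  refine (h F.1).trans ?_
  have h1 : ∀ x ∈ tp, x = none := by
    have h2 : (sortedSeq s n).drop s.length = List.replicate n none := by
      rw [sortedSeq]
      exact List.drop_left' (by simp)
    have h3 : s.length ≤ tz.length := by
      have : tz.length = (z ++ z').length := by rw [← htz]; simp
      rw [this, List.length_append]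
      omega
    rw [ht, List.drop_append_of_le_length h3] at h2
    intro x hx
    refine List.eq_of_mem_replicate (n := n) (h2 ▸ ?_)
    simp [hx]
  have h4 : tp.length = p.tgt.length := by rw [← htp]; simp
  rw [← List.eq_replicate_length] at h1
  rw [h1, h4]
  cases p <;> exact zero_smul _ _

theorem ghostEval_rightPl (hi : C.a i i ≤ 0) (h : ν + Multiset.replicate n i = γ)
    (c : Alg 𝕜 C (Multiset.replicate n i)) (F : ghostSpace K n) :
    ghostEval K n (ghostRep K hi h (rightPl C h c) F) = charOf hi rfl c • ghostEval K n F := by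
  induction c using alg_induction generalizing F with
  | hc c =>
    rw [alg_unit_smul, map_smul, map_smul, map_smul, LinearMap.smul_apply, map_smul, ← leftPl_one,
      ghostEval_leftPl, one_smul, map_one, smul_assoc, one_smul]
  | hg g =>
    rw [rightPl_gen, map_sum, LinearMap.sum_apply, map_sum, charOf_gen]
    simp only [ghostRep_gen, ghostEval_apply]
    rw [Finset.sum_comm, Finset.smul_sum]
    refine Finset.sum_congr rfl fun s hs => ?_
    have hlen : ∀ z ∈ seqs ν, z.length = s.length := fun z hz => by
      have := congrArg Multiset.card ((mem_seqs.1 hz).trans (mem_seqs.1 hs).symm)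
      simpa using this
    cases g with
    | idem u =>
      rw [Finset.sum_eq_single_of_mem s hs]
      · simp only [Gen.shift, ghostGen_idem, colours_sortedSeq, List.append_nil, trivGen,
          List.append_cancel_left_eq]
        split_ifs with h1 h2 h2
        · rw [one_smul]
        · exact absurd h1.symm h2
        · exact absurd h2.symm h1
        · rw [zero_smul]
      · intro z hz hne
        rw [Gen.shift, ghostGen_idem, if_neg]
        rw [colours_sortedSeq, List.append_nil]
        exact fun h' => hne (List.append_inj h' (hlen z hz).symm).1.symm
    | place z' p q =>
      rw [trivGen, zero_smul]
      exact Finset.sum_eq_zero fun z hz => ghostGen_place_sortedSeq (hlen z hz) F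
  | hm a b ha hb => rw [rightPl_mul, map_mul, Module.End.mul_apply, ha, hb, map_mul, mul_smul]
  | ha a b ha hb => rw [map_add, map_add, LinearMap.add_apply, map_add, ha, hb, map_add, add_smul]

/-! ### The grading -/

/-- The degree of the diagram which sorts a marked sequence. -/
def markDeg (C : BorcherdsCartan I) (i : I) : List (Option I) → ℤ
  | [] => 0
  | some _ :: t => markDeg C i t
  | none :: t => markDeg C i t - (t.reduceOption.map (C.form i)).sum

theorem markDeg_append (t t' : List (Option I)) :
    markDeg C i (t ++ t') = markDeg C i t + markDeg C i t' -
      marks t * (t'.reduceOption.map (C.form i)).sum := by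
  induction t with
  | nil => simp [markDeg]
  | cons x t ih =>
    cases x with
    | some j => simpa [markDeg] using ih
    | none =>
      simp only [List.cons_append, markDeg, ih, List.reduceOption_append, List.map_append,
        List.sum_append, marks_none]
      push_cast
      ring

theorem markDeg_sortedSeq (s : List I) (n : ℕ) : markDeg C i (sortedSeq s n) = 0 := by
  rw [sortedSeq, markDeg_append]
  have h1 : markDeg C i (s.map some) = 0 := by
    induction s with
    | nil => rfl
    | cons j s ih => exact ih
  have h2 : markDeg C i (List.replicate n none) = 0 := by
    induction n with
    | zero => rfl
    | succ n ih => simp [List.replicate_succ, markDeg, ih]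
  simp [h1, h2]

theorem pow_mem_gr {d : ℤ} {x : Alg 𝕜 C ν} (hx : x ∈ Alg.gr 𝕜 C ν d) (m : ℕ) :
    x ^ m ∈ Alg.gr 𝕜 C ν (m * d) := by
  induction m with
  | zero => simpa using one_mem_gr C ν
  | succ m ih =>
    rw [pow_succ, Nat.cast_succ, add_mul, one_mul]
    exact mul_mem_gr C ih hx

theorem doubleCoef_mem_gr (a : I) (z q : List I) :
    doubleCoef 𝕜 C ν i a z q ∈ Alg.gr 𝕜 C ν (-2 * C.form a i) := by
  rw [doubleCoef]
  split_ifs with h1 h2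
  · exact zero_mem _
  · rw [h2]; exact one_mem_gr C ν
  · have h3 := pow_mem_gr (gen_mem_gr (𝕜 := 𝕜) C ν (.place z (.dot a) q)) (-C.a a i).toNat
    have h4 := C.off_diag a i h1
    rw [Int.toNat_of_nonneg (by omega)] at h3
    have h5 : -C.a a i * (Gen.place z (.dot a) q).deg C = -2 * C.form a i := by
      simp only [Gen.deg, Piece.deg, BorcherdsCartan.form]
      ring
    rwa [h5] at h3

/-- The coefficient c stands in a relation of the form `sortDiag` · g = c · `sortDiag`, with
different marked sequences on the two sides, so its degree is that of g plus the difference of the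
degrees of the two sorting diagrams. -/
theorem ghostCoef_mem_gr {p : Piece I} {tp : List (Option I)} (h : colours i tp = p.tgt)
    (z q : List I) : ghostCoef 𝕜 C ν i p tp z q ∈
      Alg.gr 𝕜 C ν (p.deg C + markDeg C i tp - markDeg C i (p.permute tp)) := by
  cases p with
  | dot j =>
    obtain ⟨x, t, rfl, hx, ht⟩ := colours_eq_cons h
    obtain rfl := colours_eq_nil ht
    cases x with
    | none => exact zero_mem _
    | some x =>
      simp only [Piece.permute, add_sub_cancel_right]
      exact gen_mem_gr C ν (.place z (.dot j) q)
  | cross a b =>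
    obtain ⟨x, t, rfl, hx, ht⟩ := colours_eq_cons h
    obtain ⟨y, t, rfl, hy, ht⟩ := colours_eq_cons ht
    obtain rfl := colours_eq_nil ht
    cases x with
    | none =>
      cases y with
      | none => exact zero_mem _
      | some y =>
        obtain rfl : y = a := hy
        obtain rfl : i = b := hx
        have hd : (Piece.cross y i).deg C + markDeg C i [none, some y] -
            markDeg C i ((Piece.cross y i).permute [none, some y]) = -2 * C.form y i := by
          have := C.form_comm i y
          simp [Piece.permute, Piece.deg, markDeg, this]
          ring
        rw [hd]
        exact doubleCoef_mem_gr y z q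
    | some x =>
      cases y with
      | none =>
        obtain rfl : x = b := hx
        obtain rfl : i = a := hy
        have hd : (Piece.cross i x).deg C + markDeg C i [some x, none] -
            markDeg C i ((Piece.cross i x).permute [some x, none]) = 0 := by
          simp [Piece.permute, Piece.deg, markDeg]
        rw [hd]
        exact one_mem_gr C ν
      | some y =>
        obtain rfl : y = a := hy
        obtain rfl : x = b := hx
        have hd : (Piece.cross y x).deg C + markDeg C i [some x, some y] -
            markDeg C i ((Piece.cross y x).permute [some x, some y]) = (Piece.cross y x).deg C := by
          simp [Piece.permute, markDeg]
        rw [hd]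
        exact gen_mem_gr C ν (.place z (.cross y x) q)

/-- A piece does not change which strands stand to the left and to the right of it, so their
contributions to the degree cancel. -/
theorem markDeg_permute (p : Piece I) (tz tp tq : List (Option I)) :
    markDeg C i (tz ++ (tp ++ tq)) - markDeg C i (tz ++ (p.permute tp ++ tq)) =
      markDeg C i tp - markDeg C i (p.permute tp) := by
  have h1 : ((p.permute tp).reduceOption.map (C.form i)).sum =
      (tp.reduceOption.map (C.form i)).sum := by
    cases p with
    | dot j => rfl
    | cross a b => simp [Piece.permute, List.reduceOption, List.filterMap_reverse]
  simp only [markDeg_append, Piece.marks_permute, List.reduceOption_append, List.map_append,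
    List.sum_append, h1]
  ring

/-- Homogeneous elements of `ghostSpace`. -/
def GhostHomogeneous (i : I) (d : ℤ) (F : ghostSpace K n) : Prop :=
  ∀ t, F.1 t ∈ K.gr (d + markDeg C i t)

theorem GhostHomogeneous.gen {d : ℤ} {F : ghostSpace K n} (hF : GhostHomogeneous i d F)
    (g : Gen I) : GhostHomogeneous i (g.deg C + d) (ghostGen i K n g F) := by
  intro t
  cases g with
  | idem s =>
    rw [ghostGen_idem]
    split_ifs
    · simpa [Gen.deg] using hF t
    · exact zero_mem _
  | place z p q =>
    obtain h | ⟨tz, tp, tq, rfl, htz, htp, htq, h⟩ := ghostAct_cases (i := i) K z p q t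
    · rw [ghostGen_apply, h]; exact zero_mem _
    · rw [ghostGen_apply, h]
      have h1 := K.smul_mem _ _ _ (ghostCoef_mem_gr (𝕜 := 𝕜) (C := C) (ν := ν) htp tz.reduceOption
        tq.reduceOption) _ (hF (tz ++ (p.permute tp ++ tq)))
      have h2 := markDeg_permute (C := C) (i := i) p tz tp tq
      convert h1 using 2
      simp only [Gen.deg]
      linarith

theorem GhostHomogeneous.rep (hi : C.a i i ≤ 0) (h : ν + Multiset.replicate n i = γ) {d e : ℤ}
    {F : ghostSpace K n} (hF : GhostHomogeneous i d F) {y : Alg 𝕜 C γ}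
    (hy : y ∈ Alg.gr 𝕜 C γ e) : GhostHomogeneous i (e + d) (ghostRep K hi h y F) := by
  induction hy using Submodule.span_induction with
  | mem x hx =>
    obtain ⟨l, rfl, rfl⟩ := hx
    induction l with
    | nil => simpa using hF
    | cons g l ih =>
      simp only [List.map_cons, List.sum_cons, List.prod_cons, map_mul, Module.End.mul_apply,
        ghostRep_gen, add_assoc]
      exact ih.gen g
  | zero =>
    intro t
    rw [map_zero]
    exact zero_mem _
  | add x y _ _ hx hy =>
    intro t
    rw [map_add]
    exact add_mem (hx t) (hy t)
  | smul c x _ hx =>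
    intro t
    rw [map_smul]
    exact Submodule.smul_mem _ c (hx t)

theorem GhostHomogeneous.eval {d : ℤ} {F : ghostSpace K n} (hF : GhostHomogeneous i d F) :
    ghostEval K n F ∈ K.gr d := by
  rw [ghostEval_apply]
  refine Submodule.sum_mem _ fun s _ => ?_
  have := hF (sortedSeq s n)
  rwa [markDeg_sortedSeq, add_zero] at this

theorem exists_ghost {d : ℤ} {k : K} (hk : k ∈ K.gr d) (n : ℕ) :
    ∃ F : ghostSpace K n, GhostHomogeneous i d F ∧ ghostEval K n F = k := by
  classical
  -- The function is supported on sorted sequences, where it takes as values the weight components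
  -- of `k`; they add up to `k`.
  let f : List (Option I) → K := fun t =>
    if t = sortedSeq t.reduceOption n then gen 𝕜 C ν (.idem t.reduceOption) • k else 0
  have hf : f ∈ ghostSpace K n := by
    intro t
    by_cases ht : t = sortedSeq t.reduceOption n
    · refine ⟨?_, fun h => absurd ?_ h⟩
      · simp only [f, if_pos ht]
        rw [smul_smul, idem_mul_idem, if_pos rfl]
      · rw [ht, marks_sortedSeq]
    · simp only [f, if_neg ht, smul_zero, implies_true, and_self]
  refine ⟨⟨f, hf⟩, fun t => ?_, ?_⟩
  · by_cases ht : t = sortedSeq t.reduceOption n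
    · have h0 : markDeg C i t = 0 := by rw [ht, markDeg_sortedSeq]
      simp only [f, if_pos ht]
      have := K.smul_mem _ _ _ (gen_mem_gr (𝕜 := 𝕜) C ν (.idem t.reduceOption)) _ hk
      rwa [Gen.deg, zero_add, ← add_zero d, ← h0] at this
    · simp only [f, if_neg ht]
      exact zero_mem _
  · rw [ghostEval_apply]
    have : ∀ s, f (sortedSeq s n) = gen 𝕜 C ν (.idem s) • k := fun s => by
      simp only [f, reduceOption_sortedSeq, if_true]
    simp only [this]
    rw [← Finset.sum_smul, sum_idem, one_smul]

/-- A nonzero homogeneous homomorphism from `1_{ν, n i} R(ν + n i)` to `K ⊗ V(i^n)`. -/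
theorem exists_hom (hi : C.a i i ≤ 0) (h : ν + Multiset.replicate n i = γ) {d : ℤ} {k : K}
    (hk : k ∈ K.gr d) :
    ∃ f : Alg 𝕜 C γ →ₗ[𝕜] K, f 1 = k ∧
      (∀ a c y, f (leftPl C h a * rightPl C h c * y) = charOf hi rfl c • a • f y) ∧
      ∀ e, ∀ y ∈ Alg.gr 𝕜 C γ e, f y ∈ K.gr (e + d) := by
  obtain ⟨F, hF, hFk⟩ := exists_ghost (i := i) hk n
  -- The map sends y to the evaluation of y • F, so its equivariance is that of the evaluation.
  refine ⟨ghostEval K n ∘ₗ LinearMap.applyₗ F ∘ₗ (ghostRep K hi h).toLinearMap, ?_, ?_, ?_⟩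
  · simp [hFk]
  · intro a c y
    simp only [LinearMap.comp_apply, AlgHom.toLinearMap_apply, LinearMap.applyₗ_apply_apply,
      map_mul, Module.End.mul_apply]
    rw [ghostEval_leftPl, ghostEval_rightPl]
    exact (K.act a).map_smul _ _
  · intro e y hy
    exact (hF.rep hi h hy).eval

end GhostEvaluation

/-! ### Socles and cyclic graded modules -/

section GradedModules

variable {𝕜 : Type u} [Field 𝕜] {I : Type v} [DecidableEq I] {C : BorcherdsCartan I}
  {γ : Multiset I}

theorem GrMod.smul_comm' (M : GrMod.{u, v, w} 𝕜 C γ) (a : Alg 𝕜 C γ) (c : 𝕜) (m : M) :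
    a • c • m = c • a • m := (M.act a).map_smul c m

theorem GrMod.eq_zero_of_mem (M : GrMod.{u, v, w} 𝕜 C γ) {d : ℤ} {m : M} (hm : m ∈ M.gr d)
    (hm' : m ∈ ⨆ (e) (_ : e ≠ d), M.gr e) : m = 0 :=
  Submodule.disjoint_def.1 (iSupIndep_def.1 M.gr_indep d) m hm hm'

theorem GrMod.span_isHomogeneous (M : GrMod.{u, v, w} 𝕜 C γ) {d : ℤ} {m : M} (hm : m ∈ M.gr d) :
    M.IsHomogeneous (Submodule.span (Alg 𝕜 C γ) {m}) := by
  intro x hx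
  obtain ⟨a, rfl⟩ := Submodule.mem_span_singleton.1 (show x ∈ Submodule.span _ {m} from hx)
  obtain ⟨f, hf, rfl⟩ := exists_homogeneous_sum C a
  rw [Finsupp.sum, Finset.sum_smul]
  refine Submodule.sum_mem _ fun e _ => Submodule.mem_iSup_of_mem (e + d) ⟨?_, ?_⟩
  · exact Submodule.smul_mem _ _ (Submodule.mem_span_singleton_self m)
  · exact M.smul_mem _ _ _ (hf e) _ hm

theorem GrMod.exists_homogeneous (M : GrMod.{u, v, w} 𝕜 C γ) {N : Submodule (Alg 𝕜 C γ) M}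
    (hN : M.IsHomogeneous N) (h0 : N ≠ ⊥) : ∃ d, ∃ m ∈ N, m ∈ M.gr d ∧ m ≠ 0 := by
  by_contra! h
  apply h0
  rw [eq_bot_iff]
  intro x hx
  have h1 : ⨆ d, N.restrictScalars 𝕜 ⊓ M.gr d ≤ ⊥ :=
    iSup_le fun d m hm => h d m hm.1 hm.2
  exact h1 (hN hx)

/-- The homogeneous components of R(γ) are not assumed independent. Their independence in the module
suffices: in any decomposition of `a`, the terms of degree other than d together annihilate `m`.
Thus the degree of a • m is described by the class of `a` modulo the annihilator of `m`. -/
theorem GrMod.smul_mem_gr_iff (M : GrMod.{u, v, w} 𝕜 C γ) {c d : ℤ} {m : M} (hm : m ∈ M.gr c)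
    {a : Alg 𝕜 C γ} : a • m ∈ M.gr (d + c) ↔ ∃ b ∈ Alg.gr 𝕜 C γ d, b • m = a • m := by
  refine ⟨fun h => ?_, fun ⟨b, hb, hba⟩ => hba ▸ M.smul_mem _ _ _ hb _ hm⟩
  obtain ⟨f, hf, rfl⟩ := exists_homogeneous_sum C a
  refine ⟨f d, hf d, ?_⟩
  have h1 : (f.sum fun _ a => a) = f d + ∑ e ∈ f.support.erase d, f e := by
    rw [Finsupp.sum]
    by_cases hd : d ∈ f.support
    · rw [Finset.add_sum_erase _ _ hd]
    · rw [Finset.erase_eq_of_notMem hd, Finsupp.notMem_support_iff.1 hd, zero_add]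
  rw [h1, add_smul] at h ⊢
  have h2 : (∑ e ∈ f.support.erase d, f e) • m = 0 := by
    refine M.eq_zero_of_mem ((Submodule.add_mem_iff_right _ (M.smul_mem _ _ _ (hf d) _ hm)).1 h) ?_
    rw [Finset.sum_smul]
    refine Submodule.sum_mem _ fun e he => ?_
    exact Submodule.mem_iSup_of_mem (e + c) (Submodule.mem_iSup_of_mem
      (fun h => Finset.ne_of_mem_erase he (add_right_cancel h)) (M.smul_mem _ _ _ (hf e) _ hm))
  rw [h2, add_zero]

/-- If `g` lies in every nonzero graded submodule, then it generates a gr-irreducible submodule. -/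
theorem GrMod.sub_isIrreducible (M : GrMod.{u, v, w} 𝕜 C γ) {g : M} (h0 : g ≠ 0)
    (hg : ∀ N, M.IsHomogeneous N → N ≠ ⊥ → g ∈ N) {N : Submodule (Alg 𝕜 C γ) M}
    (hN : M.IsHomogeneous N) (hspan : N = Submodule.span (Alg 𝕜 C γ) {g}) :
    (M.sub N hN).IsIrreducible := by
  have hgN : g ∈ N := hspan ▸ Submodule.mem_span_singleton_self g
  refine ⟨⟨⟨⟨g, hgN⟩, 0, fun h => h0 (congrArg Subtype.val h)⟩⟩, fun L hL => ?_⟩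
  refine or_iff_not_imp_left.2 fun hL0 => ?_
  -- A graded submodule of `N` is also a graded submodule of `M`, so `hg` applies to it.
  let L' : Submodule (Alg 𝕜 C γ) M :=
    { carrier := {x | ∃ hx : x ∈ N, (⟨x, hx⟩ : M.sub N hN) ∈ L}
      add_mem' := fun ⟨hx, hx'⟩ ⟨hy, hy'⟩ => ⟨add_mem hx hy, L.add_mem hx' hy'⟩
      zero_mem' := ⟨zero_mem _, L.zero_mem⟩
      smul_mem' := fun a _ ⟨hx, hx'⟩ => ⟨N.smul_mem a hx, L.smul_mem a hx'⟩ }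
  have hL' : M.IsHomogeneous L' := by
    rintro x ⟨hx, hx'⟩
    have h1 : (⨆ d, L.restrictScalars 𝕜 ⊓ (M.sub N hN).gr d) ≤
        (⨆ d, L'.restrictScalars 𝕜 ⊓ M.gr d).comap (N.restrictScalars 𝕜).subtype :=
      iSup_le fun d y hy => Submodule.mem_iSup_of_mem d ⟨⟨y.2, hy.1⟩, hy.2⟩
    exact h1 (hL hx')
  obtain ⟨_, hgL⟩ := hg L' hL' fun h => hL0 <| (eq_bot_iff).2 fun x hx => by
    have h1 : x.1 ∈ L' := ⟨x.2, hx⟩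
    rw [h] at h1
    exact Subtype.ext h1
  refine eq_top_iff.2 fun x _ => ?_
  have hx : x.1 ∈ Submodule.span (Alg 𝕜 C γ) {g} := hspan ▸ x.2
  obtain ⟨a, ha⟩ := Submodule.mem_span_singleton.1 hx
  have h1 : x = a • (⟨g, hgN⟩ : M.sub N hN) := Subtype.ext ha.symm
  rw [h1]
  exact L.smul_mem a hgL

/-- A gr-irreducible graded submodule is nonzero, hence contains `g`, hence is generated by `g`. -/
theorem GrMod.socle_eq_span (M : GrMod.{u, v, w} 𝕜 C γ) {d : ℤ} {g : M} (hd : g ∈ M.gr d)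
    (h0 : g ≠ 0) (hg : ∀ N, M.IsHomogeneous N → N ≠ ⊥ → g ∈ N) :
    M.socle = Submodule.span (Alg 𝕜 C γ) {g} := by
  refine le_antisymm (sSup_le ?_) (le_sSup ⟨M.span_isHomogeneous hd,
    M.sub_isIrreducible h0 hg _ rfl⟩)
  rintro N ⟨hN, hirr⟩
  have hgN : g ∈ N := hg N hN fun h => by
    obtain ⟨x, y, hxy⟩ := hirr.1
    have h1 := (Submodule.eq_bot_iff N).1 h
    exact hxy (Subtype.ext ((h1 _ x.2).trans (h1 _ y.2).symm))
  let g₁ : M.sub N hN := ⟨g, hgN⟩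
  have h1 := hirr.2 (Submodule.span (Alg 𝕜 C γ) {g₁})
    ((M.sub N hN).span_isHomogeneous (d := d) hd)
  have h2 : g₁ ≠ 0 := fun h => h0 (congrArg Subtype.val h)
  rcases h1 with h1 | h1
  · exact absurd (Submodule.span_singleton_eq_bot.1 h1) h2
  · intro x hx
    let x₁ : M.sub N hN := ⟨x, hx⟩
    have h3 : x₁ ∈ Submodule.span (Alg 𝕜 C γ) {g₁} := by rw [h1]; trivial
    obtain ⟨a, ha⟩ := Submodule.mem_span_singleton.1 h3
    exact Submodule.mem_span_singleton.2 ⟨a, congrArg Subtype.val ha⟩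

/-- Cyclic graded modules with generators of the same degree and the same annihilator are
isomorphic. -/
theorem GrMod.sub_iso (M M' : GrMod.{u, v, w} 𝕜 C γ) {d : ℤ} {g : M} {g' : M'}
    (hd : g ∈ M.gr d) (hd' : g' ∈ M'.gr d) (hann : ∀ a : Alg 𝕜 C γ, a • g = 0 ↔ a • g' = 0)
    {N : Submodule (Alg 𝕜 C γ) M} (hN : M.IsHomogeneous N)
    (hspan : N = Submodule.span (Alg 𝕜 C γ) {g})
    {N' : Submodule (Alg 𝕜 C γ) M'} (hN' : M'.IsHomogeneous N')
    (hspan' : N' = Submodule.span (Alg 𝕜 C γ) {g'}) :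
    (M.sub N hN).Iso (M'.sub N' hN') := by
  have hmem : ∀ a : Alg 𝕜 C γ, a • g ∈ N := fun a =>
    hspan ▸ Submodule.smul_mem _ a (Submodule.mem_span_singleton_self g)
  have hmem' : ∀ a : Alg 𝕜 C γ, a • g' ∈ N' := fun a =>
    hspan' ▸ Submodule.smul_mem _ a (Submodule.mem_span_singleton_self g')
  have hex : ∀ x : M.sub N hN, ∃ a : Alg 𝕜 C γ, a • g = x.1 := fun x =>
    Submodule.mem_span_singleton.1 (show x.1 ∈ Submodule.span _ {g} from hspan ▸ x.2)
  have hex' : ∀ x : M'.sub N' hN', ∃ a : Alg 𝕜 C γ, a • g' = x.1 := fun x =>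
    Submodule.mem_span_singleton.1 (show x.1 ∈ Submodule.span _ {g'} from hspan' ▸ x.2)
  have heq : ∀ a b : Alg 𝕜 C γ, a • g = b • g ↔ a • g' = b • g' := fun a b => by
    rw [← sub_eq_zero, ← sub_smul, hann, sub_smul, sub_eq_zero]
  choose p hp using hex
  choose q hq using hex'
  let φ : M.sub N hN →ₗ[Alg 𝕜 C γ] M'.sub N' hN' :=
    { toFun := fun x => ⟨p x • g', hmem' _⟩
      map_add' := fun x y => Subtype.ext <| by
        change p (x + y) • g' = p x • g' + p y • g'
        rw [← add_smul, ← heq, add_smul, hp, hp, hp]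
        rfl
      map_smul' := fun a x => Subtype.ext <| by
        change p (a • x) • g' = a • p x • g'
        rw [smul_smul, ← heq, mul_smul, hp, hp]
        rfl }
  have hφ : ∀ x, (φ x).1 = p x • g' := fun _ => rfl
  have hbij : Function.Bijective φ := by
    refine ⟨fun x y hxy => Subtype.ext ?_, fun y => ?_⟩
    · rw [← hp, ← hp, heq, ← hφ, ← hφ, hxy]
    · let x : M.sub N hN := ⟨q y • g, hmem _⟩
      refine ⟨x, Subtype.ext ?_⟩
      rw [hφ, ← hq, ← heq]
      exact hp x
  refine ⟨LinearEquiv.ofBijective φ hbij, fun e x => ?_⟩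
  obtain ⟨c, rfl⟩ : ∃ c, e = c + d := ⟨e - d, by ring⟩
  change p x • g' ∈ M'.gr (c + d) ↔ x.1 ∈ M.gr (c + d)
  -- Both sides are now conditions on the class of `p x` modulo the common annihilator of `g` and
  -- `g'`.
  rw [← hp, M.smul_mem_gr_iff hd, M'.smul_mem_gr_iff hd']
  simp only [heq]

theorem GrMod.delta_eq_bot_iff (M : GrMod.{u, v, w} 𝕜 C γ) (i : I) (n : ℕ) :
    M.delta i n = ⊥ ↔ ∀ m : M, tailIdem (𝕜 := 𝕜) C γ i n • m = 0 := by
  rw [GrMod.delta, LinearMap.range_eq_bot]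
  exact LinearMap.ext_iff

theorem tailIdem_mul_idem (i : I) (n : ℕ) (s : List I) :
    tailIdem (𝕜 := 𝕜) C γ i n * gen 𝕜 C γ (.idem (s ++ List.replicate n i)) =
      gen 𝕜 C γ (.idem (s ++ List.replicate n i)) := by
  by_cases hs : ((s ++ List.replicate n i : List I) : Multiset I) = γ
  · rw [tailIdem, Finset.sum_mul, Finset.sum_eq_single_of_mem (s ++ List.replicate n i)]
    · rw [idem_mul_idem, if_pos rfl]
    · rw [Finset.mem_filter]
      exact ⟨mem_seqs.2 hs, List.suffix_append _ _⟩
    · intro t _ ht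
      rw [idem_mul_idem, if_neg ht]
  · rw [idem_eq_zero C hs, mul_zero]

theorem idem_mul_tailIdem (i : I) (n : ℕ) (s : List I) :
    gen 𝕜 C γ (.idem (s ++ List.replicate n i)) * tailIdem (𝕜 := 𝕜) C γ i n =
      gen 𝕜 C γ (.idem (s ++ List.replicate n i)) := by
  by_cases hs : ((s ++ List.replicate n i : List I) : Multiset I) = γ
  · rw [tailIdem, Finset.mul_sum, Finset.sum_eq_single_of_mem (s ++ List.replicate n i)]
    · rw [idem_mul_idem, if_pos rfl]
    · rw [Finset.mem_filter]
      exact ⟨mem_seqs.2 hs, List.suffix_append _ _⟩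
    · intro t _ ht
      rw [idem_mul_idem, if_neg ht.symm]
  · rw [idem_eq_zero C hs, zero_mul]

theorem tailIdem_eq_zero (i : I) {n : ℕ} (hn : Multiset.card γ < n) :
    tailIdem (𝕜 := 𝕜) C γ i n = 0 := by
  rw [tailIdem]
  refine Finset.sum_eq_zero fun s hs => ?_
  rw [Finset.mem_filter, mem_seqs] at hs
  have h1 := hs.2.length_le
  have h2 := congrArg Multiset.card hs.1
  simp only [List.length_replicate, Multiset.coe_card] at h1 h2
  omega

theorem GrMod.idem_smul_eq_zero (K : GrMod.{u, v, w} 𝕜 C γ) {i : I} (hε : K.eps i = 0)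
    (s : List I) (k : K) : gen 𝕜 C γ (.idem (s ++ [i])) • k = 0 := by
  -- In ℕ the supremum of an unbounded set is 0 by convention, so ε_i(K) = 0 carries information
  -- only once the set is known to be bounded. It is, because a tail cannot be longer than the
  -- sequence.
  have hb : BddAbove {n : ℕ | K.delta i n ≠ ⊥} := by
    refine ⟨Multiset.card γ, fun n hn => ?_⟩
    by_contra! h
    exact hn ((K.delta_eq_bot_iff i n).2 fun m => by rw [tailIdem_eq_zero i h, zero_smul])
  have h1 : K.delta i 1 = ⊥ := by
    by_contra h
    have : 1 ≤ K.eps i := le_csSup hb h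
    omega
  rw [K.delta_eq_bot_iff] at h1
  have h2 := idem_mul_tailIdem (𝕜 := 𝕜) (C := C) (γ := γ) i 1 s
  rw [List.replicate_one] at h2
  rw [← h2, mul_smul, h1, smul_zero]

end GradedModules

/-! ### Elements on which R(ni) acts by its trivial character -/

section Evaluation

variable {𝕜 : Type u} [Field 𝕜] {I : Type v} [DecidableEq I] {C : BorcherdsCartan I}
  {ν γ : Multiset I} {i : I} {n : ℕ}

theorem leftPl_one_mul_rightPl (h : ν + Multiset.replicate n i = γ)
    (c : Alg 𝕜 C (Multiset.replicate n i)) :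
    leftPl C h 1 * rightPl C h c = rightPl C h c := by
  rw [leftPl_one, ← rightPl_mul, one_mul]

/-- An injection of a graded `R(ν + n i)`-module `M` into the linear maps `R(ν + n i) → K` which
commute with `R(ν)` and kill the multiples of the dots of `R(n i)`. -/
structure Realization (K : GrMod.{u, v, w} 𝕜 C ν) (M : GrMod.{u, v, w'} 𝕜 C γ)
    (h : ν + Multiset.replicate n i = γ) where
  toLin : M →ₗ[𝕜] Alg 𝕜 C γ →ₗ[𝕜] K
  inj : ∀ f, toLin f = 0 → f = 0
  smul : ∀ z f y, toLin (z • f) y = toLin f (y * z)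
  left : ∀ f a y, toLin f (leftPl C h a * y) = a • toLin f y
  -- Only dots are required to act by zero from the left: a crossing between two blocks of the
  -- composition need not do so.
  dot : ∀ f k l, k + 1 + l = n → ∀ y, toLin f (rightPl C h
    (gen 𝕜 C _ (.place (List.replicate k i) (.dot i) (List.replicate l i))) * y) = 0
  mem_gr : ∀ d, ∀ f ∈ M.gr d, ∀ e, ∀ y ∈ Alg.gr 𝕜 C γ e, toLin f y ∈ K.gr (e + d)

/-- The elements on which `R(n i)` acts by its trivial character. -/
def IsTrivial (M : GrMod.{u, v, w'} 𝕜 C γ) (h : ν + Multiset.replicate n i = γ)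
    (hi : C.a i i ≤ 0) (f : M) : Prop :=
  ∀ c : Alg 𝕜 C (Multiset.replicate n i), rightPl C h c • f = trivRep hi n c • f

variable {M : GrMod.{u, v, w'} 𝕜 C γ} {h : ν + Multiset.replicate n i = γ} {hi : C.a i i ≤ 0}

theorem IsTrivial.leftPl_one_smul {f : M} (hf : IsTrivial M h hi f) : leftPl (𝕜 := 𝕜) C h 1 • f = f := by
  rw [leftPl_one, hf, map_one, one_smul]

theorem IsTrivial.leftPl_smul {f : M} (hf : IsTrivial M h hi f) (a : Alg 𝕜 C ν) :
    IsTrivial M h hi (leftPl C h a • f) := by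
  intro c
  rw [smul_smul, ← leftPl_comm, mul_smul, hf, M.smul_comm']

theorem IsTrivial.sub {f g : M} (hf : IsTrivial M h hi f) (hg : IsTrivial M h hi g) :
    IsTrivial M h hi (f - g) := by
  intro c
  rw [smul_sub, smul_sub, hf, hg]

theorem isTrivial_of_place {f : M} (h1 : leftPl (𝕜 := 𝕜) C h 1 • f = f)
    (hf : ∀ z p q, rightPl C h (gen 𝕜 C _ (.place z p q)) • f = 0) : IsTrivial M h hi f := by
  intro c
  induction c using alg_induction with
  | hc c =>
    rw [alg_unit_smul, map_smul, map_smul, map_one (trivRep hi n), smul_assoc, ← leftPl_one, h1,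
      smul_assoc, one_smul]
  | hg g =>
    rw [trivRep_gen]
    cases g with
    | idem s =>
      rw [trivGen]
      split_ifs with hs
      · have := sum_idem (𝕜 := 𝕜) C (Multiset.replicate n i)
        rw [seqs_replicate, Finset.sum_singleton] at this
        rw [hs, this, ← leftPl_one, h1, one_smul]
      · rw [idem_eq_zero C (mt coe_eq_replicate.1 hs), map_zero, zero_smul, zero_smul]
    | place z p q => rw [hf, trivGen, zero_smul]
  | hm a b ha hb => rw [rightPl_mul, mul_smul, hb, M.smul_comm', ha, map_mul, mul_comm, mul_smul]
  | ha a b ha hb => rw [map_add, add_smul, ha, hb, map_add, add_smul]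

theorem rightPl_placeWord_mem_gr (h : ν + Multiset.replicate n i = γ)
    (l : List (List I × Piece I × List I)) :
    ∃ e, rightPl C h (placeWord 𝕜 C _ l) ∈ Alg.gr 𝕜 C γ e := by
  have h1 : placeWord 𝕜 C (Multiset.replicate n i) l =
      ((l.map fun x => Gen.place x.1 x.2.1 x.2.2).map (gen 𝕜 C _)).prod := by
    rw [placeWord, List.map_map]
    rfl
  exact ⟨_, h1 ▸ rightPl_word_mem C h _⟩

namespace Realization

variable {K : GrMod.{u, v, w} 𝕜 C ν} (Φ : Realization K M h)

theorem left_one (f : M) (y : Alg 𝕜 C γ) : Φ.toLin f (leftPl C h 1 * y) = Φ.toLin f y := by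
  rw [Φ.left, one_smul]

/-- By R(ν)-linearity the value lies in the image of an idempotent 1_s of R(ν) with s ending in i,
up to an element of R(ν), and such idempotents annihilate K. -/
theorem apply_tailIdeal (hε : K.eps i = 0) (f : M) {y : Alg 𝕜 C γ} (hy : y ∈ tailIdeal 𝕜 C i h) :
    Φ.toLin f y = 0 := by
  have : tailIdeal 𝕜 C i h ≤ LinearMap.ker (Φ.toLin f) := by
    refine Submodule.span_le.2 ?_
    rintro _ ⟨a, s, x, rfl⟩
    rw [SetLike.mem_coe, LinearMap.mem_ker, Φ.left, mul_smul, K.idem_smul_eq_zero hε, smul_zero]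
  exact this hy

theorem apply_dotIdeal (f : M) {c : Alg 𝕜 C (Multiset.replicate n i)}
    (hc : c ∈ dotIdeal 𝕜 C i n) (y : Alg 𝕜 C γ) : Φ.toLin f (rightPl C h c * y) = 0 := by
  have : dotIdeal 𝕜 C i n ≤
      LinearMap.ker (Φ.toLin f ∘ₗ LinearMap.mulRight 𝕜 y ∘ₗ rightPl C h) := by
    refine Submodule.span_le.2 ?_
    rintro _ ⟨k, l, x, hkl, rfl⟩
    change Φ.toLin f (rightPl C h (_ * x) * y) = 0
    rw [rightPl_mul, mul_assoc, Φ.dot f k l hkl]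
  exact this hc

/-- The fields of `Realization` control dots on the left of the argument, while here c acts on the
right. To compare, y is reduced to the corner of 1_{ν,ni}: on a product from R(ν) ⊗ R(ni) the factor
c joins the R(ni)-part, where the dots form a two-sided ideal, and on `tailIdeal` every map
vanishes. -/
theorem dotIdeal_smul (Φ : Realization K M h) (hi : C.a i i ≤ 0) (hε : K.eps i = 0) (f : M)
    {c : Alg 𝕜 C (Multiset.replicate n i)} (hc : c ∈ dotIdeal 𝕜 C i n) :
    rightPl C h c • f = 0 := by
  refine Φ.inj _ (LinearMap.ext fun y => ?_)
  rw [LinearMap.zero_apply, Φ.smul, ← leftPl_one_mul_rightPl, ← mul_assoc, ← Φ.left_one,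
    ← mul_assoc, ← mul_assoc]
  have : parabolic 𝕜 C h ⊔ tailIdeal 𝕜 C i h ≤
      LinearMap.ker (Φ.toLin f ∘ₗ LinearMap.mulRight 𝕜 (rightPl C h c)) := by
    refine sup_le (Submodule.span_le.2 ?_) fun x hx => ?_
    · rintro _ ⟨a, b, rfl⟩
      change Φ.toLin f (leftPl C h a * rightPl C h b * rightPl C h c) = 0
      rw [mul_assoc, Φ.left, ← rightPl_mul, ← mul_one (rightPl C h _),
        Φ.apply_dotIdeal f (mul_mem_dotIdeal hi b hc), smul_zero]
    · exact Φ.apply_tailIdeal hε f (tailIdeal_mul h hx _)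
  exact this (corner_mem hi h rfl y)

/-- Triviality includes that f is fixed by 1_{ν,ni}, so f is determined by its values on the corner,
that is, on products ac with a in R(ν) and c in R(ni). There f(ac) = a f(c), and f(c) is the value
of c • f at 1, a multiple of f(1). -/
theorem eq_zero_of_apply_one (hε : K.eps i = 0) {f : M} (hf : IsTrivial M h hi f)
    (h1 : Φ.toLin f 1 = 0) : f = 0 := by
  refine Φ.inj _ (LinearMap.ext fun y => ?_)
  rw [LinearMap.zero_apply, ← hf.leftPl_one_smul, Φ.smul, ← Φ.left_one, ← mul_assoc]
  have : parabolic 𝕜 C h ⊔ tailIdeal 𝕜 C i h ≤ LinearMap.ker (Φ.toLin f) := by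
    refine sup_le (Submodule.span_le.2 ?_) fun x hx => Φ.apply_tailIdeal hε f hx
    rintro _ ⟨a, c, rfl⟩
    rw [SetLike.mem_coe, LinearMap.mem_ker, Φ.left, ← one_mul (rightPl C h c), ← Φ.smul, hf,
      map_smul, LinearMap.smul_apply, h1, smul_zero, smul_zero]
  exact this (corner_mem hi h rfl y)

/-- Every nonzero element has a nonzero multiple, by a homogeneous element, on which `R(n i)`
acts trivially. -/
theorem exists_isTrivial (Φ : Realization K M h) (hi : C.a i i ≤ 0) (hε : K.eps i = 0) {f : M}
    (h0 : f ≠ 0) : ∃ (z : Alg 𝕜 C γ) (e : ℤ), z ∈ Alg.gr 𝕜 C γ e ∧ z • f ≠ 0 ∧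
      IsTrivial M h hi (z • f) := by
  obtain ⟨e, y, hy, hy0⟩ : ∃ e, ∃ y ∈ Alg.gr 𝕜 C γ e, Φ.toLin f y ≠ 0 := by
    by_contra! h1
    refine h0 (Φ.inj f (LinearMap.ext fun y => ?_))
    obtain ⟨g, hg, rfl⟩ := exists_homogeneous_sum C y
    rw [Finsupp.sum, map_sum]
    exact Finset.sum_eq_zero fun e _ => h1 e _ (hg e)
  -- `P m` states that some word of `m` dots and crossings of R(ni) does not annihilate y • f.
  let P : ℕ → Prop := fun m => ∃ l : List (List I × Piece I × List I), l.length = m ∧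
    (rightPl C h (placeWord 𝕜 C _ l) * y) • f ≠ 0
  have hP0 : P 0 := by
    refine ⟨[], rfl, fun h1 => hy0 ?_⟩
    have h2 := congrArg (fun g => Φ.toLin g 1) h1
    simp only [Φ.smul, map_zero, LinearMap.zero_apply, placeWord, List.map_nil, List.prod_nil,
      one_mul] at h2
    rwa [← leftPl_one, Φ.left_one] at h2
  -- Words of length n² + 1 lie in the ideal of the dots and act by zero, so there is a nonvanishing
  -- word that no further dot or crossing prolongs to a nonvanishing one. It provides the required
  -- multiple.
  obtain ⟨m, ⟨l, hl, hl0⟩, hm⟩ : ∃ m, P m ∧ ¬ P (m + 1) := by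
    by_contra! h1
    have h2 : ∀ m, P m := fun m => by
      induction m with
      | zero => exact hP0
      | succ m ih => exact h1 m ih
    obtain ⟨l, hl, hl0⟩ := h2 (n * n + 1)
    refine hl0 ?_
    rw [mul_smul]
    exact Φ.dotIdeal_smul hi hε _ (placeWord_mem_dotIdeal hi l (by omega))
  obtain ⟨e', he'⟩ := rightPl_placeWord_mem_gr (𝕜 := 𝕜) h l
  refine ⟨_, _, mul_mem_gr C he' hy, hl0, isTrivial_of_place ?_ fun z p q => ?_⟩
  · rw [smul_smul, ← mul_assoc, leftPl_one_mul_rightPl]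
  · rw [smul_smul, ← mul_assoc, ← rightPl_mul]
    by_contra h1
    exact hm ⟨(z, p, q) :: l, by simp [hl], h1⟩

/-- The value of f at 1 is homogeneous and nonzero, so it generates K. Some a in R(ν) therefore
carries it to g(1), and trivial elements with equal values at 1 coincide. -/
theorem exists_leftPl_smul_eq (Φ : Realization K M h) (hε : K.eps i = 0) (hK : K.IsIrreducible) {d : ℤ} {f g : M}
    (hf : f ∈ M.gr d) (h0 : f ≠ 0) (hft : IsTrivial M h hi f) (hgt : IsTrivial M h hi g) :
    ∃ a : Alg 𝕜 C ν, leftPl C h a • f = g := by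
  have h1 : Φ.toLin f 1 ≠ 0 := fun h1 => h0 (Φ.eq_zero_of_apply_one hε hft h1)
  have h2 := hK.2 (Submodule.span (Alg 𝕜 C ν) {Φ.toLin f 1})
    (K.span_isHomogeneous (Φ.mem_gr d f hf 0 1 (one_mem_gr C γ)))
  have h3 : Submodule.span (Alg 𝕜 C ν) {Φ.toLin f 1} = ⊤ :=
    h2.resolve_left fun h => h1 (Submodule.span_singleton_eq_bot.1 h)
  obtain ⟨a, ha⟩ := Submodule.mem_span_singleton.1
    (h3 ▸ Submodule.mem_top : Φ.toLin g 1 ∈ Submodule.span (Alg 𝕜 C ν) {Φ.toLin f 1})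
  refine ⟨a, sub_eq_zero.1 (Φ.eq_zero_of_apply_one hε ((hft.leftPl_smul a).sub hgt) ?_)⟩
  rw [map_sub, LinearMap.sub_apply, Φ.smul, one_mul, ← mul_one (leftPl C h a), Φ.left, ha, sub_self]

/-- A homogeneous nonzero element of N has a trivial nonzero homogeneous multiple, and g is a
multiple of that one. -/
theorem mem_of_isTrivial (Φ : Realization K M h) (hε : K.eps i = 0) (hK : K.IsIrreducible) {g : M}
    (hgt : IsTrivial M h hi g) (N : Submodule (Alg 𝕜 C γ) M) (hN : M.IsHomogeneous N)
    (hN0 : N ≠ ⊥) : g ∈ N := by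
  obtain ⟨d, f, hfN, hfd, hf0⟩ := M.exists_homogeneous hN hN0
  obtain ⟨z, e, hz, hz0, hzt⟩ := Φ.exists_isTrivial hi hε hf0
  obtain ⟨a, rfl⟩ := Φ.exists_leftPl_smul_eq hε hK (M.smul_mem _ _ _ hz _ hfd) hz0 hzt hgt
  exact N.smul_mem _ (N.smul_mem _ hfN)

theorem tailIdem_smul (Φ : Realization K M h) (hi : C.a i i ≤ 0) (hε : K.eps i = 0) {k : ℕ} (hk : n < k) (f : M) :
    tailIdem (𝕜 := 𝕜) C γ i k • f = 0 := by
  refine Φ.inj _ (LinearMap.ext fun y => ?_)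
  rw [LinearMap.zero_apply, Φ.smul, ← Φ.left_one, ← mul_assoc, tailIdem, Finset.mul_sum, map_sum]
  refine Finset.sum_eq_zero fun s hs => ?_
  obtain ⟨t, rfl⟩ := (Finset.mem_filter.1 hs).2
  exact Φ.apply_tailIdeal hε f (mul_idem_mem_tailIdeal hi h rfl y t hk)

theorem soc_eps (Φ : Realization K M h) (hε : K.eps i = 0) {g : M} (hg : g ∈ M.socle) (h0 : g ≠ 0)
    (hgt : IsTrivial M h hi g) : M.soc.eps i = n := by
  refine IsGreatest.csSup_eq ⟨?_, fun k hk => ?_⟩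
  · intro h1
    have h2 := congrArg Subtype.val ((M.soc.delta_eq_bot_iff i n).1 h1 ⟨g, hg⟩)
    change tailIdem (𝕜 := 𝕜) C γ i n • g = 0 at h2
    refine h0 ?_
    -- A trivial element is fixed by 1_{ν,ni}, which in turn is fixed by the idempotent of the
    -- sequences ending in i^n. Hence the component of `g` for tails i^n is `g` itself.
    rw [← h2, ← hgt.leftPl_one_smul, smul_smul]
    congr 1
    rw [← sum_idem, map_sum, Finset.mul_sum]
    refine Finset.sum_congr rfl fun s _ => ?_
    rw [leftPl_idem_eq h rfl, tailIdem_mul_idem]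
  · by_contra! hlt
    exact hk ((M.soc.delta_eq_bot_iff i k).2 fun m =>
      Subtype.ext (Φ.tailIdem_smul hi hε hlt m.1))

end Realization

end Evaluation

/-! ### Co-induced modules as spaces of maps R(ν + ni) → K -/

section Coinduced

variable {𝕜 : Type u} [Field 𝕜] {I : Type v} [DecidableEq I] {C : BorcherdsCartan I}
  {ν γ : Multiset I} {i : I} {n : ℕ}

theorem leftPl_eq_of_eq {ν' ν'' : Multiset I} (e : ν' = ν'') (h : ν + ν' = γ) (h' : ν + ν'' = γ)
    (a : Alg 𝕜 C ν) : leftPl C h a = leftPl C h' a := by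
  subst e
  rfl

theorem rightPl_gen_eq_of_eq {ν' ν'' : Multiset I} (e : ν' = ν'') (h : ν + ν' = γ)
    (h' : ν + ν'' = γ) (g : Gen I) :
    rightPl (𝕜 := 𝕜) C h (gen 𝕜 C ν' g) = rightPl C h' (gen 𝕜 C ν'' g) := by
  subst e
  rfl

variable (K : GrMod.{u, v, w} 𝕜 C ν) (hi : C.a i i ≤ 0) {r : ℕ} (m : Fin r → ℕ)

/-- The product `V(i^{m_1}) ⊗ ⋯ ⊗ V(i^{m_r}) → 𝕜`. -/
def trivProd : MultilinearMap 𝕜 (fun j => triv (𝕜 := 𝕜) C hi (m j)) 𝕜 :=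
  MultilinearMap.mkPiAlgebra 𝕜 (Fin r) 𝕜

/-- The canonical identification of `K ⊗ V(i^{m_1}) ⊗ ⋯ ⊗ V(i^{m_r})` with `K`. -/
def outerToK : Outer K (fun j => triv (𝕜 := 𝕜) C hi (m j)) →ₗ[𝕜] K :=
  (TensorProduct.rid 𝕜 K).toLinearMap ∘ₗ
    TensorProduct.map LinearMap.id (PiTensorProduct.lift (trivProd hi m))

/-- The inverse of `outerToK`. -/
def outerOfK : K →ₗ[𝕜] Outer K (fun j => triv (𝕜 := 𝕜) C hi (m j)) :=
  (TensorProduct.mk 𝕜 K _).flip (PiTensorProduct.tprod 𝕜 fun _ => (1 : 𝕜))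

theorem outerToK_tmul (k : K) (x : ∀ j, triv (𝕜 := 𝕜) C hi (m j)) :
    outerToK K hi m (k ⊗ₜ[𝕜] PiTensorProduct.tprod 𝕜 x) = (trivProd hi m x) • k := by
  rw [outerToK, LinearMap.comp_apply, TensorProduct.map_tmul, PiTensorProduct.lift.tprod]
  exact TensorProduct.rid_tmul _ _

theorem trivProd_apply (x : Fin r → 𝕜) :
    trivProd (C := C) hi m x = ∏ j, x j := MultilinearMap.mkPiAlgebra_apply x

theorem outerToK_outerOfK (k : K) : outerToK K hi m (outerOfK K hi m k) = k := by
  refine (outerToK_tmul K hi m k fun j => (1 : 𝕜)).trans ?_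
  rw [trivProd_apply]
  simp

theorem outer_ext {β : Fin r → Multiset I} {W : ∀ j, GrMod.{u, v, w'} 𝕜 C (β j)} {V : Type*}
    [AddCommGroup V] [Module 𝕜 V] {f g : Outer K W →ₗ[𝕜] V}
    (h : ∀ k x, f (k ⊗ₜ[𝕜] PiTensorProduct.tprod 𝕜 x) = g (k ⊗ₜ[𝕜] PiTensorProduct.tprod 𝕜 x)) :
    f = g :=
  TensorProduct.ext (LinearMap.ext fun k => PiTensorProduct.ext (MultilinearMap.ext fun x => h k x))

theorem outerOfK_outerToK (t : Outer K (fun j => triv (𝕜 := 𝕜) C hi (m j))) :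
    outerOfK K hi m (outerToK K hi m t) = t := by
  have : outerOfK K hi m ∘ₗ outerToK K hi m = LinearMap.id := by
    refine outer_ext K fun k x => ?_
    rw [LinearMap.comp_apply, outerToK_tmul, map_smul]
    let x' : Fin r → 𝕜 := x
    have h1 := (PiTensorProduct.tprod 𝕜
      (s := fun j => (triv (𝕜 := 𝕜) C hi (m j)).carrier)).map_smul_univ x' (fun _ => (1 : 𝕜))
    have h2 : (fun j => x' j • (1 : 𝕜)) = x := funext fun j => mul_one (x' j)
    refine Eq.trans ?_ (congrArg (fun z => k ⊗ₜ[𝕜] PiTensorProduct.tprod 𝕜 z) h2)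
    refine Eq.trans ?_ (congrArg (fun z => k ⊗ₜ[𝕜] z) h1.symm)
    rw [TensorProduct.tmul_smul, ← trivProd_apply hi m x]
    rfl
  exact LinearMap.congr_fun this t

theorem outerToK_act (a : Alg 𝕜 C ν) (b : ∀ j, Alg 𝕜 C (Multiset.replicate (m j) i))
    (t : Outer K (fun j => triv (𝕜 := 𝕜) C hi (m j))) :
    outerToK K hi m (outerAct K _ a b t) = (∏ j, trivRep hi (m j) (b j)) • a • outerToK K hi m t := by
  have : outerToK K hi m ∘ₗ outerAct K _ a b =
      (∏ j, trivRep hi (m j) (b j)) • K.act a ∘ₗ outerToK K hi m := by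
    refine outer_ext K fun k x => ?_
    rw [LinearMap.comp_apply, outerAct, TensorProduct.map_tmul, PiTensorProduct.map_tprod,
      outerToK_tmul, LinearMap.smul_apply, LinearMap.comp_apply, outerToK_tmul, map_smul, smul_smul]
    congr 1
    let x' : Fin r → 𝕜 := x
    exact (trivProd_apply hi m fun j => trivRep hi (m j) (b j) * x' j).trans
      (Finset.prod_mul_distrib.trans (congrArg _ (trivProd_apply hi m x).symm))
  exact LinearMap.congr_fun this t

theorem outerToK_mem_gr {d : ℤ} {t : Outer K (fun j => triv (𝕜 := 𝕜) C hi (m j))}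
    (ht : t ∈ outerGr K _ d) : outerToK K hi m t ∈ K.gr d := by
  have : outerGr K (fun j => triv (𝕜 := 𝕜) C hi (m j)) d ≤ (K.gr d).comap (outerToK K hi m) := by
    refine Submodule.span_le.2 ?_
    rintro _ ⟨c, e, k, x, hce, hk, hx, rfl⟩
    change outerToK K hi m _ ∈ K.gr d
    rw [outerToK_tmul]
    by_cases h : ∀ j, e j = 0
    · obtain rfl : c = d := by simpa [h] using hce
      exact Submodule.smul_mem _ _ hk
    · push Not at h
      obtain ⟨j, hj⟩ := h
      let x' : 𝕜 := x j
      have h1 : x' ∈ (if e j = 0 then ⊤ else ⊥ : Submodule 𝕜 𝕜) := hx j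
      rw [if_neg hj, Submodule.mem_bot] at h1
      have h2 : trivProd (C := C) hi m x = 0 :=
        (trivProd_apply hi m x).trans (Finset.prod_eq_zero (Finset.mem_univ j) h1)
      rw [h2, zero_smul]
      exact zero_mem _
  exact this ht

theorem outerOfK_mem_gr {d : ℤ} {k : K} (hk : k ∈ K.gr d) :
    outerOfK K hi m k ∈ outerGr K (fun j => triv (𝕜 := 𝕜) C hi (m j)) d := by
  refine Submodule.subset_span ⟨d, fun _ => 0, k, fun _ => (1 : 𝕜), by simp, hk, fun j => ?_, rfl⟩
  change (1 : 𝕜) ∈ (if (0 : ℤ) = 0 then ⊤ else ⊥ : Submodule 𝕜 𝕜)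
  rw [if_pos rfl]
  trivial

variable {K m}

theorem sum_replicate_eq (hm : ∑ j, m j = n) :
    ∑ j, Multiset.replicate (m j) i = Multiset.replicate n i := by
  rw [sum_replicate, hm]

theorem par_left_one (h : ν + ∑ j, Multiset.replicate (m j) i = γ) (a : Alg 𝕜 C ν) :
    par C h a 1 = leftPl C h a := by
  have h1 := juxt_one (𝕜 := 𝕜) (C := C) (i := i) m
  rw [par]
  change hcomp C h a (juxt C _ fun _ => 1) = _
  rw [h1, hcomp, ← leftPl_one, ← leftPl_mul, mul_one]

theorem outerAct_outerOfK (a : Alg 𝕜 C ν) (b : ∀ j, Alg 𝕜 C (Multiset.replicate (m j) i)) (k : K) :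
    outerAct K (fun j => triv (𝕜 := 𝕜) C hi (m j)) a b (outerOfK K hi m k) =
      outerOfK K hi m ((∏ j, trivRep hi (m j) (b j)) • a • k) := by
  rw [← outerOfK_outerToK K hi m (outerAct K _ a b _), outerToK_act, outerToK_outerOfK]

/-- The projection `y ↦ 1_{ν, β} y`. -/
def toParSpace {β : Fin r → Multiset I} (h : ν + ∑ j, β j = γ) :
    Alg 𝕜 C γ →ₗ[𝕜] parSpace (𝕜 := 𝕜) C h :=
  LinearMap.rangeRestrict (LinearMap.mulLeft 𝕜 (par (𝕜 := 𝕜) C h 1 1))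

theorem toParSpace_coe {β : Fin r → Multiset I} (h : ν + ∑ j, β j = γ)
    (y : parSpace (𝕜 := 𝕜) C h) : toParSpace h y.1 = y :=
  Subtype.ext ((mem_parSpace C h).1 y.2)

theorem parAct_toParSpace {β : Fin r → Multiset I} (h : ν + ∑ j, β j = γ) (a : Alg 𝕜 C ν)
    (b : ∀ j, Alg 𝕜 C (β j)) (y : Alg 𝕜 C γ) :
    parAct C h a b (toParSpace h y) = toParSpace h (par C h a b * y) := by
  apply Subtype.ext
  change par C h a b * (par C h 1 1 * y) = par C h 1 1 * (par C h a b * y)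
  rw [← mul_assoc, ← mul_assoc, ← par_mul, ← par_mul, one_mul, one_mul, mul_one, mul_one]

theorem parRight_toParSpace {β : Fin r → Multiset I} (h : ν + ∑ j, β j = γ) (z y : Alg 𝕜 C γ) :
    parRight C h z (toParSpace h y) = toParSpace h (y * z) :=
  Subtype.ext (mul_assoc _ _ _)

/-- Equivariance is a linear condition and holds for the homogeneous maps, so it holds for their
sums. -/
theorem homSpace_act {K : GrMod.{u, v, w} 𝕜 C ν} {β : Fin r → Multiset I}
    {W : ∀ j, GrMod.{u, v, w'} 𝕜 C (β j)} (h : ν + ∑ j, β j = γ) (f : homSpace K W h)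
    (a : Alg 𝕜 C ν) (b : ∀ j, Alg 𝕜 C (β j)) (y : parSpace (𝕜 := 𝕜) C h) :
    f.1 (parAct C h a b y) = outerAct K W a b (f.1 y) := by
  have h1 : homSpace K W h ≤ LinearMap.eqLocus (LinearMap.lcomp 𝕜 (Outer K W) (parAct C h a b))
      (LinearMap.llcomp 𝕜 _ _ _ (outerAct K W a b)) :=
    iSup_le fun d g hg => LinearMap.ext fun y => hg.1 a b y
  exact LinearMap.congr_fun (h1 f.2) y

variable (K m)

/-- The map `R(ν + n i) → K` given by an element of the co-induced module. -/
def coindEval (hm : ∑ j, m j = n) :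
    coindTriv K hi m hm →ₗ[𝕜] Alg 𝕜 C (ν + Multiset.replicate n i) →ₗ[𝕜] K where
  toFun f := outerToK K hi m ∘ₗ f.1 ∘ₗ toParSpace _
  map_add' _ _ := LinearMap.ext fun _ => map_add (outerToK K hi m) _ _
  map_smul' _ _ := LinearMap.ext fun _ => map_smul (outerToK K hi m) _ _

theorem coindEval_par (hm : ∑ j, m j = n) (h : ν + ∑ j, Multiset.replicate (m j) i =
    ν + Multiset.replicate n i) (f : coindTriv K hi m hm) (a : Alg 𝕜 C ν)
    (b : ∀ j, Alg 𝕜 C (Multiset.replicate (m j) i)) (y : Alg 𝕜 C (ν + Multiset.replicate n i)) :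
    coindEval K hi m hm f (par C h a b * y) =
      (∏ j, trivRep hi (m j) (b j)) • a • coindEval K hi m hm f y := by
  change outerToK K hi m (f.1 (toParSpace h _)) = _ • _ • outerToK K hi m (f.1 (toParSpace h _))
  rw [← parAct_toParSpace, ← outerToK_act]
  exact congrArg _ (homSpace_act h f a b _)

/-- The co-induced module embeds into the linear maps `R(ν + n i) → K`. -/
def coindRealization (hm : ∑ j, m j = n) :
    Realization K (coindTriv K hi m hm) (rfl : ν + Multiset.replicate n i = _) where
  toLin := coindEval K hi m hm
  inj f hf := Subtype.ext <| LinearMap.ext fun y => by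
    have h1 := congrArg (outerOfK K hi m) (LinearMap.congr_fun hf y.1)
    rw [LinearMap.zero_apply, map_zero] at h1
    change outerOfK K hi m (outerToK K hi m (f.1 (toParSpace _ y.1))) = 0 at h1
    rwa [outerOfK_outerToK, toParSpace_coe] at h1
  smul z f y := congrArg (fun x => outerToK K hi m (f.1 x)) (parRight_toParSpace _ z y)
  left f a y := by
    have e := sum_replicate_eq (i := i) hm
    have h : ν + ∑ j, Multiset.replicate (m j) i = ν + Multiset.replicate n i := by rw [e]
    have h1 := coindEval_par K hi m hm h f a 1 y
    rw [par_left_one, leftPl_eq_of_eq e h rfl] at h1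
    simpa using h1
  dot f k l hkl y := by
    have e := sum_replicate_eq (i := i) hm
    have h : ν + ∑ j, Multiset.replicate (m j) i = ν + Multiset.replicate n i := by rw [e]
    -- The dot comes from one tensor factor R(μ_j i), and the trivial character of that factor kills
    -- it.
    obtain ⟨b, hb, hb'⟩ := exists_juxt_eq_dot (𝕜 := 𝕜) (C := C) hi m k l (hkl.trans hm.symm)
    have h1 := coindEval_par K hi m hm h f 1 b y
    rw [hb', zero_smul, par, hcomp, hb, leftPl_one, ← rightPl_mul, one_mul,
      rightPl_gen_eq_of_eq e h rfl] at h1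
    exact h1
  mem_gr d f hf e y hy := by
    have h : ν + ∑ j, Multiset.replicate (m j) i = ν + Multiset.replicate n i := by
      rw [sum_replicate_eq hm]
    refine outerToK_mem_gr K hi m (hf.2 e (toParSpace h y) ?_)
    have := mul_mem_gr C (par_one_mem_gr C h) hy
    rwa [zero_add] at this

/-- Equivariance under R(ν) ⊗ R(ni) implies equivariance under the smaller R(ν) ⊗ R(μi), by
`charOf_juxt`. This realizes the co-induced module of K ⊗ V(i^n) inside that of K ⊗ V(i^μ). -/
theorem exists_coindEval_eq (hm : ∑ j, m j = n) {d : ℤ}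
    (F : Alg 𝕜 C (ν + Multiset.replicate n i) →ₗ[𝕜] K)
    (hF : ∀ a c y, F (leftPl C rfl a * rightPl C rfl c * y) = charOf hi rfl c • a • F y)
    (hd : ∀ e, ∀ y ∈ Alg.gr 𝕜 C _ e, F y ∈ K.gr (e + d)) :
    ∃ f ∈ (coindTriv K hi m hm).gr d, coindEval K hi m hm f = F := by
  -- The equivariance is transported to a weight that only propositionally equals ni, such as the
  -- sum of the blocks.
  have key : ∀ (ν' : Multiset I) (e : ν' = Multiset.replicate n i)
      (h : ν + ν' = ν + Multiset.replicate n i) (a : Alg 𝕜 C ν) (c : Alg 𝕜 C ν') y,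
      F (hcomp C h a c * y) = charOf hi e c • a • F y := by
    rintro _ rfl h a c y
    exact hF a c y
  have e := sum_replicate_eq (i := i) hm
  have h : ν + ∑ j, Multiset.replicate (m j) i = ν + Multiset.replicate n i := by rw [e]
  have hpar : ∀ a b y, F (par C h a b * y) = (∏ j, trivRep hi (m j) (b j)) • a • F y := by
    intro a b y
    rw [par, key _ e, charOf_juxt]
  have hf : outerOfK K hi m ∘ₗ F ∘ₗ (parSpace (𝕜 := 𝕜) C h).subtype ∈ homGr K _ h d := by
    refine ⟨fun a b y => ?_, fun e' y hy => outerOfK_mem_gr K hi m (hd e' y.1 hy)⟩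
    change outerOfK K hi m (F (par C h a b * y.1)) = outerAct K _ a b (outerOfK K hi m (F y.1))
    rw [outerAct_outerOfK, hpar]
  refine ⟨⟨_, Submodule.mem_iSup_of_mem d hf⟩, hf, LinearMap.ext fun y => ?_⟩
  change outerToK K hi m (outerOfK K hi m (F (par C h 1 1 * y))) = F y
  rw [outerToK_outerOfK, hpar]
  simp

end Coinduced

/-! ### The socle and its independence of the composition -/

section Socle

variable {𝕜 : Type u} [Field 𝕜] {I : Type v} [DecidableEq I] {C : BorcherdsCartan I}
  {ν γ : Multiset I} {i : I} {n : ℕ} {K : GrMod.{u, v, w} 𝕜 C ν}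
  {h : ν + Multiset.replicate n i = γ} {hi : C.a i i ≤ 0}

/-- The annihilator of an element can be read off from the map it defines, which makes elements of
different modules comparable. -/
theorem Realization.smul_eq_zero_iff {M : GrMod.{u, v, w'} 𝕜 C γ} (Φ : Realization K M h)
    (z : Alg 𝕜 C γ) (f : M) : z • f = 0 ↔ ∀ y, Φ.toLin f (y * z) = 0 := by
  refine ⟨fun h0 y => by rw [← Φ.smul, h0, map_zero, LinearMap.zero_apply], fun h0 => ?_⟩
  exact Φ.inj _ (LinearMap.ext fun y => (Φ.smul z f y).trans (h0 y))

/-- If homogeneous elements of `M` and `M'` of the same degree give the same nonzero map, then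
`M` and `M'` have isomorphic gr-irreducible socles. -/
theorem Realization.soc_of_toLin_eq {M M' : GrMod.{u, v, w'} 𝕜 C γ}
    (Φ : Realization K M h) (Φ' : Realization K M' h) (hi : C.a i i ≤ 0) (hε : K.eps i = 0)
    (hK : K.IsIrreducible) {d : ℤ} {f : M} {f' : M'} (hf : f ∈ M.gr d) (hf' : f' ∈ M'.gr d)
    (h0 : f ≠ 0) (heq : Φ.toLin f = Φ'.toLin f') :
    M.soc.IsIrreducible ∧ M.soc.eps i = n ∧ M.soc.Iso M'.soc := by
  have hann : ∀ z : Alg 𝕜 C γ, z • f = 0 ↔ z • f' = 0 := fun z => by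
    rw [Φ.smul_eq_zero_iff, Φ'.smul_eq_zero_iff, heq]
  obtain ⟨z, e, hz, hz0, hzt⟩ := Φ.exists_isTrivial hi hε h0
  -- Triviality of z • f says that certain elements of R(γ) annihilate f, so it is inherited by f'.
  have hzt' : IsTrivial M' h hi (z • f') := by
    intro c
    have h1 := hzt c
    rw [← sub_eq_zero, smul_smul, ← smul_assoc, ← sub_smul] at h1 ⊢
    exact (hann _).1 h1
  have hg := M.smul_mem _ _ _ hz _ hf
  have hg' := M'.smul_mem _ _ _ hz _ hf'
  have hmem := Φ.mem_of_isTrivial hε hK hzt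
  have hmem' := Φ'.mem_of_isTrivial hε hK hzt'
  have hs := M.socle_eq_span hg hz0 hmem
  have hs' := M'.socle_eq_span hg' (fun h1 => hz0 ((hann z).2 h1)) hmem'
  refine ⟨M.sub_isIrreducible hz0 hmem _ hs, ?_, M.sub_iso M' hg hg' (fun a => ?_) _ hs _ hs'⟩
  · exact Φ.soc_eps hε (hs ▸ Submodule.mem_span_singleton_self _) hz0 hzt
  · rw [smul_smul, smul_smul, hann]

theorem GrMod.top_isHomogeneous (M : GrMod.{u, v, w} 𝕜 C γ) : M.IsHomogeneous ⊤ := by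
  intro x _
  simp [M.gr_iSup]

/-- A single nonzero map equivariant for R(ν) ⊗ R(ni) is an element of both co-induced modules,
whatever the two compositions, and in the same degree. -/
theorem coindTriv_socle (hi : C.a i i ≤ 0) (hK : K.IsIrreducible) (hε : K.eps i = 0) {r r' : ℕ}
    (m : Fin r → ℕ) (hm : ∑ j, m j = n) (m' : Fin r' → ℕ) (hm' : ∑ j, m' j = n) :
    (coindTriv K hi m hm).soc.IsIrreducible ∧ (coindTriv K hi m hm).soc.eps i = n ∧
      (coindTriv K hi m hm).soc.Iso (coindTriv K hi m' hm').soc := by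
  have := hK.1
  obtain ⟨d, k, -, hkd, hk0⟩ := K.exists_homogeneous K.top_isHomogeneous top_ne_bot
  obtain ⟨F, hF1, hF, hFd⟩ := exists_hom (n := n) hi rfl hkd
  obtain ⟨f, hf, hfF⟩ := exists_coindEval_eq K hi m hm F hF hFd
  obtain ⟨f', hf', hfF'⟩ := exists_coindEval_eq K hi m' hm' F hF hFd
  refine (coindRealization K hi m hm).soc_of_toLin_eq (coindRealization K hi m' hm') hi hε
    hK hf hf' ?_ (hfF.trans hfF'.symm)
  rintro rfl
  rw [map_zero] at hfF
  rw [← hfF, LinearMap.zero_apply] at hF1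
  exact hk0 hF1.symm

end Socle

end QHA

end

theorem lemmaL5 {𝕜 : Type u} [Field 𝕜] [IsAlgClosed 𝕜] {I : Type v} [DecidableEq I]
    (C : QHA.BorcherdsCartan I) (i : I) (hi : C.a i i ≤ 0) (ν : Multiset I)
    (K : QHA.GrMod.{u, v, w} 𝕜 C ν) (hfin : FiniteDimensional 𝕜 K) (hirr : K.IsIrreducible)
    (hε : K.eps i = 0) (n : ℕ) (μ : Composition n) :
    (QHA.coindTriv K hi μ.blocksFun μ.sum_blocksFun).soc.IsIrreducible ∧
    (QHA.coindTriv K hi μ.blocksFun μ.sum_blocksFun).soc.eps i = n ∧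
    (QHA.coindTriv K hi μ.blocksFun μ.sum_blocksFun).soc.Iso
      (QHA.coindTriv K hi (fun _ : Fin 1 => n) (Fin.sum_univ_one _)).soc := by
  exact QHA.coindTriv_socle hi hirr hε _ _ _ _
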